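/- Let $k$ be a field, let $\overline X$ be a proper $k$-scheme, let $D$ be an effective Cartier divisor on $\overline X$ with support $|D|$, and let $X=\overline X\setminus|D|$. Let $Z_0(X)$ be the free abelian group on the closed points of $X$. For an integral scheme $\overline C$ and a closed subscheme $E\subseteq\overline C$, let $G(\overline C,E)=\bigcap_{x\in E}\ker\bigl(\mathcal O_{\overline C,x}^\times\to\mathcal O_{E,x}^\times\bigr)$, the intersection being taken in $k(\overline C)^\times$. The *Chow group of zero-cycles with modulus* $\mathrm{CH}_0(\overline X|D)$ is the quotient of $Z_0(X)$ by the subgroup generated by the cycles $(\varphi|_{\varphi^{-1}(X)})_*\operatorname{div}_{\overline C}(f)$, where $\varphi\colon\overline C\to\overline X$ runs over the finite morphisms from integral normal curves with $\varphi(\overline C)\not\subseteq |D|$, and $f$ over $G(\overline C,\varphi^*D)$. The *zeroth Suslin homology group* $H_0^{\mathrm{Sing}}(X)$ is the cokernel of $\partial_0-\partial_1\colon C_0(X\times_k\mathbb A^1/\mathbb A^1)\to Z_0(X)$, where $C_0(X\times_k\mathbb A^1/\mathbb A^1)$ is the free abelian group on the closed integral subschemes $W\subseteq X\times_k\mathbb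 A^1$ that are finite and surjective over $\mathbb A^1$, and $\partial_a(W)$ is the cycle on $X$ of the fibre of $W$ over $t=a$. (Equivalently, one may replace $(\mathbb A^1;0,1)$ by $(\mathbb P^1\setminus\{1\};0,\infty)$.) **Theorem.** The identity map of $Z_0(X)$ induces a surjective homomorphism $\pi\colon \mathrm{CH}_0(\overline X|D)\to H_0^{\mathrm{Sing}}(X)$. Its kernel $U(\overline X|D)$ has the following properties. 1. If $\operatorname{char} k=0$, then $U(\overline X|D)$ is a divisible group. 2. If $\operatorname{char} k=p>0$, then $U(\overline X|D)$ is a $p$-primary torsion group. -/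

import Mathlib

open AlgebraicGeometry CategoryTheory CategoryTheory.Limits

universe u

noncomputable section

namespace ZeroCyclesWithModulus

/-! ### Zero-cycles -/

/-- The closed points of a scheme. -/
abbrev ClosedPoint (X : Scheme.{u}) : Type u :=
  {x : X // IsClosed ({x} : Set X)}

/-- The group `Z₀(X)` of zero-cycles: the free abelian group on the closed points of `X`. -/
abbrev ZeroCycle (X : Scheme.{u}) : Type u :=
  ClosedPoint X →₀ ℤ

/-- The image of a closed point under a finite morphism. -/
def ClosedPoint.map {Y X : Scheme.{u}} (g : Y ⟶ X) [IsFinite g] (y : ClosedPoint Y) :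
    ClosedPoint X :=
  ⟨g y.1, by simpa using g.isClosedMap _ y.2⟩

/-- Push-forward of zero-cycles along a finite morphism: `[y] ↦ [κ(y) : κ(g y)] [g y]`. -/
def pushforward {Y X : Scheme.{u}} (g : Y ⟶ X) [IsFinite g] : ZeroCycle Y →+ ZeroCycle X :=
  Finsupp.liftAddHom fun y =>
    (Finsupp.singleAddHom (y.map g)).comp (AddMonoidHom.mulLeft (g.residueDegree y.1 : ℤ))

/-- The cycle `∑ length (𝒪_{Z,z}) [z]` of a scheme `Z`, the sum running over its closed points.
It is only used for schemes that are finite over a field, where the sum and the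
lengths are finite. -/
def fundamentalCycle (Z : Scheme.{u}) : ZeroCycle Z :=
  ∑ᶠ z : ClosedPoint Z, Finsupp.single z
    ((Module.length (Z.presheaf.stalk z.1) (Z.presheaf.stalk z.1)).toNat : ℤ)

/-- The restriction to an open subscheme `U` of the divisor of a rational function `f` on an
integral curve `C`: the sum of `ord_x(f) [x]` over the closed points `x` of `U`. On a noetherian
curve the order is non-zero at only finitely many `x`. -/
def divOn {C : Scheme.{u}} [IsIntegral C] [IsLocallyNoetherian C] (U : C.Opens)
    (f : C.functionFieldˣ) : ZeroCycle (U : Scheme.{u}) :=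
  ∑ᶠ x : ClosedPoint (U : Scheme.{u}),
    Finsupp.single x (Scheme.ord (f : C.functionField) (U.ι x.1))

/-! ### Effective Cartier divisors and the modulus condition -/

/-- An effective Cartier divisor on `X`: a closed subscheme (given by its ideal sheaf) which
locally on `X` is cut out by a single non-zero-divisor. -/
structure EffectiveCartierDivisor (X : Scheme.{u}) where
  /-- The ideal sheaf of the divisor. -/
  ideal : X.IdealSheafData
  locally_principal : ∀ x : X, ∃ U : X.affineOpens, x ∈ U.1 ∧
    ∃ a ∈ nonZeroDivisors Γ(X, U.1), ideal.ideal U = Ideal.span {a}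

/-- The open complement `X ∖ |D|` of the support of an effective Cartier divisor. -/
def EffectiveCartierDivisor.compl {X : Scheme.{u}} (D : EffectiveCartierDivisor X) : X.Opens :=
  D.ideal.support.compl

/-- The stalk `I_x ⊆ 𝒪_{X,x}` of a quasi-coherent ideal sheaf `I`, so that the local ring at `x` of
the closed subscheme defined by `I` is `𝒪_{X,x} / I_x`. -/
def stalkIdeal {X : Scheme.{u}} (I : X.IdealSheafData) (x : X) : Ideal (X.presheaf.stalk x) :=
  ⨆ (U : X.affineOpens) (hU : x ∈ U.1), (I.ideal U).map (X.presheaf.germ U.1 x hU).hom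

/-- The group `G(C, E) = ⋂_{x ∈ E} Ker (𝒪_{C,x}ˣ → 𝒪_{E,x}ˣ)` of rational functions on `C` which
satisfy the modulus condition with respect to the closed subscheme `E`; the intersection is taken
in the multiplicative group of the function field of `C`. -/
def modulusGroup {C : Scheme.{u}} [IsIntegral C] (E : C.IdealSheafData) :
    Subgroup C.functionFieldˣ :=
  ⨅ x ∈ E.support,
    (Units.map (Ideal.Quotient.mk (stalkIdeal E x)).toMonoidHom).ker.map
      (Units.map (algebraMap (C.presheaf.stalk x) C.functionField).toMonoidHom)

/-! ### The Chow group of zero-cycles with modulus -/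

/-- `φ : C ⟶ X` is a finite morphism from an integral normal curve whose image is not contained in
`D`. (When `X` is of finite type over a field, `C` is automatically locally noetherian.) -/
structure IsAdmissibleCurve {X : Scheme.{u}} (D : EffectiveCartierDivisor X) {C : Scheme.{u}}
    (φ : C ⟶ X) : Prop where
  isIntegral : IsIntegral C
  isLocallyNoetherian : IsLocallyNoetherian C
  dim_eq_one : topologicalKrullDim C = 1
  normal : ∀ x : C, IsIntegrallyClosed (C.presheaf.stalk x)
  isFinite : IsFinite φ
  not_subset : ¬ Set.range φ ⊆ (D.ideal.support : Set X)

/-- The cycle `τ_C(f) = (φ|_{φ⁻¹(X ∖ |D|)})_* div_C(f)` on `X ∖ |D|`. -/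
def tau {X : Scheme.{u}} (D : EffectiveCartierDivisor X) {C : Scheme.{u}} [IsIntegral C]
    [IsLocallyNoetherian C] (φ : C ⟶ X) [IsFinite φ] (f : C.functionFieldˣ) :
    ZeroCycle (D.compl : Scheme.{u}) :=
  pushforward (φ ∣_ D.compl) (divOn (φ ⁻¹ᵁ D.compl) f)

/-- The subgroup of `Z₀(X ∖ |D|)` generated by the cycles `τ_C(f)`, for all finite morphisms
`φ : C ⟶ X` from integral normal curves with image not contained in `D` and all
`f ∈ G(C, φ^* D)`. -/
def modulusRelations {X : Scheme.{u}} (D : EffectiveCartierDivisor X) :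
    AddSubgroup (ZeroCycle (D.compl : Scheme.{u})) :=
  AddSubgroup.closure {z | ∃ (C : Scheme.{u}) (φ : C ⟶ X) (h : IsAdmissibleCurve D φ),
    haveI := h.isIntegral
    haveI := h.isLocallyNoetherian
    haveI := h.isFinite
    ∃ f ∈ modulusGroup (D.ideal.comap φ), z = tau D φ f}

/-- The Chow group `CH₀(X|D)` of zero-cycles with modulus. -/
abbrev ChowGroupWithModulus {X : Scheme.{u}} (D : EffectiveCartierDivisor X) : Type u :=
  ZeroCycle (D.compl : Scheme.{u}) ⧸ modulusRelations D

/-! ### Suslin homology in degree zero -/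

section Suslin

variable (k : Type u) [Field k]

/-- The affine line over `k`. -/
abbrev affineLine : Scheme.{u} := Spec (CommRingCat.of (Polynomial k))

/-- The structure morphism of the affine line. -/
abbrev affineLineToSpec : affineLine k ⟶ Spec (CommRingCat.of k) :=
  Spec.map (CommRingCat.ofHom (Polynomial.C : k →+* Polynomial k))

/-- The rational point `t = a` of the affine line. -/
abbrev affineLinePoint (a : k) : Spec (CommRingCat.of k) ⟶ affineLine k :=
  Spec.map (CommRingCat.ofHom (Polynomial.evalRingHom a))

/-- The closed integral subschemes of `X` that are finite and surjective over `S`. -/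
structure FiniteCorrespondenceGenerator {X S : Scheme.{u}} (p : X ⟶ S) where
  /-- The ideal sheaf of the closed subscheme. -/
  ideal : X.IdealSheafData
  isIntegral : IsIntegral ideal.subscheme
  isFinite : IsFinite (ideal.subschemeι ≫ p)
  surjective : Surjective (ideal.subschemeι ≫ p)

/-- The group `C₀(X/S)`: the free abelian group on the closed integral subschemes of `X` that are
finite and surjective over `S`. -/
abbrev FiniteCorrespondence {X S : Scheme.{u}} (p : X ⟶ S) : Type u :=
  FiniteCorrespondenceGenerator p →₀ ℤ

variable {k} {X : Scheme.{u}} (s : X ⟶ Spec (CommRingCat.of k))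

/-- The projection `X ×ₖ 𝔸¹ ⟶ 𝔸¹`. -/
abbrev cylinderProj : pullback s (affineLineToSpec k) ⟶ affineLine k :=
  pullback.snd s (affineLineToSpec k)

variable {s}

/-- The fibre over `t = a` of a closed subscheme `W` of `X ×ₖ 𝔸¹`. -/
abbrev fibreAt (W : FiniteCorrespondenceGenerator (cylinderProj s)) (a : k) : Scheme.{u} :=
  pullback (W.ideal.subschemeι ≫ cylinderProj s) (affineLinePoint k a)

/-- The morphism from the fibre of `W ⊆ X ×ₖ 𝔸¹` over `t = a` to `X`; it is the closed immersion
`W ∩ (X × {a}) ⟶ X × {a} = X`. -/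
abbrev fibreToBase (W : FiniteCorrespondenceGenerator (cylinderProj s)) (a : k) :
    fibreAt W a ⟶ X :=
  pullback.fst _ _ ≫ W.ideal.subschemeι ≫ pullback.fst s (affineLineToSpec k)

lemma affineLinePoint_comp (a : k) :
    affineLinePoint k a ≫ affineLineToSpec k = 𝟙 _ := by
  rw [← Spec.map_comp, ← CommRingCat.ofHom_comp, ← Spec.map_id]
  congr 1
  ext x
  simp

lemma fibreToBase_comp (W : FiniteCorrespondenceGenerator (cylinderProj s)) (a : k) :
    fibreToBase W a ≫ s = pullback.snd _ _ := by
  have h1 : pullback.fst s (affineLineToSpec k) ≫ s = cylinderProj s ≫ affineLineToSpec k :=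
    pullback.condition
  have h2 : pullback.fst (W.ideal.subschemeι ≫ cylinderProj s) (affineLinePoint k a) ≫
      (W.ideal.subschemeι ≫ cylinderProj s) = pullback.snd _ _ ≫ affineLinePoint k a :=
    pullback.condition
  simp only [Category.assoc] at h2 ⊢
  rw [h1, reassoc_of% h2, affineLinePoint_comp, Category.comp_id]

instance fibreToBase_isFinite [IsSeparated s] (W : FiniteCorrespondenceGenerator (cylinderProj s))
    (a : k) : IsFinite (fibreToBase W a) := by
  have := W.isFinite
  have h : IsFinite (fibreToBase W a ≫ s) := by
    rw [fibreToBase_comp]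
    infer_instance
  exact MorphismProperty.of_postcomp @IsFinite (W' := @IsSeparated) _ s inferInstance h

variable (s)

/-- The map `∂_a : C₀(X ×ₖ 𝔸¹ / 𝔸¹) → Z₀(X)` induced by the point `t = a`, sending `W` to the
cycle of its fibre over `t = a` (`W` is flat over `𝔸¹`, so no higher Tor terms occur). -/
def boundaryAt [IsSeparated s] (a : k) :
    FiniteCorrespondence (cylinderProj s) →+ ZeroCycle X :=
  Finsupp.liftAddHom fun W =>
    zmultiplesHom _ (pushforward (fibreToBase W a) (fundamentalCycle (fibreAt W a)))

/-- The boundary map `∂ = ∂₀ - ∂₁`. -/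
def boundary [IsSeparated s] : FiniteCorrespondence (cylinderProj s) →+ ZeroCycle X :=
  boundaryAt s 0 - boundaryAt s 1

/-- The zeroth Suslin homology group `H₀^Sing(X)` of a separated `k`-scheme of finite type:
the cokernel of `∂ : C₀(X ×ₖ 𝔸¹ / 𝔸¹) → Z₀(X)`. The triple `(𝔸¹; 0, 1)` is isomorphic to
`(ℙ¹ ∖ {1}; 0, ∞)`, through the coordinate `t / (t - 1)` on the latter. -/
abbrev SuslinHomologyZero [IsSeparated s] : Type u :=
  ZeroCycle X ⧸ (boundary s).range

end Suslin

end ZeroCyclesWithModulus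

end

open ZeroCyclesWithModulus

/-!
Write `R(D)` for the relations which define `CH₀(X|D)`, and `R_red` for the larger group of relations
in which the modulus condition is weakened: on a finite normal curve `φ : C ⟶ X` all functions `f` are
allowed which are regular with value `1` at the points above `D` (`reducedRelations`). The theorem
rests on two facts.

First, `R_red` is the group of boundaries of Suslin homology (`range_boundary_eq_reducedRelations`),
so that the kernel of `π` is `R_red / R(D)`. The function `f` corresponds to `u = f / (f - 1)`, which
has a pole exactly where `f = 1`. If `f` has value `1` along `D`, then the closure of the graph of `u`
in `X × 𝔸¹` does not meet `D × 𝔸¹`; it is finite over `𝔸¹`, and its boundary is the cycle of `f` up to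
the degree of the function field of `C` over that of the graph (`tau_mem_range_boundary` takes care of
that degree). Conversely, the boundary of an integral `W` which maps to a closed point vanishes, since
all fibres of `W` over `𝔸¹` have the same degree (`boundary_single_eq_zero`); otherwise the
normalization `C` of `X` in the function field of `W` is a finite normal curve over `X`, and
`∂ W` is the cycle on `C` of `u / (u - 1)`, for the coordinate `u` of `𝔸¹`
(`exists_tau_eq_boundary_of_not_isClosed`).

Both directions need to compare orders of vanishing on `C` with multiplicities of fibres of `W`
(`pushforward_zerosOn`). Points of `C` and of `W` are compared through the valuation rings of the
function field `K` of `C` which are centred at them (`IsCenter`): by the valuative criterion the closed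
points of `C` at which `u` is regular are the valuation rings `V ≠ K` of `K` which contain `k[u]`, and these
dominate the local rings of `W`. The comparison then becomes the formula
`∑ ord_V(t) [κ(V) : k] = d ℓ(A / t) [κ(A) : k]` for the valuation rings `V` which dominate a
one-dimensional local domain `A` (`exists_finset_dominates_sum_eq`). It requires that integral
closures in function fields of one variable are finite, over an arbitrary field `k`
(`finite_integralClosure_polynomial`).

Second, let `f` have value `1` along `D`. Locally above `D`, write `f = 1 + h` with `h` in the maximal
ideal; since only finitely many points lie above `D`, there is an `N` such that `h ^ N` lies in the
ideal of the divisor at all of them (`exists_pow_mem_stalkIdeal`). In characteristic `p`, the function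
`f ^ (p ^ m) = 1 + h ^ (p ^ m)` satisfies the modulus condition as soon as `p ^ m ≥ N`. In
characteristic zero, let `P` be a truncation of the binomial series of `(1 + T) ^ (1 / n)`
(`exists_X_pow_dvd_sub_pow`); then `f / P(f - 1) ^ n` satisfies the modulus condition, and the cycle of
`f` is `n` times that of `P(f - 1)` modulo `R(D)`. So `R_red / R(D)` is `p`-primary torsion in
characteristic `p`, and divisible in characteristic zero.
-/

noncomputable section

namespace ZeroCyclesWithModulus

/-! ### Lengths -/

section Length

open Module IsLocalRing

lemma length_eq_mul_length_residueField (k A M : Type*) [Field k] [CommRing A] [IsLocalRing A]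
    [Algebra k A] [AddCommGroup M] [Module k M] [Module A M] [IsScalarTower k A M] :
    length k M = length A M * length k (ResidueField A) := by
  have h1 := IsLocalRing.length_restrictScalars k A M
  have h2 := IsLocalRing.length_restrictScalars k A (ResidueField A)
  have h3 : length A (ResidueField A) = 1 := by
    rw [length_eq_one_iff]
    exact (isSimpleModule_iff_quot_maximal).2 ⟨maximalIdeal A, inferInstance, ⟨LinearEquiv.refl _ _⟩⟩
  rw [h1, h2, h3, one_mul]

lemma length_eq_sum_primeSpectrum (k E : Type*) [Field k] [CommRing E] [IsArtinianRing E]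
    [Algebra k E] [Fintype (PrimeSpectrum E)] :
    length k E = ∑ p : PrimeSpectrum E,
      length (Localization.AtPrime p.asIdeal) (Localization.AtPrime p.asIdeal) *
        length k (ResidueField (Localization.AtPrime p.asIdeal)) := by
  have e := ((PrimeSpectrum.toPiLocalizationEquiv E).restrictScalars k).toLinearEquiv
  rw [e.length_eq, Module.length_pi_of_fintype]
  refine Finset.sum_congr rfl fun p _ => ?_
  exact length_eq_mul_length_residueField k _ _

end Length

section Rank

open Module

/-- A finite torsion module over a one-dimensional noetherian ring has finite length, as it is a module
over the artinian ring `A / a` for some non-zero-divisor `a`. -/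
lemma isFiniteLength_of_isTorsion (A Q : Type*) [CommRing A] [IsNoetherianRing A]
    [Ring.KrullDimLE 1 A] [AddCommGroup Q] [Module A Q] [Module.Finite A Q]
    (hQ : Module.IsTorsion A Q) : IsFiniteLength A Q := by
  obtain ⟨a, ha, ha'⟩ := Submodule.annihilator_top_inter_nonZeroDivisors hQ
  have hfl := isFiniteLength_quotient_span_singleton A ha'
  have : IsArtinianRing (A ⧸ Ideal.span {a}) := by
    have h2 := Module.length_ne_top_iff.mpr hfl
    rw [Module.length_eq_of_surjective (R := A ⧸ Ideal.span {a}) Ideal.Quotient.mk_surjective,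
      Module.length_ne_top_iff] at h2
    exact (isFiniteLength_iff_isNoetherian_isArtinian.mp h2).2
  have htors : Module.IsTorsionBySet A Q (Ideal.span {a} : Ideal A) := by
    refine (Module.isTorsionBySet_span_singleton_iff a).mpr fun x => ?_
    exact Submodule.mem_annihilator.mp ha x trivial
  let inst : Module (A ⧸ Ideal.span {a}) Q := htors.module
  have : IsScalarTower A (A ⧸ Ideal.span {a}) Q := htors.isScalarTower
  have : Module.Finite (A ⧸ Ideal.span {a}) Q := Module.Finite.of_restrictScalars_finite A _ _
  rw [← Module.length_ne_top_iff,
    Module.length_eq_of_surjective (R := A ⧸ Ideal.span {a}) Ideal.Quotient.mk_surjective]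
  exact Module.length_ne_top

variable (A S : Type*) [CommRing A] [IsDomain A] [IsNoetherianRing A] [Ring.KrullDimLE 1 A]
  [AddCommGroup S] [Module A S] [Module.Finite A S] [Module.IsTorsionFree A S]

/-- For a finite torsion-free module `S` of rank `d` over a one-dimensional noetherian domain `A`
one has `ℓ(S / t S) = d ℓ(A / t A)`: compare `S` with a free submodule of full rank, on whose
cokernel, which has finite length, multiplication by `t` has Herbrand quotient one. -/
lemma length_quotient_smul_top (t : A) (ht : t ≠ 0) :
    length A (S ⧸ (LinearMap.range (LinearMap.lsmul A S t))) =
      finrank A S * length A (A ⧸ Ideal.span {t}) := by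
  obtain ⟨b, hb⟩ := exists_linearIndependent_of_le_finrank (R := A) (M := S) le_rfl
  generalize hd : finrank A S = d at b hb ⊢
  let i : (Fin d → A) →ₗ[A] S := Fintype.linearCombination A b
  have hi : Function.Injective i := hb.fintypeLinearCombination_injective
  have hQ : IsFiniteLength A (S ⧸ LinearMap.range i) := by
    apply isFiniteLength_of_isTorsion
    rw [← Module.finrank_eq_zero_iff_isTorsion]
    have h1 : finrank A (S ⧸ LinearMap.range i) + finrank A (LinearMap.range i) = finrank A S :=
      Submodule.finrank_quotient_add_finrank _
    rw [LinearMap.finrank_range_of_inj hi] at h1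
    simp only [finrank_fintype_fun_eq_card, Fintype.card_fin] at h1
    omega
  have hinj : Function.Injective (LinearMap.lsmul A S t) := by
    intro x y h
    exact smul_right_injective S ht h
  let m := LinearMap.lsmul A S t
  let N := LinearMap.range (m ∘ₗ i)
  -- two filtrations of `S / t F`, through `F` and through `t S`, for the free submodule `F`
  have key1 : length A (S ⧸ N) =
      length A (Fin d → A ⧸ Ideal.span {t}) + length A (S ⧸ LinearMap.range i) := by
    let p : (Fin d → A) →ₗ[A] (Fin d → A ⧸ Ideal.span {t}) :=
      LinearMap.compLeft (Ideal.span {t} : Submodule A A).mkQ _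
    have hp : Function.Surjective p := by
      intro y
      choose z hz using fun j => Submodule.mkQ_surjective _ (y j)
      exact ⟨z, funext hz⟩
    have hker : LinearMap.ker p = LinearMap.ker (N.mkQ ∘ₗ i) := by
      ext x
      rw [LinearMap.mem_ker, LinearMap.mem_ker, LinearMap.comp_apply, Submodule.mkQ_apply,
        Submodule.Quotient.mk_eq_zero]
      constructor
      · intro h
        have : ∀ j, ∃ y, t * y = x j := fun j => by
          have := congrFun h j
          simp only [p, LinearMap.compLeft_apply, Pi.zero_apply, Function.comp, Submodule.mkQ_apply,
            Submodule.Quotient.mk_eq_zero] at this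
          obtain ⟨y, hy⟩ := Ideal.mem_span_singleton'.mp this
          exact ⟨y, by rw [mul_comm]; exact hy⟩
        choose y hy using this
        refine ⟨y, ?_⟩
        have : x = t • y := funext fun j => (hy j).symm
        rw [this, map_smul]
        rfl
      · rintro ⟨y, hy⟩
        have : x = t • y := hi (by rw [map_smul, ← hy]; rfl)
        rw [this, map_smul]
        ext j
        simp only [p, LinearMap.compLeft_apply, Pi.zero_apply, Pi.smul_apply, Function.comp,
          Submodule.mkQ_apply, ← Submodule.Quotient.mk_smul, Submodule.Quotient.mk_eq_zero]
        exact Ideal.mem_span_singleton'.mpr ⟨y j, by simp [mul_comm]⟩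
    let e := p.quotKerEquivOfSurjective hp
    rw [← e.length_eq]
    let f : ((Fin d → A) ⧸ LinearMap.ker p) →ₗ[A] S ⧸ N :=
      (LinearMap.ker p).liftQ (N.mkQ ∘ₗ i) hker.le
    have hf : Function.Injective f := by
      rw [← LinearMap.ker_eq_bot]
      exact Submodule.ker_liftQ_eq_bot _ _ _ hker.ge
    have hN : N ≤ LinearMap.range i := by
      rintro _ ⟨x, rfl⟩
      exact ⟨t • x, by rw [map_smul]; rfl⟩
    refine Module.length_eq_add_of_exact f (Submodule.factor hN) hf
      (Submodule.factor_surjective hN) ?_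
    rw [LinearMap.exact_iff, Submodule.factor, Submodule.ker_mapQ, Submodule.range_liftQ,
      LinearMap.range_comp]
    rfl
  have key2 : length A (S ⧸ N) =
      length A (S ⧸ LinearMap.range i) + length A (S ⧸ LinearMap.range m) := by
    have hker : LinearMap.range i = LinearMap.ker (N.mkQ ∘ₗ m) := by
      rw [LinearMap.ker_comp, Submodule.ker_mkQ]
      simp only [N, LinearMap.range_comp]
      exact (Submodule.comap_map_eq_of_injective hinj _).symm
    let f : (S ⧸ LinearMap.range i) →ₗ[A] S ⧸ N :=
      (LinearMap.range i).liftQ (N.mkQ ∘ₗ m) hker.le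
    have hf : Function.Injective f := by
      rw [← LinearMap.ker_eq_bot]
      exact Submodule.ker_liftQ_eq_bot _ _ _ hker.ge
    have hN : N ≤ LinearMap.range m := LinearMap.range_comp_le_range _ _
    refine Module.length_eq_add_of_exact f (Submodule.factor hN) hf
      (Submodule.factor_surjective hN) ?_
    rw [LinearMap.exact_iff, Submodule.factor, Submodule.ker_mapQ, Submodule.range_liftQ,
      LinearMap.range_comp]
    rfl
  have hpi : length A (Fin d → A ⧸ Ideal.span {t}) = d * length A (A ⧸ Ideal.span {t}) := by
    rw [Module.length_pi]; simp
  rw [hpi, key2, add_comm] at key1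
  exact (ENat.add_left_injective_of_ne_top (Module.length_ne_top_iff.mpr hQ)) key1

end Rank

/-! ### Valuation rings above a local ring of dimension one -/

section Dominating

open Module IsLocalRing

/-- The (possibly trivial) places of `K / k`: the valuation rings of `K` which contain `k`. -/
@[ext]
structure Place (k K : Type*) [Field k] [Field K] [Algebra k K] where
  /-- The valuation ring. -/
  ring : ValuationSubring K
  algebraMap_mem : ∀ x : k, algebraMap k K x ∈ ring

instance (k K : Type*) [Field k] [Field K] [Algebra k K] (V : Place k K) : Algebra k V.ring :=
  ((algebraMap k K).codRestrict V.ring.toSubring V.algebraMap_mem).toAlgebra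

instance (k K : Type*) [Field k] [Field K] [Algebra k K] (V : Place k K) :
    IsScalarTower k V.ring K := .of_algebraMap_eq fun _ => rfl

lemma mem_of_isIntegral_of_forall_mem {A K : Type*} [CommRing A] [Field K] [Algebra A K]
    (V : ValuationSubring K) (hV : ∀ a : A, algebraMap A K a ∈ V) {x : K} (hx : IsIntegral A x) :
    x ∈ V := by
  let f : A →+* V := (algebraMap A K).codRestrict V.toSubring hV
  have : IsIntegral V x := by
    obtain ⟨p, hp, h⟩ := hx
    refine ⟨p.map f, hp.map f, ?_⟩
    rw [Polynomial.eval₂_map]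
    exact h
  obtain ⟨y, rfl⟩ := IsIntegrallyClosed.isIntegral_iff.mp this
  exact y.2

/-- The centre on `S` of a valuation ring `V` of `K` containing the image of `S`. -/
def valCenter (S : Type*) {K : Type*} [CommRing S] [Field K] [Algebra S K]
    (V : ValuationSubring K) (hV : ∀ a : S, algebraMap S K a ∈ V) : Ideal S :=
  (maximalIdeal V).comap ((algebraMap S K).codRestrict V.toSubring hV : S →+* V)

instance (S : Type*) {K : Type*} [CommRing S] [Field K] [Algebra S K]
    (V : ValuationSubring K) (hV : ∀ a : S, algebraMap S K a ∈ V) : (valCenter S V hV).IsPrime :=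
  Ideal.comap_isPrime _ _

lemma mem_valCenter {S : Type*} {K : Type*} [CommRing S] [Field K] [Algebra S K]
    (V : ValuationSubring K) (hV : ∀ a : S, algebraMap S K a ∈ V) (x : S) :
    x ∈ valCenter S V hV ↔ algebraMap S K x ∈ V.nonunits := by
  rw [valCenter, Ideal.mem_comap, ValuationSubring.mem_nonunits_iff_exists_mem_maximalIdeal]
  constructor
  · intro h; exact ⟨_, h⟩
  · rintro ⟨_, h⟩; exact h

/-- The image in `K` of the localization of `S` at `P`. -/
def localSubringAtPrime (S : Type*) (K : Type*) [CommRing S] [IsDomain S] [Field K] [Algebra S K]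
    [IsFractionRing S K] (P : Ideal S) [P.IsPrime] : LocalSubring K :=
  LocalSubring.range (IsLocalization.lift (M := P.primeCompl) (S := Localization.AtPrime P)
    (g := algebraMap S K) (fun y => IsUnit.mk0 _ (by
      have : (y : S) ≠ 0 := fun h => y.2 (h ▸ P.zero_mem)
      simpa using this)))

lemma mem_localSubringAtPrime {S : Type*} {K : Type*} [CommRing S] [IsDomain S] [Field K]
    [Algebra S K] [IsFractionRing S K] (P : Ideal S) [P.IsPrime] (x : K) :
    x ∈ (localSubringAtPrime S K P).toSubring ↔ ∃ a b : S, b ∉ P ∧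
      x * algebraMap S K b = algebraMap S K a := by
  have h0 : ∀ b : S, b ∉ P → algebraMap S K b ≠ 0 := fun b hb => by
    have : b ≠ 0 := fun h => hb (h ▸ P.zero_mem)
    simpa using this
  constructor
  · rintro ⟨y, rfl⟩
    obtain ⟨⟨a, b⟩, hab⟩ := IsLocalization.surj P.primeCompl y
    refine ⟨a, b, b.2, ?_⟩
    have := congrArg (IsLocalization.lift (M := P.primeCompl) (S := Localization.AtPrime P)
      (g := algebraMap S K) (fun y => IsUnit.mk0 _ (h0 y y.2))) hab
    simpa using this
  · rintro ⟨a, b, hb, h⟩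
    refine ⟨IsLocalization.mk' _ a (⟨b, hb⟩ : P.primeCompl), ?_⟩
    erw [IsLocalization.lift_mk'_spec]
    rw [mul_comm]; exact h.symm

lemma le_toLocalSubring_iff {K : Type*} [Field K] (R : LocalSubring K) (V : ValuationSubring K) :
    R ≤ V.toLocalSubring ↔
      R.toSubring ≤ V.toSubring ∧ ∀ x ∈ R.toSubring, x⁻¹ ∈ V → x⁻¹ ∈ R.toSubring := by
  rw [LocalSubring.le_def]
  constructor
  · rintro ⟨h, hl⟩
    refine ⟨h, fun x hx hx' => ?_⟩
    rcases eq_or_ne x 0 with rfl | h0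
    · simp
    have hu : IsUnit (Subring.inclusion h ⟨x, hx⟩) :=
      IsUnit.of_mul_eq_one (⟨x⁻¹, hx'⟩ : V.toLocalSubring.toSubring)
        (Subtype.ext (mul_inv_cancel₀ h0))
    obtain ⟨y, hy⟩ := (hl.map_nonunit _ hu).exists_right_inv
    have : x * y = 1 := congrArg Subtype.val hy
    rw [← eq_inv_of_mul_eq_one_right this]
    exact y.2
  · rintro ⟨h, hl⟩
    refine ⟨h, ⟨fun x hx => ?_⟩⟩
    obtain ⟨y, hy⟩ := hx.exists_right_inv
    have hxy : (x : K) * y = 1 := congrArg Subtype.val hy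
    have hy' : (y : K) = (x : K)⁻¹ := eq_inv_of_mul_eq_one_right hxy
    have hmem : (x : K)⁻¹ ∈ V := by
      rw [← hy']
      exact y.2
    refine IsUnit.of_mul_eq_one ⟨(x : K)⁻¹, hl x x.2 hmem⟩ (Subtype.ext ?_)
    exact (congrArg ((x : K) * ·) hy'.symm).trans hxy

lemma eq_of_toLocalSubring_le {K : Type*} [Field K] {V W : ValuationSubring K}
    (h : V.toLocalSubring ≤ W.toLocalSubring) : V = W :=
  ValuationSubring.toLocalSubring_injective (V.isMax_toLocalSubring.eq_of_le h)

lemma inv_mem_of_notMem_valCenter {S : Type*} {K : Type*} [CommRing S] [Field K] [Algebra S K]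
    {V : ValuationSubring K} {hV : ∀ a : S, algebraMap S K a ∈ V} {b : S}
    (hb : b ∉ valCenter S V hV) : algebraMap S K b ≠ 0 ∧ (algebraMap S K b)⁻¹ ∈ V := by
  rw [mem_valCenter, ValuationSubring.mem_nonunits_iff_or] at hb
  push Not at hb
  exact hb

lemma localSubringAtPrime_le {S : Type*} {K : Type*} [CommRing S] [IsDomain S] [Field K]
    [Algebra S K] [IsFractionRing S K]
    (V : ValuationSubring K) (hV : ∀ a : S, algebraMap S K a ∈ V) :
    localSubringAtPrime S K (valCenter S V hV) ≤ V.toLocalSubring := by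
  rw [le_toLocalSubring_iff]
  constructor
  · intro x hx
    obtain ⟨a, b, hb, h⟩ := (mem_localSubringAtPrime _ x).mp hx
    obtain ⟨hb0, hb1⟩ := inv_mem_of_notMem_valCenter hb
    rw [← eq_mul_inv_iff_mul_eq₀ hb0] at h
    rw [h]
    exact V.mul_mem _ _ (hV a) hb1
  · intro x hx hx'
    obtain ⟨a, b, hb, h⟩ := (mem_localSubringAtPrime _ x).mp hx
    obtain ⟨hb0, hb1⟩ := inv_mem_of_notMem_valCenter hb
    rcases eq_or_ne x 0 with rfl | hx0
    · simp
    refine (mem_localSubringAtPrime _ _).mpr ⟨b, a, ?_, ?_⟩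
    · rw [mem_valCenter, ValuationSubring.mem_nonunits_iff_or, ← h]
      simp only [mul_eq_zero, hx0, hb0, or_self, false_or, not_not, mul_inv]
      exact V.mul_mem _ _ hx' hb1
    · rw [← h, inv_mul_cancel_left₀ hx0]

/-- A valuation ring containing a Dedekind domain `S`, with non-zero centre `P` on `S`, is `S_P`. -/
lemma toSubring_eq_localSubringAtPrime {S : Type*} {K : Type*} [CommRing S] [IsDedekindDomain S]
    [Field K] [Algebra S K] [IsFractionRing S K]
    (V : ValuationSubring K) (hV : ∀ a : S, algebraMap S K a ∈ V) (h0 : valCenter S V hV ≠ ⊥) :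
    V.toLocalSubring = localSubringAtPrime S K (valCenter S V hV) := by
  let P := valCenter S V hV
  have := IsLocalization.AtPrime.isDiscreteValuationRing_of_dedekind_domain S h0
    (Localization.AtPrime P)
  let f := IsLocalization.lift (M := P.primeCompl) (S := Localization.AtPrime P)
    (g := algebraMap S K) (fun y => IsUnit.mk0 _ (by
      have : (y : S) ≠ 0 := fun h => y.2 (h ▸ P.zero_mem)
      simpa using this))
  let : Algebra (Localization.AtPrime P) K := f.toAlgebra
  have : IsScalarTower S (Localization.AtPrime P) K := .of_algebraMap_eq fun x => by
    simp [RingHom.algebraMap_toAlgebra, f]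
  have : IsFractionRing (Localization.AtPrime P) K :=
    IsFractionRing.isFractionRing_of_isDomain_of_isLocalization P.primeCompl _ K
  let W : ValuationSubring K :=
    { (localSubringAtPrime S K P).toSubring with
      mem_or_inv_mem' := fun x => by
        rcases ValuationRing.isInteger_or_isInteger (Localization.AtPrime P) x with h | h
        · obtain ⟨y, hy⟩ := h; exact Or.inl ⟨y, hy⟩
        · obtain ⟨y, hy⟩ := h; exact Or.inr ⟨y, hy⟩ }
  have hW : W.toLocalSubring = localSubringAtPrime S K P := LocalSubring.toSubring_injective rfl
  have hle : W.toLocalSubring ≤ V.toLocalSubring := hW ▸ localSubringAtPrime_le V hV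
  have heq : V.toLocalSubring = W.toLocalSubring := by rw [eq_of_toLocalSubring_le hle]
  exact heq.trans hW

lemma isLocalization_valCenter {S : Type*} {K : Type*} [CommRing S] [IsDedekindDomain S]
    [Field K] [Algebra S K] [IsFractionRing S K]
    (V : ValuationSubring K) (hV : ∀ a : S, algebraMap S K a ∈ V) {P : Ideal S} [P.IsPrime]
    (hP : valCenter S V hV = P) (h0 : P ≠ ⊥) [Algebra S V] [IsScalarTower S V K] :
    IsLocalization.AtPrime V P where
  map_units y := by
    subst hP
    obtain ⟨hb0, hb1⟩ := inv_mem_of_notMem_valCenter y.2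
    refine IsUnit.of_mul_eq_one (⟨_, hb1⟩ : V) (Subtype.ext ?_)
    have : ((algebraMap S V y : V) : K) = algebraMap S K y :=
      (IsScalarTower.algebraMap_apply S V K _).symm
    simp only [MulMemClass.coe_mul, this]
    exact mul_inv_cancel₀ hb0
  surj x := by
    have hx : (x : K) ∈ V.toLocalSubring.toSubring := x.2
    subst hP
    rw [toSubring_eq_localSubringAtPrime V hV h0, mem_localSubringAtPrime] at hx
    obtain ⟨a, b, hb, h⟩ := hx
    refine ⟨⟨a, ⟨b, hb⟩⟩, Subtype.ext ?_⟩
    rw [MulMemClass.coe_mul]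
    exact (congrArg ((x : K) * ·) (IsScalarTower.algebraMap_apply S V K b).symm).trans
      (h.trans (IsScalarTower.algebraMap_apply S V K a))
  exists_of_eq {x y} h := by
    refine ⟨1, ?_⟩
    have : algebraMap S K x = algebraMap S K y := by
      rw [IsScalarTower.algebraMap_apply S V K, h, ← IsScalarTower.algebraMap_apply S V K]
    rw [IsFractionRing.injective S K this]

/-- A surjection of local rings induces an isomorphism of residue fields. -/
def residueFieldEquivOfSurjective (k : Type*) {A B : Type*} [CommRing k] [CommRing A]
    [IsLocalRing A] [CommRing B] [IsLocalRing B] [Algebra k A] [Algebra k B] (f : A →ₐ[k] B)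
    (hf : Function.Surjective f) : ResidueField A ≃ₐ[k] ResidueField B :=
  haveI : IsLocalHom f := ⟨(IsLocalHom.of_surjective f.toRingHom hf).map_nonunit⟩
  AlgEquiv.ofBijective (ResidueField.mapAlgHom f) ⟨(ResidueField.mapAlgHom f).toRingHom.injective,
    fun y => by
      obtain ⟨y, rfl⟩ := residue_surjective y
      obtain ⟨x, rfl⟩ := hf y
      exact ⟨residue A x, ResidueField.mapAlgHom_residue _ _⟩⟩

/-- Lengths in the localization of `S / t` at a prime, in terms of the localization of `S`. -/
lemma length_localization_quotient {k S V : Type*} [Field k] [CommRing S] [Algebra k S] (t : S)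
    [IsArtinianRing (S ⧸ Ideal.span {t})] (p : PrimeSpectrum (S ⧸ Ideal.span {t}))
    [CommRing V] [IsLocalRing V] [Algebra S V] [Algebra k V] [IsScalarTower k S V]
    [IsLocalization.AtPrime V (p.asIdeal.comap (Ideal.Quotient.mk (Ideal.span {t})))] :
    length (Localization.AtPrime p.asIdeal) (Localization.AtPrime p.asIdeal) =
        length V (V ⧸ Ideal.span {algebraMap S V t}) ∧
      length k (ResidueField (Localization.AtPrime p.asIdeal)) = length k (ResidueField V) := by
  set E := S ⧸ Ideal.span {t}
  set P := p.asIdeal.comap (Ideal.Quotient.mk (Ideal.span {t})) with hP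
  let Ep := Localization.AtPrime p.asIdeal
  let f : S →+* Ep := (algebraMap E Ep).comp (Ideal.Quotient.mk (Ideal.span {t}))
  have hf : ∀ y : P.primeCompl, IsUnit (f y) := fun y =>
    IsLocalization.map_units Ep (⟨Ideal.Quotient.mk _ y, y.2⟩ : p.asIdeal.primeCompl)
  let g : V →+* Ep := IsLocalization.lift hf
  have hgf : ∀ x, g (algebraMap S V x) = f x := fun x => IsLocalization.lift_eq hf x
  have hfsurj : Function.Surjective f :=
    (IsArtinianRing.localization_surjective p.asIdeal.primeCompl Ep).comp
      Ideal.Quotient.mk_surjective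
  have hgsurj : Function.Surjective g := fun y => by
    obtain ⟨x, rfl⟩ := hfsurj y
    exact ⟨_, hgf x⟩
  have hker : RingHom.ker g = Ideal.span {algebraMap S V t} := by
    apply le_antisymm
    · intro x hx
      obtain ⟨⟨a, b⟩, hab⟩ := IsLocalization.surj P.primeCompl x
      simp only at hab
      have h1 : f a = 0 := by
        rw [← hgf, ← hab, map_mul, (RingHom.mem_ker).mp hx, zero_mul]
      obtain ⟨c, hc⟩ := (IsLocalization.map_eq_zero_iff p.asIdeal.primeCompl Ep
        (Ideal.Quotient.mk (Ideal.span {t}) a)).mp h1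
      obtain ⟨c', hc'⟩ := Ideal.Quotient.mk_surjective (c : E)
      have hc'P : c' ∈ P.primeCompl := fun h => c.2 (hc' ▸ h)
      rw [← hc', ← map_mul, Ideal.Quotient.eq_zero_iff_mem] at hc
      obtain ⟨r, hr⟩ := Ideal.mem_span_singleton'.mp hc
      have hu : IsUnit (algebraMap S V (c' * b)) := IsLocalization.map_units V
        (⟨c' * b, mul_mem hc'P b.2⟩ : P.primeCompl)
      rw [← Ideal.unit_mul_mem_iff_mem _ hu, map_mul, mul_assoc, mul_comm _ x, hab, ← map_mul, ← hr,
        map_mul]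
      exact Ideal.mul_mem_left _ _ (Ideal.mem_span_singleton_self _)
    · rw [Ideal.span_singleton_le_iff_mem, RingHom.mem_ker, hgf]
      have : Ideal.Quotient.mk (Ideal.span {t}) t = 0 :=
        Ideal.Quotient.eq_zero_iff_mem.mpr (Ideal.mem_span_singleton_self _)
      simp only [f, RingHom.comp_apply, this, map_zero]
  let : Algebra V Ep := g.toAlgebra
  have : IsScalarTower k V Ep := .of_algebraMap_eq fun x => by
    rw [RingHom.algebraMap_toAlgebra, IsScalarTower.algebraMap_apply k S V, hgf,
      IsScalarTower.algebraMap_apply k E Ep]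
    rfl
  constructor
  · rw [← Module.length_eq_of_surjective (S := V) (M := Ep) (R := Ep) hgsurj]
    have e := (Algebra.linearMap V Ep).quotKerEquivOfSurjective hgsurj
    rw [← e.length_eq]
    exact (Submodule.quotEquivOfEq _ _ hker).length_eq
  · exact (residueFieldEquivOfSurjective k (IsScalarTower.toAlgHom k V Ep)
      hgsurj).toLinearEquiv.length_eq.symm

/-- The valuation ring `V` of `K` dominates the local ring `A`. -/
def Dominates (A : Type*) {K : Type*} [CommRing A] [IsLocalRing A] [Field K] [Algebra A K]
    (V : ValuationSubring K) : Prop :=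
  (∀ a : A, algebraMap A K a ∈ V) ∧ ∀ a ∈ maximalIdeal A, algebraMap A K a ∈ V.nonunits

lemma exists_valCenter_eq {S : Type*} (K : Type*) [CommRing S] [IsDomain S]
    [Field K] [Algebra S K] [IsFractionRing S K] (P : Ideal S) [P.IsPrime] :
    ∃ (V : ValuationSubring K) (hV : ∀ a : S, algebraMap S K a ∈ V), valCenter S V hV = P := by
  obtain ⟨V, hV⟩ := (localSubringAtPrime S K P).exists_le_valuationSubring
  rw [le_toLocalSubring_iff] at hV
  have h1 : (1 : S) ∉ P := P.ne_top_iff_one.mp (Ideal.IsPrime.ne_top inferInstance)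
  refine ⟨V, fun a => hV.1 ((mem_localSubringAtPrime P _).mpr ⟨a, 1, h1, by simp⟩), ?_⟩
  ext x
  rw [mem_valCenter, ValuationSubring.mem_nonunits_iff_or]
  constructor
  · intro h
    by_contra hx
    have hx0 : algebraMap S K x ≠ 0 := by
      have : x ≠ 0 := fun h => hx (h ▸ P.zero_mem)
      simpa using this
    refine h.elim hx0 fun h => h (hV.1 ((mem_localSubringAtPrime P _).mpr ⟨1, x, hx, ?_⟩))
    simp [hx0]
  · intro hx
    by_contra! h
    have := hV.2 _ ((mem_localSubringAtPrime P _).mpr ⟨x, 1, h1, by simp⟩) h.2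
    obtain ⟨a, b, hb, hab⟩ := (mem_localSubringAtPrime P _).mp this
    rw [inv_mul_eq_iff_eq_mul₀ h.1, ← map_mul] at hab
    have := IsFractionRing.injective S K hab
    exact hb (this ▸ P.mul_mem_right _ hx)

/-- The length of `V / x` for `x ∈ V`; it is the value of `x` when `V` is discrete. -/
def valLength {K : Type*} [Field K] (V : ValuationSubring K) (x : K) : ℕ∞ :=
  length V (V ⧸ Ideal.span {y : V | (y : K) = x})

lemma valLength_coe {K : Type*} [Field K] (V : ValuationSubring K) (x : V) :
    valLength V x = length V (V ⧸ Ideal.span {x}) := by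
  have : {y : V | (y : K) = x} = {x} := Set.ext fun y => Subtype.ext_iff.symm
  rw [valLength, this]

section LocalFormula

variable (k A F K : Type*) [Field k] [CommRing A] [IsDomain A] [IsLocalRing A] [IsNoetherianRing A]
  [Ring.DimensionLEOne A] [Field F] [Algebra A F] [IsFractionRing A F] [Field K] [Algebra A K]
  [Algebra F K] [IsScalarTower A F K] [FiniteDimensional F K]
  [Module.Finite A (integralClosure A K)] [Algebra k A] [Algebra k K] [IsScalarTower k A K]

open scoped Classical in
/-- Let `A` be a one-dimensional local domain, and `K` a finite extension of degree `d` of its field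
of fractions, such that the integral closure of `A` in `K` is finite. Then
`∑ ord_V(t) [κ(V) : k] = d ℓ(A / t) [κ(A) : k]`, the sum running over the valuation rings `V` of
`K` which dominate `A`. -/
theorem exists_finset_dominates_sum_eq (t : A) (ht : t ∈ maximalIdeal A) (ht0 : t ≠ 0) :
    ∃ s : Finset (Place k K), (∀ V, V ∈ s ↔ Dominates A V.ring) ∧
      ∑ V ∈ s, valLength V.ring (algebraMap A K t) * length k (ResidueField V.ring) =
        finrank F K * (length A (A ⧸ Ideal.span {t}) * length k (ResidueField A)) := by
  have : FaithfulSMul A K := by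
    have := (FaithfulSMul.trans A F K)
    exact this
  let S := integralClosure A K
  have : IsFractionRing S K := integralClosure.isFractionRing_of_finite_extension F K
  have : IsIntegrallyClosed S := integralClosure.isIntegrallyClosedOfFiniteExtension F
  have : IsNoetherianRing S := IsNoetherianRing.of_finite A S
  have : IsDedekindDomain S := { }
  let t' : S := algebraMap A S t
  have ht' : t' ≠ 0 := by
    simpa [t'] using ht0
  have : IsArtinianRing (S ⧸ Ideal.span {t'}) := by
    have h2 := Module.length_ne_top_iff.mpr (isFiniteLength_quotient_span_singleton S
      (mem_nonZeroDivisors_of_ne_zero ht'))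
    rw [Module.length_eq_of_surjective (R := S ⧸ Ideal.span {t'}) Ideal.Quotient.mk_surjective,
      Module.length_ne_top_iff] at h2
    exact (isFiniteLength_iff_isNoetherian_isArtinian.mp h2).2
  have : Fintype (PrimeSpectrum (S ⧸ Ideal.span {t'})) := Fintype.ofFinite _
  -- `S` has rank `d` over `A`, so the right-hand side is the length of `S / t` over `k`
  have hE : length k (S ⧸ Ideal.span {t'}) =
      finrank F K * (length A (A ⧸ Ideal.span {t}) * length k (ResidueField A)) := by
    rw [length_eq_mul_length_residueField k A, ← mul_assoc, IsFractionRing.finrank_eq A F S K,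
      ← length_quotient_smul_top A S t ht0]
    congr 1
    have h : (Ideal.span {t'}).restrictScalars A = LinearMap.range (LinearMap.lsmul A S t) := by
      ext x
      simp only [Submodule.restrictScalars_mem, LinearMap.mem_range, LinearMap.lsmul_apply,
        Ideal.mem_span_singleton', Algebra.smul_def]
      exact exists_congr fun a => by rw [mul_comm]
    rw [← (Submodule.Quotient.restrictScalarsEquiv A (Ideal.span {t'})).length_eq]
    exact (Submodule.quotEquivOfEq _ _ h).length_eq
  -- the points of `S / t` correspond to the valuation rings which dominate `A`
  have hex : ∀ p : PrimeSpectrum (S ⧸ Ideal.span {t'}), ∃ (V : Place k K)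
      (hV : ∀ a : S, algebraMap S K a ∈ V.ring),
      valCenter S V.ring hV = p.asIdeal.comap (Ideal.Quotient.mk (Ideal.span {t'})) := fun p => by
    obtain ⟨V, hV, h⟩ := exists_valCenter_eq K (p.asIdeal.comap (Ideal.Quotient.mk (Ideal.span {t'})))
    refine ⟨⟨V, fun x => ?_⟩, hV, h⟩
    rw [IsScalarTower.algebraMap_apply k S K]
    exact hV _
  choose Ψ hΨ hΨP using hex
  have ht'P : ∀ p : PrimeSpectrum (S ⧸ Ideal.span {t'}),
      t' ∈ p.asIdeal.comap (Ideal.Quotient.mk (Ideal.span {t'})) := fun p => by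
    rw [Ideal.mem_comap, Ideal.Quotient.eq_zero_iff_mem.mpr (Ideal.mem_span_singleton_self _)]
    exact zero_mem _
  have hne : ∀ p : PrimeSpectrum (S ⧸ Ideal.span {t'}), valCenter S (Ψ p).ring (hΨ p) ≠ ⊥ :=
    fun p h => ht' (by
      have := ht'P p
      rwa [← hΨP, h, Ideal.mem_bot] at this)
  have hinj : Function.Injective Ψ := by
    intro p q h
    have h1 : (Ψ p).ring = (Ψ q).ring := congrArg Place.ring h
    have h2 : p.asIdeal.comap (Ideal.Quotient.mk (Ideal.span {t'})) =
        q.asIdeal.comap (Ideal.Quotient.mk (Ideal.span {t'})) := by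
      rw [← hΨP, ← hΨP]
      ext x
      rw [mem_valCenter, mem_valCenter, h1]
    exact PrimeSpectrum.ext (Ideal.comap_injective_of_surjective _ Ideal.Quotient.mk_surjective h2)
  refine ⟨Finset.univ.image Ψ, fun V => ?_, ?_⟩
  · simp only [Finset.mem_image, Finset.mem_univ, true_and]
    constructor
    · rintro ⟨p, rfl⟩
      refine ⟨fun a => hΨ p (algebraMap A S a), fun a ha => ?_⟩
      rw [IsScalarTower.algebraMap_apply A S K]
      refine (mem_valCenter (Ψ p).ring (hΨ p) _).mp ?_
      rw [hΨP]
      have hm : (p.asIdeal.comap (Ideal.Quotient.mk (Ideal.span {t'}))).IsMaximal := by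
        have := hne p
        rw [hΨP] at this
        exact Ideal.IsPrime.isMaximal inferInstance this
      have := Ideal.isMaximal_comap_of_isIntegral_of_isMaximal (R := A)
        (p.asIdeal.comap (Ideal.Quotient.mk (Ideal.span {t'})))
      rw [← eq_maximalIdeal this] at ha
      exact ha
    · intro hV
      have hS : ∀ a : S, algebraMap S K a ∈ V.ring := fun a =>
        mem_of_isIntegral_of_forall_mem V.ring hV.1 a.2
      have htc : t' ∈ valCenter S V.ring hS := (mem_valCenter _ _ _).mpr (hV.2 t ht)
      let p : PrimeSpectrum (S ⧸ Ideal.span {t'}) :=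
        ⟨(valCenter S V.ring hS).map (Ideal.Quotient.mk (Ideal.span {t'})),
          Ideal.map_isPrime_of_surjective Ideal.Quotient.mk_surjective (by
            rwa [Ideal.mk_ker, Ideal.span_singleton_le_iff_mem])⟩
      have hp : p.asIdeal.comap (Ideal.Quotient.mk (Ideal.span {t'})) = valCenter S V.ring hS := by
        rw [Ideal.comap_map_of_surjective _ Ideal.Quotient.mk_surjective, ← RingHom.ker_eq_comap_bot,
          Ideal.mk_ker, sup_eq_left, Ideal.span_singleton_le_iff_mem]
        exact htc
      have hc : valCenter S (Ψ p).ring (hΨ p) = valCenter S V.ring hS := (hΨP p).trans hp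
      refine ⟨p, Place.ext (ValuationSubring.toLocalSubring_injective ?_)⟩
      rw [toSubring_eq_localSubringAtPrime V.ring hS (hc ▸ hne p),
        toSubring_eq_localSubringAtPrime (Ψ p).ring (hΨ p) (hne p)]
      congr 1
  · rw [Finset.sum_image hinj.injOn, ← hE, length_eq_sum_primeSpectrum]
    refine Finset.sum_congr rfl fun p _ => ?_
    let : Algebra S (Ψ p).ring := ((algebraMap S K).codRestrict (Ψ p).ring.toSubring (hΨ p)).toAlgebra
    have : IsScalarTower S (Ψ p).ring K := .of_algebraMap_eq fun _ => rfl
    have : IsScalarTower k S (Ψ p).ring := .of_algebraMap_eq fun x => Subtype.ext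
      (IsScalarTower.algebraMap_apply k S K x)
    have := isLocalization_valCenter (Ψ p).ring (hΨ p) (hΨP p) (hΨP p ▸ hne p)
    obtain ⟨e1, e2⟩ := length_localization_quotient (k := k) (V := (Ψ p).ring) t' p
    rw [e1, e2, ← valLength_coe]
    rfl

end LocalFormula

end Dominating

/-! ### Finiteness of integral closures over `k[T]` -/

section IntegralClosure

open Module Polynomial

section Degree

variable (k F : Type*) [Field k] [Field F] [Algebra k F] [Algebra k[X] F] [IsFractionRing k[X] F]
  [IsScalarTower k k[X] F]

/-- The rational functions over `k` which vanish to order at least `j` at infinity: those which can be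
written as `a / b` with `deg a + j ≤ deg b`. -/
def vanishingAtInfinity (j : ℕ) : Submodule k F where
  carrier := {x | ∃ a b : k[X], b ≠ 0 ∧ x * algebraMap k[X] F b = algebraMap k[X] F a ∧
    (a * X ^ j).degree ≤ b.degree}
  add_mem' := by
    rintro x y ⟨a, b, hb, h, hd⟩ ⟨a', b', hb', h', hd'⟩
    refine ⟨a * b' + a' * b, b * b', mul_ne_zero hb hb', ?_, ?_⟩
    · rw [map_mul, map_add, map_mul, map_mul, ← h, ← h']; ring
    · rw [add_mul, degree_mul]
      refine (degree_add_le _ _).trans (max_le ?_ ?_)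
      · rw [mul_right_comm, degree_mul]; exact add_le_add_left hd _
      · rw [mul_right_comm, degree_mul, add_comm]; exact add_le_add_right hd' _
  zero_mem' := ⟨0, 1, one_ne_zero, by simp, by simp⟩
  smul_mem' := by
    rintro c x ⟨a, b, hb, h, hd⟩
    refine ⟨C c * a, b, hb, ?_, ?_⟩
    · rw [map_mul, ← h, ← algebraMap_eq, ← IsScalarTower.algebraMap_apply, Algebra.smul_def, mul_assoc]
    · rw [mul_assoc, degree_mul]
      refine le_trans ?_ hd
      calc (C c).degree + (a * X ^ j).degree ≤ 0 + (a * X ^ j).degree := by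
            gcongr; exact degree_C_le
        _ = _ := zero_add _

variable {k F}

lemma exists_add_mem_vanishingAtInfinity (x : F) :
    ∃ p : k[X], x - algebraMap k[X] F p ∈ vanishingAtInfinity k F 1 := by
  obtain ⟨a, b, hb, rfl⟩ := IsFractionRing.div_surjective (A := k[X]) x
  have hb0 : b ≠ 0 := nonZeroDivisors.ne_zero hb
  have hb' : algebraMap k[X] F b ≠ 0 := by simpa using hb0
  refine ⟨a / b, a % b, b, hb0, ?_, ?_⟩
  · rw [sub_mul, div_mul_cancel₀ _ hb', ← map_mul, ← map_sub]
    congr 1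
    rw [EuclideanDomain.mod_eq_sub_mul_div]; ring
  · rw [pow_one, degree_mul, degree_X]
    have := EuclideanDomain.mod_lt a hb0
    have h2 : (a % b).degree < b.degree := this
    by_cases h0 : a % b = 0
    · simp [h0]
    · rw [degree_eq_natDegree h0, degree_eq_natDegree hb0] at h2 ⊢
      exact_mod_cast h2

lemma exists_sub_smul_mem_vanishingAtInfinity {j : ℕ} {x : F} (hx : x ∈ vanishingAtInfinity k F j) :
    ∃ c : k, x - c • (algebraMap k[X] F X)⁻¹ ^ j ∈ vanishingAtInfinity k F (j + 1) := by
  obtain ⟨a, b, hb, h, hd⟩ := hx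
  have hX : algebraMap k[X] F X ≠ 0 := by simp
  -- `c` is the leading coefficient of the expansion in powers of `X⁻¹`
  let c := (a * X ^ j).coeff b.natDegree / b.leadingCoeff
  refine ⟨c, a * X ^ j - C c * b, b * X ^ j, mul_ne_zero hb (by simp), ?_, ?_⟩
  · rw [map_mul, map_sub, sub_mul, ← mul_assoc, h, map_mul, map_mul, ← algebraMap_eq,
      ← IsScalarTower.algebraMap_apply, Algebra.smul_def, map_pow, inv_pow]
    field_simp
  · rw [pow_succ', ← mul_assoc, degree_mul, degree_mul (p := b)]
    refine add_le_add_left ?_ _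
    rw [degree_mul, degree_X]
    by_cases h0 : a * X ^ j - C c * b = 0
    · simp [h0]
    · have hlt : (a * X ^ j - C c * b).degree < b.degree := by
        rw [degree_eq_natDegree hb, degree_lt_iff_coeff_zero]
        intro m hm
        rcases hm.eq_or_lt with rfl | hm
        · simp [c, hb]
        · rw [coeff_sub, coeff_C_mul, coeff_eq_zero_of_natDegree_lt hm, mul_zero, sub_zero]
          refine coeff_eq_zero_of_degree_lt (hd.trans_lt ?_)
          rw [degree_eq_natDegree hb]
          exact_mod_cast hm
      rw [degree_eq_natDegree h0, degree_eq_natDegree hb] at hlt ⊢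
      exact_mod_cast hlt

/-- The functions which vanish at infinity to order `r` have finite codimension among those which
vanish there. -/
lemma vanishingAtInfinity_le_sup (r : ℕ) : ∃ S : Submodule k F, S.FG ∧
    vanishingAtInfinity k F 1 ≤ vanishingAtInfinity k F r ⊔ S := by
  induction r with
  | zero =>
    refine ⟨⊥, Submodule.fg_bot, ?_⟩
    rintro x ⟨a, b, hb, h, hd⟩
    refine Submodule.mem_sup_left ⟨a, b, hb, h, ?_⟩
    rw [pow_zero, mul_one]
    refine le_trans ?_ hd
    by_cases h0 : a = 0
    · simp [h0]
    · rw [degree_mul, pow_one, degree_X, degree_eq_natDegree h0]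
      exact_mod_cast Nat.le_succ _
  | succ r ih =>
    obtain ⟨S, hS, h⟩ := ih
    refine ⟨S ⊔ Submodule.span k {(algebraMap k[X] F X)⁻¹ ^ r},
      hS.sup (Submodule.fg_span_singleton _), h.trans (sup_le ?_ (le_sup_of_le_right le_sup_left))⟩
    intro x hx
    obtain ⟨c, hc⟩ := exists_sub_smul_mem_vanishingAtInfinity hx
    rw [← sub_add_cancel x (c • (algebraMap k[X] F X)⁻¹ ^ r)]
    exact add_mem (Submodule.mem_sup_left hc) (Submodule.mem_sup_right (Submodule.mem_sup_right
      (Submodule.smul_mem _ _ (Submodule.mem_span_singleton_self _))))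

end Degree

variable {k K : Type*} [Field k] [Field K] [Algebra k K]

/-- An element which lies in every valuation ring of `K` containing `k` is algebraic over `k`. -/
lemma isIntegral_of_forall_mem_valuationSubring {x : K}
    (h : ∀ V : ValuationSubring K, (∀ c : k, algebraMap k K c ∈ V) → x ∈ V) : IsIntegral k x := by
  have h1 := iInf_valuationSubring_superset (K := K) (s := Set.range (algebraMap k K))
  have h2 : x ∈ (integralClosure (Subring.closure (Set.range (algebraMap k K))) K).toSubring := by
    rw [← h1, Subring.mem_iInf]
    exact fun V => h V fun c => V.2 ⟨c, rfl⟩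
  have h3 : Subring.closure (Set.range (algebraMap k K)) = (algebraMap k K).range := by
    rw [← RingHom.coe_range, Subring.closure_eq]
  rw [h3] at h2
  obtain ⟨p, hp, hpx⟩ := h2
  have hsurj : Function.Surjective (algebraMap k K).rangeRestrict :=
    (algebraMap k K).rangeRestrict_surjective
  obtain ⟨q, hq, -, hqm⟩ := lifts_and_degree_eq_and_monic ((mem_lifts p).mpr (map_surjective _ hsurj p)) hp
  refine ⟨q, hqm, ?_⟩
  rw [← hq, eval₂_map] at hpx
  exact hpx

lemma isTrivialOn_valuation (V : ValuationSubring K) (hV : ∀ c : k, algebraMap k K c ∈ V) :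
    V.valuation.IsTrivialOn k where
  eq_one c hc := by
    have hc' : algebraMap k K c ≠ 0 := by simpa using hc
    refine le_antisymm ((V.valuation_le_one_iff _).mpr (hV c)) ?_
    have := (V.valuation_le_one_iff _).mpr (hV c⁻¹)
    rw [map_inv₀, map_inv₀] at this
    exact (inv_le_one₀ ((Valuation.pos_iff _).mpr hc')).mp this

variable [Algebra k[X] K] [IsScalarTower k k[X] K]

/-- If `K / k(T)` is finite, the elements of `K` algebraic over `k` form a finite extension: elements
of `K` which are algebraic over `k` and linearly independent over `k` remain so over `k(T)`. -/
lemma finite_integralClosure_field (F : Type*) [Field F] [Algebra k[X] F] [IsFractionRing k[X] F]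
    [Algebra F K] [IsScalarTower k[X] F K] [FiniteDimensional F K] :
    Module.Finite k (integralClosure k K) := by
  have : FaithfulSMul k[X] K := FaithfulSMul.trans k[X] F K
  let u := algebraMap k[X] K X
  have hu0 : Transcendental k u := by
    have h := transcendental_X k
    exact (transcendental_algebraMap_iff (FaithfulSMul.algebraMap_injective k[X] K)).mpr h
  have hu : Transcendental (integralClosure k K) u := hu0.integralClosure
  refine Module.rank_lt_aleph0_iff.mp (lt_of_le_of_lt ?_ (Cardinal.natCast_lt_aleph0 (n := finrank F K)))
  refine rank_le fun s hs => ?_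
  have h1 : LinearIndependent k[X] (fun i : s => ((i : integralClosure k K) : K)) := by
    rw [Fintype.linearIndependent_iff]
    intro g hg
    -- the relation is a polynomial in the transcendental element `u`
    let P : (integralClosure k K)[X] :=
      ∑ i : s, C (i : integralClosure k K) * (g i).map (algebraMap k (integralClosure k K))
    have hP : aeval u P = 0 := by
      rw [← hg, map_sum]
      refine Finset.sum_congr rfl fun i _ => ?_
      rw [map_mul, aeval_C, aeval_map_algebraMap, Algebra.smul_def, mul_comm]
      congr 1
      rw [aeval_algebraMap_apply, aeval_X_left_apply]
    have hP0 : P = 0 := by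
      by_contra h
      exact hu ⟨P, h, hP⟩
    intro i
    ext n
    have hn : ∑ i : s, (g i).coeff n • (i : integralClosure k K) = 0 := by
      have := congrArg (coeff · n) hP0
      simp only [P, finsetSum_coeff, coeff_C_mul, coeff_map, coeff_zero] at this
      rw [← this]
      exact Finset.sum_congr rfl fun i _ => by rw [Algebra.smul_def, mul_comm]
    exact Fintype.linearIndependent_iff.mp hs (fun i => (g i).coeff n) hn i
  have h2 : LinearIndependent F (fun i : s => ((i : integralClosure k K) : K)) :=
    (LinearIndependent.iff_fractionRing k[X] F).mp h1
  simpa using h2.fintype_card_le_finrank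

lemma algebraMap_polynomial_mem (V : ValuationSubring K)
    (hV : ∀ c : k, algebraMap k K c ∈ V) (hu : algebraMap k[X] K X ∈ V) (p : k[X]) :
    algebraMap k[X] K p ∈ V := by
  induction p using Polynomial.induction_on' with
  | add p q hp hq => rw [map_add]; exact V.add_mem _ _ hp hq
  | monomial n a =>
    rw [← C_mul_X_pow_eq_monomial, map_mul, map_pow, ← algebraMap_eq,
      ← IsScalarTower.algebraMap_apply]
    exact V.mul_mem _ _ (hV a) (V.pow_mem hu n)

lemma valuation_algebraMap_eq_pow_natDegree (V : ValuationSubring K)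
    (hV : ∀ c : k, algebraMap k K c ∈ V) (hu : algebraMap k[X] K X ∉ V) {p : k[X]} (hp : p ≠ 0) :
    V.valuation (algebraMap k[X] K p) = V.valuation (algebraMap k[X] K X) ^ p.natDegree := by
  have := isTrivialOn_valuation V hV
  have h := valuation_aeval_eq_valuation_X_pow_natDegree_of_one_lt_valuation_X (v := V.valuation)
    (algebraMap k[X] K X) (not_le.mp (mt (V.valuation_le_one_iff _).mp hu)) hp
  rwa [aeval_algebraMap_apply, aeval_X_left_apply] at h

lemma valuation_mul_pow_le_one_of_mem_vanishingAtInfinity {F : Type*} [Field F] [Algebra k F]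
    [Algebra k[X] F] [IsFractionRing k[X] F] [IsScalarTower k k[X] F] [Algebra F K]
    [IsScalarTower k[X] F K] (V : ValuationSubring K) (hV : ∀ c : k, algebraMap k K c ∈ V)
    (hu : algebraMap k[X] K X ∉ V) {j : ℕ} {x : F} (hx : x ∈ vanishingAtInfinity k F j) :
    V.valuation (algebraMap F K x) * V.valuation (algebraMap k[X] K X) ^ j ≤ 1 := by
  obtain ⟨a, b, hb, h, hd⟩ := hx
  have h' : algebraMap F K x * algebraMap k[X] K b = algebraMap k[X] K a := by
    rw [IsScalarTower.algebraMap_apply k[X] F K, ← map_mul, h, ← IsScalarTower.algebraMap_apply]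
  rcases eq_or_ne a 0 with rfl | ha
  · have hb0 : algebraMap k[X] F b ≠ 0 := by simpa using hb
    rw [map_zero, mul_eq_zero, or_iff_left hb0] at h
    simp [h]
  have hu1 : 1 < V.valuation (algebraMap k[X] K X) :=
    not_le.mp (mt (V.valuation_le_one_iff _).mp hu)
  have hle : a.natDegree + j ≤ b.natDegree := by
    rw [degree_mul, degree_X_pow, degree_eq_natDegree ha, degree_eq_natDegree hb] at hd
    exact_mod_cast hd
  have h2 := congrArg V.valuation h'
  rw [map_mul, valuation_algebraMap_eq_pow_natDegree V hV hu hb,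
    valuation_algebraMap_eq_pow_natDegree V hV hu ha] at h2
  have hpos : 0 < V.valuation (algebraMap k[X] K X) ^ a.natDegree :=
    pow_pos (zero_lt_one.trans hu1) _
  refine le_of_mul_le_mul_right ?_ hpos
  rw [mul_assoc, ← pow_add, one_mul, ← h2, add_comm]
  gcongr
  exact hu1.le

/-- An element integral over `k[T]` has a pole of bounded order at the valuation rings over infinity. -/
lemma exists_valuation_le_pow {b : K} (hb : IsIntegral k[X] b) :
    ∃ r : ℕ, ∀ V : ValuationSubring K, (∀ c : k, algebraMap k K c ∈ V) → algebraMap k[X] K X ∉ V →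
      V.valuation b ≤ V.valuation (algebraMap k[X] K X) ^ r := by
  obtain ⟨p, hp, hpb⟩ := hb
  refine ⟨p.support.sup fun j => (p.coeff j).natDegree, fun V hV hu => ?_⟩
  set r := p.support.sup fun j => (p.coeff j).natDegree
  have hu1 : 1 < V.valuation (algebraMap k[X] K X) :=
    not_le.mp (mt (V.valuation_le_one_iff _).mp hu)
  by_contra! hlt
  have hb1 : 1 < V.valuation b := lt_of_le_of_lt (one_le_pow₀ hu1.le) hlt
  have h0 : (0 : V.ValueGroup) < V.valuation b ^ p.natDegree := pow_pos (zero_lt_one.trans hb1) _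
  rw [eval₂_eq_sum_range, Finset.sum_range_succ, hp.coeff_natDegree, map_one, one_mul,
    add_comm] at hpb
  rw [← eq_neg_iff_add_eq_zero] at hpb
  have h1 : V.valuation (∑ j ∈ Finset.range p.natDegree, algebraMap k[X] K (p.coeff j) * b ^ j) <
      V.valuation b ^ p.natDegree := by
    refine Valuation.map_sum_lt _ h0.ne' fun j hj => ?_
    rcases eq_or_ne (p.coeff j) 0 with h | h
    · simpa [h] using h0
    rw [map_mul, map_pow, valuation_algebraMap_eq_pow_natDegree V hV hu h]
    have hjr : (p.coeff j).natDegree ≤ r :=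
      Finset.le_sup (f := fun j => (p.coeff j).natDegree) (mem_support_iff.mpr h)
    calc _ ≤ V.valuation (algebraMap k[X] K X) ^ r * V.valuation b ^ j := by
          gcongr; exact hu1.le
      _ < V.valuation b * V.valuation b ^ j := by
          exact mul_lt_mul_of_pos_right hlt (pow_pos (zero_lt_one.trans hb1) _)
      _ = V.valuation b ^ (j + 1) := (pow_succ' _ _).symm
      _ ≤ _ := pow_le_pow_right₀ hb1.le (Finset.mem_range.mp hj)
  rw [← map_pow, hpb, Valuation.map_neg] at h1
  exact h1.false

/-- The integral closure of `k[T]` in a finite extension `K` of `k(T)` is finite over `k[T]`.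

No separability is needed: modulo the span of a basis consisting of integral elements, an integral
element has coordinates which vanish at infinity; those integral elements whose coordinates vanish
there to high order lie in all valuation rings of `K / k`, so they are algebraic over `k`. -/
theorem finite_integralClosure_polynomial (F : Type*) [Field F] [Algebra k[X] F]
    [IsFractionRing k[X] F] [Algebra F K] [IsScalarTower k[X] F K] [FiniteDimensional F K] :
    Module.Finite k[X] (integralClosure k[X] K) := by
  have : FaithfulSMul k[X] K := FaithfulSMul.trans k[X] F K
  let : Algebra k F := ((algebraMap k[X] F).comp (algebraMap k k[X])).toAlgebra
  have : IsScalarTower k k[X] F := .of_algebraMap_eq fun _ => rfl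
  have : IsScalarTower k F K := .of_algebraMap_eq fun x => by
    rw [IsScalarTower.algebraMap_apply k k[X] K, IsScalarTower.algebraMap_apply k[X] F K]
    rfl
  have hk := finite_integralClosure_field (k := k) (K := K) F
  obtain ⟨s, b, hb⟩ := FiniteDimensional.exists_is_basis_integral k[X] F K
  choose r hr using fun i => exists_valuation_le_pow (hb i)
  let N := Finset.univ.sup r
  let B := (integralClosure k[X] K).toSubmodule
  -- the elements of `K` all of whose coordinates vanish to order `j` at infinity
  let Q (j : ℕ) : Submodule k K :=
    (Submodule.pi Set.univ fun _ => vanishingAtInfinity k F j).comap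
      (b.equivFun.toLinearMap.restrictScalars k)
  have hQ : ∀ j x, x ∈ Q j ↔ ∀ i, b.repr x i ∈ vanishingAtInfinity k F j := fun j x => by
    simp [Q]
  -- the basis elements have poles of order at most `N` at infinity, so an integral element with
  -- coordinates vanishing to order `N` is regular at infinity, and therefore everywhere
  have hinf : (B.restrictScalars k ⊓ Q N) ≤ (integralClosure k K).toSubmodule := by
    rintro x ⟨hxB, hxQ⟩
    rw [SetLike.mem_coe, hQ] at hxQ
    refine isIntegral_of_forall_mem_valuationSubring fun V hV => ?_
    by_cases hu : algebraMap k[X] K X ∈ V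
    · refine mem_of_isIntegral_of_forall_mem (A := k[X]) V
        (algebraMap_polynomial_mem V hV hu) hxB
    · rw [← V.valuation_le_one_iff, ← b.sum_repr x]
      refine Valuation.map_sum_le _ fun i _ => ?_
      rw [Algebra.smul_def, map_mul]
      have hu1 : 1 < V.valuation (algebraMap k[X] K X) :=
        not_le.mp (mt (V.valuation_le_one_iff _).mp hu)
      refine le_trans ?_ (valuation_mul_pow_le_one_of_mem_vanishingAtInfinity V hV hu (hxQ i))
      gcongr
      refine (hr i V hV hu).trans (pow_le_pow_right₀ hu1.le ?_)
      exact Finset.le_sup (f := r) (Finset.mem_univ i)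
  obtain ⟨S, hS, hle⟩ := vanishingAtInfinity_le_sup (k := k) (F := F) N
  let T : Submodule k K := ⨆ i, S.map (((LinearMap.toSpanSingleton F K (b i))).restrictScalars k)
  have hT : T.FG := Submodule.fg_iSup _ fun i => hS.map _
  have hQT : Q 1 ≤ Q N ⊔ T := by
    intro x hx
    rw [hQ] at hx
    choose y hy z hz hyz using fun i => Submodule.mem_sup.mp (hle (hx i))
    refine Submodule.mem_sup.mpr ⟨∑ i, y i • b i, ?_, ∑ i, z i • b i, ?_, ?_⟩
    · rw [hQ]
      intro i
      rw [b.repr_sum_self]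
      exact hy i
    · refine Submodule.sum_mem _ fun i _ => Submodule.mem_iSup_of_mem i ⟨z i, hz i, rfl⟩
    · rw [← Finset.sum_add_distrib]
      simp_rw [← add_smul, hyz, b.sum_repr]
  -- `Q N` has finite codimension in `Q 1`, and meets `B` in a finite-dimensional space
  have hE : (B.restrictScalars k ⊓ Q 1).FG := by
    refine Submodule.fg_of_fg_map_of_fg_inf_ker (Q N).mkQ ?_ ?_
    · have h : (B.restrictScalars k ⊓ Q 1).map (Q N).mkQ ≤ T.map (Q N).mkQ := by
        refine (Submodule.map_mono (inf_le_right.trans hQT)).trans ?_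
        rw [Submodule.map_sup, Submodule.mkQ_map_self, bot_sup_eq]
      have : FiniteDimensional k (T.map (Q N).mkQ) := Module.Finite.iff_fg.mpr (hT.map _)
      exact Submodule.FG.of_le (hT.map _) h
    · rw [Submodule.ker_mkQ]
      have : (integralClosure k K).toSubmodule.FG := Module.Finite.iff_fg.mp hk
      exact Submodule.FG.of_le this ((inf_le_inf_right _ inf_le_left).trans hinf)
  -- division with remainder for the coordinates
  have hB : B ≤ Submodule.span k[X] (Set.range b) ⊔
      Submodule.span k[X] ((B.restrictScalars k ⊓ Q 1 : Submodule k K) : Set K) := by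
    intro x hx
    choose p hp using fun i => exists_add_mem_vanishingAtInfinity (k := k) (b.repr x i)
    have h1 : ∑ i, p i • b i ∈ Submodule.span k[X] (Set.range b) :=
      Submodule.sum_mem _ fun i _ => Submodule.smul_mem _ _ (Submodule.subset_span ⟨i, rfl⟩)
    have h2 : ∑ i, p i • b i ∈ B := Submodule.sum_mem _ fun i _ => Submodule.smul_mem _ _ (hb i)
    refine Submodule.mem_sup.mpr ⟨_, h1, x - ∑ i, p i • b i, Submodule.subset_span ⟨?_, ?_⟩, ?_⟩
    · exact B.sub_mem hx h2
    · rw [SetLike.mem_coe, hQ]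
      intro i
      have : ∑ i, p i • b i = ∑ i, (algebraMap k[X] F (p i)) • b i :=
        Finset.sum_congr rfl fun i _ => (algebraMap_smul F _ _).symm
      rw [this, map_sub, Finsupp.sub_apply, b.repr_sum_self]
      exact hp i
    · exact add_sub_cancel _ _
  have hB' : Submodule.span k[X] (Set.range b) ⊔
      Submodule.span k[X] ((B.restrictScalars k ⊓ Q 1 : Submodule k K) : Set K) = B := by
    refine le_antisymm (sup_le ?_ ?_) hB
    · rw [Submodule.span_le]; rintro _ ⟨i, rfl⟩; exact hb i
    · rw [Submodule.span_le]; exact fun x hx => hx.1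
  refine Module.Finite.iff_fg.mpr (show B.FG from ?_)
  rw [← hB']
  refine (Submodule.fg_span (Set.finite_range b)).sup ?_
  obtain ⟨G, hG⟩ := hE
  rw [← hG]
  refine ⟨G, le_antisymm (Submodule.span_mono Submodule.subset_span) ?_⟩
  rw [Submodule.span_le]
  exact Submodule.span_le_restrictScalars k k[X] _

end IntegralClosure

/-! ### Function fields in one variable -/

section FunctionField

open Module Polynomial

/-- Finiteness of integral closures passes from `R` to a localization `O` of an integral `R`-algebra. -/
lemma finite_integralClosure_localization (R S O K : Type*) [CommRing R] [CommRing S] [CommRing O]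
    [Field K] [Algebra R S] [Algebra S O] [Algebra R O] [Algebra R K] [Algebra S K] [Algebra O K]
    [IsScalarTower R S K] [IsScalarTower S O K] [IsScalarTower R O K] [Algebra.IsIntegral R S]
    (M : Submonoid S) [IsLocalization M O] [Module.Finite R (integralClosure R K)] :
    Module.Finite O (integralClosure O K) := by
  have h : ∀ x : integralClosure R K, IsIntegral O (x : K) := fun x => x.2.tower_top
  let f : integralClosure R K →ₗ[R] integralClosure O K :=
    { toFun x := ⟨x, h x⟩
      map_add' _ _ := rfl
      map_smul' _ _ := rfl }
  obtain ⟨s, hs⟩ := Module.Finite.fg_top (R := R) (M := integralClosure R K)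
  classical
  refine ⟨s.image f, top_le_iff.mp fun y _ => ?_⟩
  obtain ⟨m, hm⟩ := IsIntegral.exists_multiple_integral_of_isLocalization (R := S) M (y : K) y.2
  have hm' : IsIntegral R (m • (y : K)) := isIntegral_trans _ hm
  obtain ⟨u, hu⟩ := IsLocalization.map_units O m
  have h1 : f ⟨_, hm'⟩ ∈ Submodule.span O (f '' (s : Set (integralClosure R K))) := by
    have : (⟨_, hm'⟩ : integralClosure R K) ∈ Submodule.span R (s : Set (integralClosure R K)) := by
      rw [hs]; trivial
    have := Submodule.mem_map_of_mem (f := f) this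
    rw [Submodule.map_span] at this
    exact Submodule.span_le_restrictScalars R O _ this
  have h2 : y = (u⁻¹ : Oˣ) • f ⟨_, hm'⟩ := by
    rw [eq_inv_smul_iff]
    refine Subtype.ext ?_
    change (u : O) • (y : K) = (m : S) • (y : K)
    rw [hu, algebraMap_smul]
  rw [Finset.coe_image, h2]
  exact Submodule.smul_mem _ _ h1

lemma isAlgebraic_of_trdeg_le (k A K : Type u) [Field k] [CommRing A] [IsDomain A] [Algebra k A]
    [Field K] [Algebra k K] [Algebra A K] [IsScalarTower k A K] [FaithfulSMul A K] {n : ℕ}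
    (h : Algebra.trdeg k K ≤ n) (h' : n ≤ Algebra.trdeg k A) : Algebra.IsAlgebraic A K := by
  rw [← trdeg_eq_zero_iff]
  have h0 := trdeg_add_eq k A (A := K)
  rw [← h0] at h
  have h1 : Algebra.trdeg A K < Cardinal.aleph0 :=
    lt_of_le_of_lt (le_add_self.trans h) (Cardinal.natCast_lt_aleph0)
  have h2 : Algebra.trdeg k A < Cardinal.aleph0 :=
    lt_of_le_of_lt (le_self_add.trans h) (Cardinal.natCast_lt_aleph0)
  obtain ⟨a, ha⟩ := Cardinal.lt_aleph0.mp h1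
  obtain ⟨b, hb⟩ := Cardinal.lt_aleph0.mp h2
  rw [ha, hb] at h
  rw [hb] at h'
  rw [ha]
  norm_cast at *
  omega

lemma finiteDimensional_of_trdeg_le_one (k F K : Type u) [Field k] [Field K] [Algebra k K]
    [Algebra.EssFiniteType k K] (h : Algebra.trdeg k K ≤ 1) [Algebra k[X] K]
    [IsScalarTower k k[X] K] [FaithfulSMul k[X] K] [Field F] [Algebra k[X] F] [IsFractionRing k[X] F]
    [Algebra F K] [IsScalarTower k[X] F K] : FiniteDimensional F K := by
  let : Algebra k F := ((algebraMap k[X] F).comp (algebraMap k k[X])).toAlgebra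
  have : IsScalarTower k k[X] F := .of_algebraMap_eq fun _ => rfl
  have : IsScalarTower k F K := .of_algebraMap_eq fun x => by
    rw [IsScalarTower.algebraMap_apply k k[X] K, IsScalarTower.algebraMap_apply k[X] F K]
    rfl
  have : Algebra.EssFiniteType F K := Algebra.EssFiniteType.of_comp k F K
  have halg : Algebra.IsAlgebraic k[X] K :=
    isAlgebraic_of_trdeg_le k k[X] K (n := 1) (by simpa using h)
      (by rw [Polynomial.trdeg_of_isDomain]; simp)
  have : Algebra.IsAlgebraic F K :=
    (IsFractionRing.comap_isAlgebraic_iff (A := k[X]) (K := F) (C := K)).mp halg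
  obtain ⟨S, hS⟩ := IntermediateField.fg_top F K
  have := IntermediateField.finiteDimensional_adjoin (K := F) (S := (S : Set K))
    (fun x _ => Algebra.IsIntegral.isIntegral x)
  rw [hS] at this
  exact IntermediateField.topEquiv.toLinearEquiv.finiteDimensional

lemma trdeg_le_one_of_dimensionLEOne (k A K : Type u) [Field k] [CommRing A] [IsDomain A]
    [Algebra k A] [Algebra.FiniteType k A] [Ring.DimensionLEOne A] [Field K] [Algebra A K]
    [IsFractionRing A K] [Algebra k K] [IsScalarTower k A K] : Algebra.trdeg k K ≤ 1 := by
  obtain ⟨n, g, hg, hfin⟩ := exists_finite_inj_algHom_of_fg k A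
  let : Algebra (MvPolynomial (Fin n) k) A := g.toRingHom.toAlgebra
  have : IsScalarTower k (MvPolynomial (Fin n) k) A := .of_algebraMap_eq fun x => (g.commutes x).symm
  have : Module.Finite (MvPolynomial (Fin n) k) A := hfin
  have hg' : Function.Injective (algebraMap (MvPolynomial (Fin n) k) A) := hg
  have : FaithfulSMul (MvPolynomial (Fin n) k) A := (faithfulSMul_iff_algebraMap_injective _ _).mpr hg
  -- the dimension does not drop in an integral extension
  have hdim : Ring.DimensionLEOne (MvPolynomial (Fin n) k) := ⟨fun {p} hp0 hp => by
    obtain ⟨Q, hQ, hQp⟩ := Ideal.exists_ideal_over_prime_of_isIntegral_of_isDomain (S := A) p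
      (by rw [(RingHom.injective_iff_ker_eq_bot _).mp hg']; exact bot_le)
    have hQ0 : Q ≠ ⊥ := by
      rintro rfl
      rw [← RingHom.ker_eq_comap_bot, (RingHom.injective_iff_ker_eq_bot _).mp hg'] at hQp
      exact hp0 hQp.symm
    have := hQ.isMaximal hQ0
    rw [← hQp]
    exact Ideal.isMaximal_comap_of_isIntegral_of_isMaximal Q⟩
  have hn : n ≤ 1 := by
    have h1 : ringKrullDim (MvPolynomial (Fin n) k) ≤ 1 :=
      (Order.krullDimLE_iff 1 _).mp (inferInstanceAs (Ring.KrullDimLE 1 _))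
    rw [MvPolynomial.ringKrullDim_of_isNoetherianRing, ringKrullDim_eq_zero_of_field] at h1
    simpa using h1
  let : Algebra (MvPolynomial (Fin n) k) K := ((algebraMap A K).comp g.toRingHom).toAlgebra
  have : IsScalarTower (MvPolynomial (Fin n) k) A K := .of_algebraMap_eq fun _ => rfl
  have : IsScalarTower k (MvPolynomial (Fin n) k) K := .of_algebraMap_eq fun x => by
    rw [IsScalarTower.algebraMap_apply k A K,
      IsScalarTower.algebraMap_apply (MvPolynomial (Fin n) k) A K,
      ← IsScalarTower.algebraMap_apply k (MvPolynomial (Fin n) k) A]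
  have : FaithfulSMul (MvPolynomial (Fin n) k) K := FaithfulSMul.trans _ A K
  have : Algebra.IsAlgebraic A K := (IsFractionRing.comap_isAlgebraic_iff (K := K)).mpr inferInstance
  have : Algebra.IsAlgebraic (MvPolynomial (Fin n) k) K := Algebra.IsAlgebraic.trans _ A K
  rw [← trdeg_add_eq k (MvPolynomial (Fin n) k) (A := K), trdeg_eq_zero (R := MvPolynomial (Fin n) k), add_zero,
    MvPolynomial.trdeg_of_isDomain]
  simpa using hn

/-- A finite extension of `k(T)` is finitely generated, of transcendence degree at most one. -/
lemma essFiniteType_and_trdeg_le_one (k F K : Type u) [Field k] [Field F] [Field K] [Algebra k K]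
    [Algebra k[X] K] [IsScalarTower k k[X] K] [Algebra k[X] F] [IsFractionRing k[X] F]
    [Algebra F K] [IsScalarTower k[X] F K] [FiniteDimensional F K] :
    Algebra.EssFiniteType k K ∧ Algebra.trdeg k K ≤ 1 := by
  have : FaithfulSMul k[X] K := FaithfulSMul.trans k[X] F K
  have : Algebra.EssFiniteType k[X] F := .of_isLocalization F (nonZeroDivisors k[X])
  have : Algebra.EssFiniteType k[X] K := .comp _ F _
  refine ⟨.comp _ k[X] _, ?_⟩
  have : Algebra.IsAlgebraic k[X] K :=
    (IsFractionRing.comap_isAlgebraic_iff (A := k[X]) (K := F) (C := K)).mpr inferInstance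
  rw [← trdeg_add_eq k k[X] (A := K), trdeg_eq_zero (R := k[X]), add_zero,
    Polynomial.trdeg_of_isDomain]

lemma finite_integralClosure_of_surjective (A A' K : Type*) [CommRing A] [CommRing A'] [Field K]
    [Algebra A A'] [Algebra A K] [Algebra A' K] [IsScalarTower A A' K]
    (h : Function.Surjective (algebraMap A A')) [Module.Finite A' (integralClosure A' K)] :
    Module.Finite A (integralClosure A K) := by
  have : Algebra.IsIntegral A A' := ⟨fun x => by
    obtain ⟨y, rfl⟩ := h x; exact isIntegral_algebraMap⟩
  have : Module.Finite A A' := Module.Finite.of_surjective (Algebra.linearMap A A') h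
  have : Module.Finite A (integralClosure A' K) := Module.Finite.trans A' _
  let f : integralClosure A' K →ₗ[A] integralClosure A K :=
    { toFun x := ⟨x, isIntegral_trans _ x.2⟩
      map_add' _ _ := rfl
      map_smul' r x := Subtype.ext rfl }
  exact Module.Finite.of_surjective f fun x => ⟨⟨x, x.2.tower_top⟩, rfl⟩

/-- Finiteness of the integral closure in a function field of one variable, over any finitely generated
`k`-algebra whose image in the field contains a transcendental element. By Noether normalization, that
image is finite over a polynomial ring in one variable. -/
lemma finite_integralClosure_of_finiteType (k A K : Type u) [Field k] [CommRing A]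
    [Algebra k A] [Algebra.FiniteType k A] [Field K] [Algebra A K]
    [Algebra k K] [IsScalarTower k A K] [Algebra.EssFiniteType k K] (h : Algebra.trdeg k K ≤ 1)
    (a : A) (ha : Transcendental k (algebraMap A K a)) : Module.Finite A (integralClosure A K) := by
  let A' := (IsScalarTower.toAlgHom k A K).range
  have : Algebra.FiniteType k A' :=
    Algebra.FiniteType.of_surjective _ (IsScalarTower.toAlgHom k A K).rangeRestrict_surjective
  obtain ⟨n, g, hg, hfin⟩ := exists_finite_inj_algHom_of_fg k A'
  have hind : AlgebraicIndependent k (fun i => ((g (.X i) : A') : K)) := by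
    have : MvPolynomial.aeval (fun i => ((g (.X i) : A') : K)) = A'.val.comp g := by
      ext i; simp
    rw [AlgebraicIndependent, this]
    exact Subtype.val_injective.comp hg
  have hn : n ≤ 1 := by
    have := hind.lift_cardinalMk_le_trdeg
    simp only [Cardinal.mk_fintype, Fintype.card_fin, Cardinal.lift_natCast] at this
    rw [Cardinal.lift_uzero] at this
    exact Nat.cast_le_one.mp (this.trans h)
  have hint : g.toRingHom.IsIntegral := hfin.to_isIntegral
  have hn0 : n ≠ 0 := by
    rintro rfl
    have h1 : (g.toRingHom.comp (algebraMap k (MvPolynomial (Fin 0) k))).IsIntegral :=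
      RingHom.IsIntegral.trans _ _ (RingHom.isIntegral_of_surjective _
        (MvPolynomial.isEmptyAlgEquiv k (Fin 0)).symm.surjective) hint
    have h2 : IsIntegral k (⟨algebraMap A K a, a, rfl⟩ : A') := by
      have := h1 ⟨algebraMap A K a, a, rfl⟩
      have e : g.toRingHom.comp (algebraMap k (MvPolynomial (Fin 0) k)) = algebraMap k A' :=
        g.comp_algebraMap
      rwa [e] at this
    exact ha (h2.map A'.val).isAlgebraic
  obtain rfl : n = 1 := by omega
  -- `A'` is finite over the polynomial ring in `x`
  let x : A' := g (.X 0)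
  have hx : Transcendental k (x : K) := hind.transcendental 0
  let e : k[X] →ₐ[k] MvPolynomial (Fin 1) k := aeval (.X 0)
  have he : Function.Surjective e := by
    intro p
    refine ⟨MvPolynomial.aeval (fun _ => (X : k[X])) p, ?_⟩
    have : e.comp (MvPolynomial.aeval (fun _ => (X : k[X]))) = AlgHom.id k _ := by
      ext i
      simp [e, Fin.fin_one_eq_zero i]
    exact DFunLike.congr_fun this p
  have hint' : (g.comp e).toRingHom.IsIntegral :=
    RingHom.IsIntegral.trans _ _ (RingHom.isIntegral_of_surjective e.toRingHom he) hint
  let : Algebra k[X] A' := (g.comp e).toRingHom.toAlgebra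
  have : Algebra.IsIntegral k[X] A' := ⟨hint'⟩
  let : Algebra k[X] K := ((algebraMap A' K).comp (g.comp e).toRingHom).toAlgebra
  have : IsScalarTower k[X] A' K := .of_algebraMap_eq fun _ => rfl
  have : IsScalarTower k k[X] K := .of_algebraMap_eq fun c => by
    change _ = ((g.comp e) (algebraMap k k[X] c) : K)
    rw [AlgHom.commutes]
    rfl
  have hinj : Function.Injective (algebraMap k[X] K) := by
    have h1 : ∀ p, algebraMap k[X] K p = aeval (x : K) p := fun p => by
      have h2 : (A'.val.comp (g.comp e)) = aeval (x : K) := by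
        ext; simp [e, x]
      exact DFunLike.congr_fun h2 p
    intro p q hpq
    rw [h1, h1] at hpq
    exact (transcendental_iff_injective.mp hx) hpq
  have : FaithfulSMul k[X] K := (faithfulSMul_iff_algebraMap_injective _ _).mpr hinj
  let : Algebra (FractionRing k[X]) K := FractionRing.liftAlgebra k[X] K
  have : IsScalarTower k[X] (FractionRing k[X]) K := FractionRing.isScalarTower_liftAlgebra _ _
  have := finiteDimensional_of_trdeg_le_one k (FractionRing k[X]) K h
  have := finite_integralClosure_polynomial (k := k) (K := K) (FractionRing k[X])
  have : IsLocalization (⊥ : Submonoid A') A' := IsLocalization.self (by simp)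
  have := finite_integralClosure_localization k[X] A' A' K ⊥
  let : Algebra A A' := (IsScalarTower.toAlgHom k A K).rangeRestrict.toRingHom.toAlgebra
  have : IsScalarTower A A' K := .of_algebraMap_eq fun _ => rfl
  exact finite_integralClosure_of_surjective A A' K
    (IsScalarTower.toAlgHom k A K).rangeRestrict_surjective

end FunctionField

/-! ### Centres of valuation rings on schemes -/

section Centre

open IsLocalRing

variable {K : Type u} [Field K]

/-- The closed point of the spectrum of a local ring. -/
def specClosedPoint (R : Type u) [CommRing R] [IsLocalRing R] : Spec (.of R) := closedPoint R

/-- The point `y` of `Y` is a centre of the valuation ring `V` of `K` with respect to a `K`-valued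
point `g` of `Y`: the morphism `g` extends to `Spec V`, with the closed point mapping to `y`. -/
def IsCenter {Y : Scheme.{u}} (g : Spec (.of K) ⟶ Y) (V : ValuationSubring K) (y : Y) : Prop :=
  ∃ h : Spec (.of V) ⟶ Y, Spec.map (CommRingCat.ofHom (algebraMap V K)) ≫ h = g ∧
    h (specClosedPoint V) = y

lemma IsCenter.comp {Y Z : Scheme.{u}} {g : Spec (.of K) ⟶ Y} {V : ValuationSubring K} {y : Y}
    (hy : IsCenter g V y) (f : Y ⟶ Z) : IsCenter (g ≫ f) V (f y) := by
  obtain ⟨h, rfl, rfl⟩ := hy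
  exact ⟨h ≫ f, by simp, Scheme.Hom.comp_apply _ _ _⟩

lemma spec_map_valuationSubring_ext {R : CommRingCat.{u}} {V : ValuationSubring K}
    {a b : Spec (.of V) ⟶ Spec R}
    (h : Spec.map (CommRingCat.ofHom (algebraMap V K)) ≫ a =
      Spec.map (CommRingCat.ofHom (algebraMap V K)) ≫ b) : a = b := by
  obtain ⟨a, rfl⟩ := Spec.map_surjective a
  obtain ⟨b, rfl⟩ := Spec.map_surjective b
  rw [← Spec.map_comp, ← Spec.map_comp] at h
  have := Spec.map_injective h
  congr 1
  ext x
  have h2 := congrArg (fun f => f.hom x) this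
  exact congrArg Subtype.val (Subtype.ext h2 : a.hom x = b.hom x)

/-- Uniqueness of centres on separated schemes. -/
lemma IsCenter.unique {Y : Scheme.{u}} {R : CommRingCat.{u}} (f : Y ⟶ Spec R) [IsSeparated f]
    {g : Spec (.of K) ⟶ Y} {V : ValuationSubring K} {y y' : Y}
    (hy : IsCenter g V y) (hy' : IsCenter g V y') : y = y' := by
  obtain ⟨h, h1, rfl⟩ := hy
  obtain ⟨h', h1', rfl⟩ := hy'
  have e : h ≫ f = h' ≫ f := spec_map_valuationSubring_ext (by
    rw [reassoc_of% h1, reassoc_of% h1'])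
  have := (IsSeparated.valuativeCriterion f) ⟨V, K, g, h ≫ f, ⟨by rw [reassoc_of% h1]⟩⟩
  have : (⟨h, h1, rfl⟩ : CommSq.LiftStruct _) = ⟨h', h1', e.symm⟩ := Subsingleton.elim _ _
  rw [show h = h' from congrArg CommSq.LiftStruct.l this]

/-- Centres lift along proper morphisms. -/
lemma IsCenter.exists_lift {Y Z : Scheme.{u}} (f : Y ⟶ Z) [IsProper f] {g : Spec (.of K) ⟶ Y}
    {V : ValuationSubring K} {z : Z} (hz : IsCenter (g ≫ f) V z) :
    ∃ y, IsCenter g V y ∧ f y = z := by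
  obtain ⟨h, h1, rfl⟩ := hz
  have hf : ValuativeCriterion.Existence f := by
    have : UniversallyClosed f := inferInstance
    rw [UniversallyClosed.eq_valuativeCriterion] at this
    exact this.1
  obtain ⟨⟨l⟩⟩ := hf ⟨V, K, g, h, ⟨h1.symm⟩⟩
  exact ⟨_, ⟨l.l, l.fac_left, rfl⟩, by rw [← Scheme.Hom.comp_apply, l.fac_right]⟩

lemma isCenter_spec_iff {R : Type u} [CommRing R] [Algebra R K] {V : ValuationSubring K}
    {p : Spec (.of R)} :
    IsCenter (Spec.map (CommRingCat.ofHom (algebraMap R K))) V p ↔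
      ∃ hV : ∀ a : R, algebraMap R K a ∈ V, p.asIdeal = valCenter R V hV := by
  constructor
  · rintro ⟨h, h1, rfl⟩
    obtain ⟨h, rfl⟩ := Spec.map_surjective h
    rw [← Spec.map_comp] at h1
    have h2 : ∀ a : R, (h.hom a : K) = algebraMap R K a := fun a =>
      congrArg (fun f => f.hom a) (Spec.map_injective h1)
    refine ⟨fun a => h2 a ▸ (h.hom a).2, ?_⟩
    ext a
    rw [mem_valCenter, ← h2, ValuationSubring.mem_nonunits_iff_exists_mem_maximalIdeal]
    constructor
    · intro ha; exact ⟨(h.hom a).2, ha⟩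
    · rintro ⟨_, ha⟩; exact ha
  · rintro ⟨hV, hp⟩
    refine ⟨Spec.map (CommRingCat.ofHom ((algebraMap R K).codRestrict V.toSubring hV)), ?_, ?_⟩
    · rw [← Spec.map_comp]
      rfl
    · exact PrimeSpectrum.ext hp.symm

/-- The canonical `K`-valued point of an integral scheme `Y`, for an extension `K` of the function
field of `Y`. -/
def genericHom (K : Type u) [Field K] (Y : Scheme.{u}) [IsIntegral Y] [Algebra Y.functionField K] :
    Spec (.of K) ⟶ Y :=
  Spec.map (CommRingCat.ofHom (algebraMap Y.functionField K)) ≫ Y.fromSpecStalk (genericPoint Y)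

lemma genericHom_eq (Y : Scheme.{u}) [IsIntegral Y] [Algebra Y.functionField K] (y : Y)
    [Algebra (Y.presheaf.stalk y) K] [IsScalarTower (Y.presheaf.stalk y) Y.functionField K] :
    genericHom K Y = Spec.map (CommRingCat.ofHom (algebraMap (Y.presheaf.stalk y) K)) ≫
      Y.fromSpecStalk y := by
  have h := Scheme.SpecMap_stalkSpecializes_fromSpecStalk
    ((genericPoint_spec Y).specializes (Set.mem_univ y))
  rw [genericHom, ← h, ← Spec.map_comp_assoc]
  congr 2
  ext x
  exact (IsScalarTower.algebraMap_apply (Y.presheaf.stalk y) Y.functionField K x).symm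

lemma isCenter_genericHom_iff (Y : Scheme.{u}) [IsIntegral Y] [Algebra Y.functionField K] (y : Y)
    [Algebra (Y.presheaf.stalk y) K] [IsScalarTower (Y.presheaf.stalk y) Y.functionField K]
    (V : ValuationSubring K) :
    IsCenter (genericHom K Y) V y ↔ Dominates (Y.presheaf.stalk y) V := by
  constructor
  · rintro ⟨h, h1, rfl⟩
    let f : Y.presheaf.stalk (h (specClosedPoint V)) ⟶ .of V :=
      Scheme.stalkClosedPointTo (R := .of V) h
    have hf : Spec.map f ≫ Y.fromSpecStalk (h (specClosedPoint V)) = h := Scheme.Spec_stalkClosedPointTo_fromSpecStalk _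
    rw [← hf, genericHom_eq Y (h (specClosedPoint V)), ← Spec.map_comp_assoc, cancel_mono] at h1
    have h2 : ∀ a, (f.hom a : K) = algebraMap _ K a := fun a =>
      congrArg (fun f => f.hom a) (Spec.map_injective h1)
    have : IsLocalHom f.hom := Scheme.isLocalHom_stalkClosedPointTo (R := .of V) h
    refine ⟨fun a => h2 a ▸ (f.hom a).2, fun a ha => ?_⟩
    rw [← h2, ValuationSubring.mem_nonunits_iff_exists_mem_maximalIdeal]
    exact ⟨(f.hom a).2, (mem_maximalIdeal _).mpr fun hu => (mem_maximalIdeal _).mp ha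
      (isUnit_of_map_unit f.hom a hu)⟩
  · rintro ⟨hV, hm⟩
    let f : Y.presheaf.stalk y →+* V := (algebraMap _ K).codRestrict V.toSubring hV
    have : IsLocalHom f := ((local_hom_TFAE f).out 0 2).mpr (Ideal.map_le_iff_le_comap.mpr fun a ha => by
      have := hm a ha
      rw [ValuationSubring.mem_nonunits_iff_exists_mem_maximalIdeal] at this
      exact this.2)
    refine ⟨Spec.map (CommRingCat.ofHom f) ≫ Y.fromSpecStalk y, ?_, ?_⟩
    · rw [← Spec.map_comp_assoc, genericHom_eq Y y]
      rfl
    · have : Spec.map (CommRingCat.ofHom f) (specClosedPoint V) = closedPoint (Y.presheaf.stalk y) :=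
        IsLocalRing.comap_closedPoint f
      rw [Scheme.Hom.comp_apply, this, Scheme.fromSpecStalk_closedPoint]

/-- Every point of an integral scheme is the centre of a valuation ring. -/
lemma exists_isCenter (Y : Scheme.{u}) [IsIntegral Y] [Algebra Y.functionField K] (y : Y) :
    ∃ V : ValuationSubring K, IsCenter (genericHom K Y) V y := by
  let : Algebra (Y.presheaf.stalk y) K :=
    ((algebraMap Y.functionField K).comp (algebraMap (Y.presheaf.stalk y) Y.functionField)).toAlgebra
  have : IsScalarTower (Y.presheaf.stalk y) Y.functionField K := .of_algebraMap_eq fun _ => rfl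
  obtain ⟨V, hV, h⟩ := exists_factor_valuationRing (algebraMap (Y.presheaf.stalk y) K)
  refine ⟨V, (isCenter_genericHom_iff Y y V).mpr ⟨hV, fun a ha => ?_⟩⟩
  rw [ValuationSubring.mem_nonunits_iff_exists_mem_maximalIdeal]
  exact ⟨hV a, (mem_maximalIdeal _).mpr fun hu => (mem_maximalIdeal _).mp ha
      (h.map_nonunit _ hu)⟩

lemma genericHom_specClosedPoint (Y : Scheme.{u}) [IsIntegral Y] [Algebra Y.functionField K] :
    genericHom K Y (specClosedPoint K) = genericPoint Y := by
  rw [genericHom, Scheme.Hom.comp_apply]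
  have : Spec.map (CommRingCat.ofHom (algebraMap Y.functionField K)) (specClosedPoint K) =
    closedPoint Y.functionField := IsLocalRing.comap_closedPoint _
  rw [this]
  exact Scheme.fromSpecStalk_closedPoint

/-- A `K`-valued point whose image is the generic point comes from an embedding of the function
field in `K`. -/
lemma exists_genericHom_eq (Y : Scheme.{u}) [IsIntegral Y] (g : Spec (.of K) ⟶ Y)
    (hg : g (specClosedPoint K) = genericPoint Y) :
    ∃ _ : Algebra Y.functionField K, genericHom K Y = g := by
  have h := Scheme.Spec_stalkClosedPointTo_fromSpecStalk (R := .of K) g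
  generalize Scheme.stalkClosedPointTo (R := .of K) g = f at h
  revert f
  rw [show g (closedPoint (CommRingCat.of K)) = genericPoint Y from hg]
  exact fun f h => ⟨f.hom.toAlgebra, h⟩

end Centre

/-! ### Points of curves -/

section Curve

variable {C : Scheme.{u}} [IsIntegral C]

lemma krullDim_points_eq {X : Scheme.{u}} : Order.krullDim X = topologicalKrullDim X :=
  (Order.krullDim_eq_of_orderIso (irreducibleSetEquivPoints (α := X))).symm

lemma lt_of_specializes_of_ne {X : Scheme.{u}} {x y : X} (h : y ⤳ x) (hne : x ≠ y) : x < y :=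
  lt_iff_le_not_ge.mpr ⟨h, fun h' => hne (Specializes.antisymm h' h).eq⟩

lemma isClosed_singleton_of_ne_genericPoint (hC : topologicalKrullDim C ≤ 1) {c : C}
    (hc : c ≠ genericPoint C) : IsClosed ({c} : Set C) := by
  rw [← closure_eq_iff_isClosed]
  refine Set.Subset.antisymm (fun x hx => ?_) subset_closure
  by_contra hne
  have h1 : x < c := lt_of_specializes_of_ne (specializes_iff_mem_closure.mpr hx) hne
  have h2 : c < genericPoint C := lt_of_specializes_of_ne (genericPoint_specializes c) hc
  have h3 : Order.coheight c + 1 ≤ Order.coheight x := Order.coheight_add_one_le h1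
  have h4 : Order.coheight (genericPoint C) + 1 ≤ Order.coheight c := Order.coheight_add_one_le h2
  have h5 := (Order.coheight_le_krullDim x).trans (krullDim_points_eq.trans_le hC)
  have h6 : Order.coheight x ≤ 1 := by exact_mod_cast h5
  have h7 : (1 + 1 : ℕ∞) ≤ 1 := calc
    1 + 1 ≤ Order.coheight (genericPoint C) + 1 + 1 := by gcongr; exact le_add_self
    _ ≤ 1 := (add_le_add_left h4 1).trans (h3.trans h6)
  exact absurd h7 (by decide)

lemma coheight_eq_one_of_ne_genericPoint (hC : topologicalKrullDim C ≤ 1) {c : C}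
    (hc : c ≠ genericPoint C) : Order.coheight c = 1 := by
  have h2 : c < genericPoint C := lt_of_specializes_of_ne (genericPoint_specializes c) hc
  refine le_antisymm ?_ ?_
  · have h3 := (Order.coheight_le_krullDim c).trans (krullDim_points_eq.trans_le hC)
    exact_mod_cast h3
  · rw [Order.one_le_iff_ne_zero, Ne, Order.coheight_eq_zero]
    exact fun h => h2.not_isMax h

lemma coheight_genericPoint : Order.coheight (genericPoint C) = 0 := by
  rw [Order.coheight_eq_zero]
  exact fun x _ => genericPoint_specializes x

/-- A proper closed subset of a noetherian integral curve is finite. -/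
lemma finite_of_isClosed_of_notMem [TopologicalSpace.NoetherianSpace C]
    (hC : topologicalKrullDim C ≤ 1) {Z : Set C} (hZ : IsClosed Z) (h : genericPoint C ∉ Z) :
    Z.Finite := by
  obtain ⟨S, hS, hSc, hSi, rfl⟩ :=
    TopologicalSpace.NoetherianSpace.exists_finite_set_isClosed_irreducible hZ
  refine hS.sUnion fun t ht => ?_
  obtain ⟨x, hx⟩ := QuasiSober.sober (hSi t ht) (hSc t ht)
  have hxt : x ∈ t := hx.mem
  have hne : x ≠ genericPoint C := by
    rintro rfl
    exact h ⟨t, ht, hxt⟩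
  rw [← hx.def, (isClosed_singleton_of_ne_genericPoint hC hne).closure_eq]
  exact Set.finite_singleton x

variable [IsLocallyNoetherian C]

/-- A non-zero rational function has zeros and poles at only finitely many points. -/
lemma finite_ord_ne_zero [CompactSpace C] (hC : topologicalKrullDim C ≤ 1) (f : C.functionField)
    (hf : f ≠ 0) : {c : C | Scheme.ord f c ≠ 0}.Finite := by
  have : IsNoetherian C := { }
  obtain ⟨U, -, f', hU, rfl, hf'⟩ := exists_isUnit_germ_eq C f hf
  refine (finite_of_isClosed_of_notMem hC U.isOpen.isClosed_compl ?_).subset fun c hc hcU => ?_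
  · rw [Set.mem_compl_iff, not_not]
    exact ((genericPoint_spec C).mem_open_set_iff U.isOpen).mpr (by
      obtain ⟨x⟩ := hU; exact ⟨x.1, trivial, x.2⟩)
  · exact hc (Scheme.ord_of_isUnit hf' hcU)

open IsLocalRing Module

/-- A valuation ring is maximal for domination: it is identified with any valuation ring of its field
of fractions which dominates it. This applies to the local rings of a normal curve. -/
lemma bijective_of_dominates {O K : Type*} [CommRing O] [IsDomain O]
    [ValuationRing O] [Field K] [Algebra O K] [IsFractionRing O K] {V : ValuationSubring K}
    (hV : Dominates O V) :
    Function.Bijective ((algebraMap O K).codRestrict V.toSubring hV.1) := by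
  constructor
  · intro a b hab
    exact IsFractionRing.injective O K (congrArg Subtype.val hab)
  · intro x
    rcases ValuationRing.isInteger_or_isInteger O (x : K) with ⟨a, ha⟩ | ⟨a, ha⟩
    · exact ⟨a, Subtype.ext ha⟩
    · by_cases hu : IsUnit a
      · obtain ⟨b, hb⟩ := hu.exists_right_inv
        refine ⟨b, Subtype.ext ?_⟩
        have h1 := congrArg (algebraMap O K) hb
        rw [map_mul, ha, map_one] at h1
        change algebraMap O K b = x
        have : (x : K)⁻¹ ≠ 0 := left_ne_zero_of_mul_eq_one h1
        rw [← inv_inv (x : K)]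
        exact eq_inv_of_mul_eq_one_right h1
      · have h1 := hV.2 a ((mem_maximalIdeal _).mpr hu)
        rw [ha, ValuationSubring.mem_nonunits_iff_or, inv_inv] at h1
        rcases h1 with h1 | h1
        · refine ⟨0, Subtype.ext ?_⟩
          change algebraMap O K 0 = x
          rw [map_zero]
          exact (inv_eq_zero.mp h1).symm
        · exact absurd x.2 h1

lemma eq_of_dominates {O K : Type*} [CommRing O] [IsDomain O]
    [ValuationRing O] [Field K] [Algebra O K] [IsFractionRing O K] {V V' : ValuationSubring K}
    (hV : Dominates O V) (hV' : Dominates O V') : V = V' := by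
  ext x
  constructor
  · intro hx
    obtain ⟨a, ha⟩ := (bijective_of_dominates hV).2 ⟨x, hx⟩
    rw [← show algebraMap O K a = x from congrArg Subtype.val ha]
    exact hV'.1 a
  · intro hx
    obtain ⟨a, ha⟩ := (bijective_of_dominates hV').2 ⟨x, hx⟩
    rw [← show algebraMap O K a = x from congrArg Subtype.val ha]
    exact hV.1 a

lemma exists_dominates {O : Type*} (K : Type*) [CommRing O] [IsLocalRing O]
    [Field K] [Algebra O K] : ∃ V : ValuationSubring K, Dominates O V := by
  obtain ⟨V, hV, h⟩ := exists_factor_valuationRing (algebraMap O K)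
  refine ⟨V, hV, fun a ha => ?_⟩
  rw [ValuationSubring.mem_nonunits_iff_exists_mem_maximalIdeal]
  exact ⟨hV a, (mem_maximalIdeal _).mpr fun hu => (mem_maximalIdeal _).mp ha
      (h.map_nonunit _ hu)⟩

lemma isDiscreteValuationRing_stalk {c : C} (hc : Order.coheight c = 1)
    [IsIntegrallyClosed (C.presheaf.stalk c)] :
    IsDiscreteValuationRing (C.presheaf.stalk c) := by
  have h1 : Ring.KrullDimLE 1 (C.presheaf.stalk c) := krullDimLE_of_coheight_le hc.le
  have h2 : Ring.DimensionLEOne (C.presheaf.stalk c) :=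
    ⟨fun {p} hp0 hp => Ring.krullDimLE_one_iff_of_noZeroDivisors.mp h1 p hp0 hp⟩
  have h3 : IsDedekindDomain (C.presheaf.stalk c) := { }
  refine ((IsDiscreteValuationRing.TFAE (C.presheaf.stalk c) fun hf => ?_).out 2 0).mp h3
  have := ringKrullDim_stalk_eq_coheight c
  rw [ringKrullDim_eq_zero_of_isField hf, hc] at this
  exact absurd this (by decide)

lemma valLength_eq_ord {O K : Type*} [CommRing O] [IsDomain O]
    [ValuationRing O] [Field K] [Algebra O K] [IsFractionRing O K] {V : ValuationSubring K}
    (hV : Dominates O V) (a : O) :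
    valLength V (algebraMap O K a) = Ring.ord O a := by
  let e : O ≃+* V := RingEquiv.ofBijective _ (bijective_of_dominates hV)
  change valLength V (e a : K) = _
  rw [valLength_coe, Ring.ord]
  let : Algebra O V := e.toRingHom.toAlgebra
  rw [← Module.length_eq_of_surjective (S := O) (R := V) (M := V ⧸ Ideal.span {e a}) e.surjective]
  let f : O →ₗ[O] V ⧸ Ideal.span {e a} :=
    ((Ideal.span {e a}).mkQ.restrictScalars O) ∘ₗ Algebra.linearMap O V
  have hf : Function.Surjective f := ((Ideal.span {e a}).mkQ_surjective).comp e.surjective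
  have hk : LinearMap.ker f = Ideal.span {a} := by
    ext x
    rw [LinearMap.mem_ker]
    change Ideal.Quotient.mk (Ideal.span {e a}) (e x) = 0 ↔ _
    rw [Ideal.Quotient.eq_zero_iff_mem, Ideal.mem_span_singleton, Ideal.mem_span_singleton,
      map_dvd_iff]
  rw [← (f.quotKerEquivOfSurjective hf).length_eq]
  exact (Submodule.quotEquivOfEq _ _ hk).length_eq

/-- The order of vanishing at `c` of a function which is regular at `c` is its value. -/
lemma ord_eq_valLength {c : C} (hc : Order.coheight c = 1)
    [IsIntegrallyClosed (C.presheaf.stalk c)] {V : ValuationSubring C.functionField}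
    (hV : Dominates (C.presheaf.stalk c) V) {x : C.functionField} (hx : x ∈ V) (hx0 : x ≠ 0) :
    Scheme.ord x c = (valLength V x).toNat := by
  have := isDiscreteValuationRing_stalk hc
  obtain ⟨a, ha⟩ := (bijective_of_dominates hV).2 ⟨x, hx⟩
  obtain rfl : algebraMap _ _ a = x := congrArg Subtype.val ha
  have ha0 : a ≠ 0 := by rintro rfl; simp at hx0
  have : Ring.KrullDimLE 1 (C.presheaf.stalk c) := krullDimLE_of_coheight_le hc.le
  rw [valLength_eq_ord hV, Scheme.ord_eq_iff hc hx0]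
  refine (Ring.ordFrac_eq_ord _ ha0).trans ?_
  have h1 : Ring.ord (C.presheaf.stalk c) a ≠ ⊤ :=
    Ring.ord_ne_top (mem_nonZeroDivisors_of_ne_zero ha0)
  exact Ring.ordMonoidWithZeroHom_eq_coe _ (mem_nonZeroDivisors_of_ne_zero ha0)
    (ENat.natCast_toNat h1).symm

lemma valLength_eq_zero_of_inv_mem {K : Type*} [Field K] {V : ValuationSubring K} {x : K}
    (hx : x ∈ V) (hx' : x⁻¹ ∈ V) (hx0 : x ≠ 0) : valLength V x = 0 := by
  have hu : IsUnit (⟨x, hx⟩ : V) := .of_mul_eq_one ⟨x⁻¹, hx'⟩ (Subtype.ext (mul_inv_cancel₀ hx0))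
  exact (valLength_coe V ⟨x, hx⟩).trans (Ring.ord_of_isUnit hu)

lemma ord_eq_zero_of_inv_mem {c : C} (hc : Order.coheight c = 1)
    [IsIntegrallyClosed (C.presheaf.stalk c)] {V : ValuationSubring C.functionField}
    (hV : Dominates (C.presheaf.stalk c) V) {x : C.functionField} (hx : x ∈ V) (hx' : x⁻¹ ∈ V) :
    Scheme.ord x c = 0 := by
  rcases eq_or_ne x 0 with rfl | hx0
  · simp
  · rw [ord_eq_valLength hc hV hx hx0, valLength_eq_zero_of_inv_mem hx hx' hx0]
    rfl

end Curve

/-! ### Stalks and residue fields over an affine base -/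

lemma length_eq_length_quotient {A B : Type*} [CommRing A] [CommRing B] (g : A →+* B)
    (hg : Function.Surjective g) {I : Ideal A} (h : RingHom.ker g = I) :
    Module.length B B = Module.length A (A ⧸ I) := by
  let := g.toAlgebra
  rw [← Module.length_eq_of_surjective (S := A) (M := B) (R := B) hg,
    ← ((Algebra.linearMap A B).quotKerEquivOfSurjective hg).length_eq]
  exact (Submodule.quotEquivOfEq _ _ h).length_eq

section Stalk

open IsLocalRing

/-- For a scheme over `Spec R`, the ring homomorphism from `R` to a stalk. -/
def toStalk {R : Type u} [CommRing R] {Y : Scheme.{u}} (f : Y ⟶ Spec (.of R)) (y : Y) :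
    R →+* Y.presheaf.stalk y :=
  (Spec.preimage (Y.fromSpecStalk y ≫ f)).hom

lemma spec_map_toStalk {R : Type u} [CommRing R] {Y : Scheme.{u}} (f : Y ⟶ Spec (.of R)) (y : Y) :
    Spec.map (CommRingCat.ofHom (toStalk f y)) = Y.fromSpecStalk y ≫ f :=
  Spec.map_preimage _

lemma toStalk_eq {R : Type u} [CommRing R] {Y : Scheme.{u}} {f : Y ⟶ Spec (.of R)} {y : Y}
    {g : R →+* Y.presheaf.stalk y} (h : Spec.map (CommRingCat.ofHom g) = Y.fromSpecStalk y ≫ f) :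
    toStalk f y = g := by
  rw [toStalk, ← h]
  exact congrArg CommRingCat.Hom.hom (Spec.preimage_map _)

lemma toStalk_comp {R : Type u} [CommRing R] {Y Z : Scheme.{u}} (g : Z ⟶ Y)
    (f : Y ⟶ Spec (.of R)) (z : Z) :
    toStalk (g ≫ f) z = (g.stalkMap z).hom.comp (toStalk f (g z)) := by
  refine toStalk_eq ?_
  rw [CommRingCat.ofHom_comp, Spec.map_comp, spec_map_toStalk]
  exact Scheme.SpecMap_stalkMap_fromSpecStalk_assoc _ _

lemma toStalk_comp_spec_map {R R' : Type u} [CommRing R] [CommRing R'] {Y : Scheme.{u}}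
    (f : Y ⟶ Spec (.of R)) (ψ : R' →+* R) (y : Y) :
    toStalk (f ≫ Spec.map (CommRingCat.ofHom ψ)) y = (toStalk f y).comp ψ := by
  refine toStalk_eq ?_
  rw [CommRingCat.ofHom_comp, Spec.map_comp, spec_map_toStalk, Category.assoc]

lemma residueDegree_comp {X Y Z : Scheme.{u}} (f : X ⟶ Y) (g : Y ⟶ Z) (x : X) :
    (f ≫ g).residueDegree x = g.residueDegree (f x) * f.residueDegree x := by
  let := (f.residueFieldMap x).hom.toAlgebra
  let := (g.residueFieldMap (f x)).hom.toAlgebra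
  let : Algebra (Z.residueField (g (f x))) (X.residueField x) :=
    ((f ≫ g).residueFieldMap x).hom.toAlgebra
  have : IsScalarTower (Z.residueField (g (f x))) (Y.residueField (f x)) (X.residueField x) :=
    .of_algebraMap_eq fun a => by
      change ((f ≫ g).residueFieldMap x).hom a = _
      rw [Scheme.residueFieldMap_comp]
      rfl
  exact (Module.finrank_mul_finrank (Z.residueField (g (f x))) (Y.residueField (f x))
    (X.residueField x)).symm

lemma residueDegree_eq_one {X Y : Scheme.{u}} (f : X ⟶ Y) (x : X)
    (h : Function.Surjective (f.stalkMap x)) : f.residueDegree x = 1 := by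
  let := (f.residueFieldMap x).hom.toAlgebra
  have hs : Function.Surjective (algebraMap (Y.residueField (f x)) (X.residueField x)) := by
    intro b
    obtain ⟨b, rfl⟩ := X.residue_surjective x b
    obtain ⟨a, rfl⟩ := h b
    refine ⟨Y.residue _ a, ?_⟩
    exact congrArg (fun φ => φ.hom a) (Scheme.residue_residueFieldMap f x)
  let e : Y.residueField (f x) ≃ₗ[Y.residueField (f x)] X.residueField x :=
    LinearEquiv.ofBijective (Algebra.linearMap _ _) 
      ⟨(algebraMap (Y.residueField (f x)) (X.residueField x)).injective, hs⟩
  exact e.finrank_eq.symm.trans (Module.finrank_self _)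

variable {k : Type u} [Field k]

/-- The stalks of a scheme over a field `k` as `k`-algebras. -/
abbrev stalkAlgebra {Y : Scheme.{u}} (q : Y ⟶ Spec (.of k)) (y : Y) :
    Algebra k (Y.presheaf.stalk y) := (toStalk q y).toAlgebra

lemma finrank_residueField_stalk {Y : Scheme.{u}} (q : Y ⟶ Spec (.of k)) (y : Y) :
    letI := stalkAlgebra q y
    Module.finrank k (ResidueField (Y.presheaf.stalk y)) = q.residueDegree y := by
  let := stalkAlgebra q y
  let := (q.residueFieldMap y).hom.toAlgebra
  have : (q y).asIdeal.IsMaximal := by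
    have := (q y).isPrime
    rw [Ideal.eq_bot_of_prime (K := k) (q y).asIdeal]
    exact Ideal.bot_isMaximal
  have h1 : Function.Bijective (algebraMap k (q y).asIdeal.ResidueField) :=
    ⟨(algebraMap k _).injective, (q y).asIdeal.algebraMap_residueField_surjective⟩
  let i : k ≃+* (Spec (CommRingCat.of k)).residueField (q y) :=
    (RingEquiv.ofBijective _ h1).trans
      (Scheme.Spec.residueFieldIso (.of k) (q y)).symm.commRingCatIsoToRingEquiv
  let j : ResidueField (Y.presheaf.stalk y) ≃+* Y.residueField y := RingEquiv.refl _
  refine Algebra.finrank_eq_of_equiv_equiv i j ?_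
  have h : CommRingCat.ofHom (algebraMap k (q y).asIdeal.ResidueField) ≫
      (Scheme.Spec.residueFieldIso (.of k) (q y)).inv ≫ q.residueFieldMap y =
      CommRingCat.ofHom (toStalk q y) ≫ Y.residue y := by
    apply Spec.map_injective
    rw [Spec.map_comp, Spec.map_comp, Category.assoc,
      Scheme.Spec.map_residueFieldIso_inv_eq_fromSpecResidueField,
      Scheme.Hom.SpecMap_residueFieldMap_fromSpecResidueField, Spec.map_comp, spec_map_toStalk,
      Scheme.fromSpecResidueField, Category.assoc]
  exact congrArg CommRingCat.Hom.hom h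

lemma finite_residueField_stalk {Y : Scheme.{u}} (q : Y ⟶ Spec (.of k)) [LocallyOfFiniteType q]
    {y : Y} (hy : IsClosed ({y} : Set Y)) :
    letI := stalkAlgebra q y
    Module.Finite k (ResidueField (Y.presheaf.stalk y)) := by
  let := stalkAlgebra q y
  have := isClosed_singleton_iff_isClosedImmersion.mp hy
  have h1 : LocallyOfFiniteType (Y.fromSpecResidueField y ≫ q) := inferInstance
  have h2 : Y.fromSpecResidueField y ≫ q =
      Spec.map (CommRingCat.ofHom (toStalk q y) ≫ Y.residue y) := by
    rw [Spec.map_comp, spec_map_toStalk, Scheme.fromSpecResidueField, Category.assoc]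
  rw [h2, HasRingHomProperty.Spec_iff (P := @LocallyOfFiniteType)] at h1
  have h3 : Algebra.FiniteType k (ResidueField (Y.presheaf.stalk y)) := h1
  exact finite_of_finite_type_of_isJacobsonRing _ _

lemma residueDegree_ne_zero {Y : Scheme.{u}} (q : Y ⟶ Spec (.of k)) [LocallyOfFiniteType q]
    {y : Y} (hy : IsClosed ({y} : Set Y)) : q.residueDegree y ≠ 0 := by
  let := stalkAlgebra q y
  have := finite_residueField_stalk q hy
  rw [← finrank_residueField_stalk]
  exact Module.finrank_pos.ne'

end Stalk

/-! ### Fibres over rational points of the affine line -/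

section Fibre

open IsLocalRing Polynomial

variable {k : Type u} [Field k] {Y : Scheme.{u}} (p : Y ⟶ affineLine k) (a : k)

instance isClosedImmersion_affineLinePoint : IsClosedImmersion (affineLinePoint k a) :=
  IsClosedImmersion.spec_of_surjective _ fun x => ⟨C x, by simp⟩

/-- The local ring of the fibre over `t = a` is the quotient of the local ring by `t - a`. -/
lemma ker_stalkMap_fst (z : (pullback p (affineLinePoint k a) : Scheme.{u})) :
    RingHom.ker ((pullback.fst p (affineLinePoint k a)).stalkMap z).hom =
      Ideal.span {toStalk p (pullback.fst p (affineLinePoint k a) z) (X - C a)} := by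
  set f := pullback.fst p (affineLinePoint k a)
  set w := f z with hw
  set t := toStalk p w (X - C a) with ht
  have h0 : (f.stalkMap z).hom t = 0 := by
    have h1 := toStalk_comp f p z
    rw [show f ≫ p = pullback.snd p (affineLinePoint k a) ≫ affineLinePoint k a from
      pullback.condition, toStalk_comp_spec_map] at h1
    have h2 := congrArg (fun g => g (X - C a)) h1
    simp only [RingHom.comp_apply] at h2
    rw [ht, ← h2]
    simp
  apply le_antisymm
  · have htu : t ∈ maximalIdeal (Y.presheaf.stalk w) := by
      rw [mem_maximalIdeal, mem_nonunits_iff]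
      intro hu
      have := hu.map (f.stalkMap z).hom
      rw [h0] at this
      exact not_isUnit_zero this
    let Q := Y.presheaf.stalk w ⧸ Ideal.span {t}
    have : Nontrivial Q := Ideal.Quotient.nontrivial_iff.mpr
      (ne_top_of_le_ne_top (maximalIdeal.isMaximal _).ne_top
        ((Ideal.span_singleton_le_iff_mem _).mpr htu))
    have : IsLocalRing Q := .of_surjective' (Ideal.Quotient.mk _) Ideal.Quotient.mk_surjective
    let m : Y.presheaf.stalk w →+* Q := Ideal.Quotient.mk (Ideal.span {t})
    have hm : IsLocalHom m := .of_surjective _ Ideal.Quotient.mk_surjective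
    have hc : (Spec.map (CommRingCat.ofHom m) ≫ Y.fromSpecStalk w) ≫ p =
        Spec.map (CommRingCat.ofHom ((m.comp (toStalk p w)).comp C)) ≫ affineLinePoint k a := by
      rw [Category.assoc, ← spec_map_toStalk, ← Spec.map_comp, ← Spec.map_comp]
      congr 1
      rw [← CommRingCat.ofHom_comp, ← CommRingCat.ofHom_comp]
      congr 1
      refine Polynomial.ringHom_ext (fun x => by simp) ?_
      have h3 : m t = 0 := Ideal.Quotient.eq_zero_iff_mem.mpr (Ideal.mem_span_singleton_self t)
      simp only [ht, map_sub, sub_eq_zero] at h3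
      simpa using h3
    let h : Spec (.of Q) ⟶ pullback p (affineLinePoint k a) := pullback.lift _ _ hc
    have hh : h ≫ f = Spec.map (CommRingCat.ofHom m) ≫ Y.fromSpecStalk w := pullback.lift_fst _ _ _
    have hz : h (specClosedPoint Q) = z := by
      apply (f.isClosedEmbedding).injective
      rw [← Scheme.Hom.comp_apply, hh, Scheme.Hom.comp_apply]
      have : Spec.map (CommRingCat.ofHom m) (specClosedPoint Q) = closedPoint _ :=
        IsLocalRing.comap_closedPoint m
      rw [this, Scheme.fromSpecStalk_closedPoint]
    have h4 := Scheme.Spec_stalkClosedPointTo_fromSpecStalk (R := .of Q) h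
    generalize Scheme.stalkClosedPointTo (R := .of Q) h = φ at h4
    revert φ
    rw [show h (closedPoint (CommRingCat.of Q)) = z from hz]
    intro φ h4
    have h5 : f.stalkMap z ≫ φ = CommRingCat.ofHom m := by
      apply Spec.map_injective
      rw [← cancel_mono (Y.fromSpecStalk w), ← hh, Spec.map_comp, Category.assoc,
        Scheme.SpecMap_stalkMap_fromSpecStalk, reassoc_of% h4]
    intro x hx
    rw [RingHom.mem_ker] at hx
    have h6 := congrArg (fun g => g.hom x) h5
    rw [← Ideal.Quotient.eq_zero_iff_mem]
    refine h6.symm.trans ?_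
    rw [CommRingCat.hom_comp, RingHom.comp_apply, hx, map_zero]
  · rw [Ideal.span_singleton_le_iff_mem]
    exact h0

lemma length_stalk_fibre (z : (pullback p (affineLinePoint k a) : Scheme.{u})) :
    Module.length ((pullback p (affineLinePoint k a)).presheaf.stalk z)
      ((pullback p (affineLinePoint k a)).presheaf.stalk z) =
    Module.length (Y.presheaf.stalk (pullback.fst p (affineLinePoint k a) z))
      (Y.presheaf.stalk (pullback.fst p (affineLinePoint k a) z) ⧸
        Ideal.span {toStalk p (pullback.fst p (affineLinePoint k a) z) (X - C a)}) := by
  set f := pullback.fst p (affineLinePoint k a)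
  exact length_eq_length_quotient (f.stalkMap z).hom (f.stalkMap_surjective z)
    (ker_stalkMap_fst p a z)

/-- A point of the fibre over `t = a` lies above `w` as soon as `t - a` vanishes at `w`. -/
lemma exists_fibre_point (w : Y) (hw : toStalk p w (X - C a) ∈ maximalIdeal (Y.presheaf.stalk w)) :
    ∃ z : (pullback p (affineLinePoint k a) : Scheme.{u}),
      pullback.fst p (affineLinePoint k a) z = w := by
  let m := residue (Y.presheaf.stalk w)
  have hc : (Spec.map (CommRingCat.ofHom m) ≫ Y.fromSpecStalk w) ≫ p =
      Spec.map (CommRingCat.ofHom ((m.comp (toStalk p w)).comp C)) ≫ affineLinePoint k a := by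
    rw [Category.assoc, ← spec_map_toStalk, ← Spec.map_comp, ← Spec.map_comp]
    congr 1
    rw [← CommRingCat.ofHom_comp, ← CommRingCat.ofHom_comp]
    congr 1
    refine Polynomial.ringHom_ext (fun x => by simp) ?_
    have h3 : m (toStalk p w (X - C a)) = 0 := (residue_eq_zero_iff _).mpr hw
    rw [map_sub, map_sub, sub_eq_zero] at h3
    simpa using h3
  refine ⟨pullback.lift _ _ hc (specClosedPoint _), ?_⟩
  rw [← Scheme.Hom.comp_apply, pullback.lift_fst, Scheme.Hom.comp_apply]
  have : Spec.map (CommRingCat.ofHom m) (specClosedPoint (ResidueField (Y.presheaf.stalk w))) =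
      closedPoint _ := IsLocalRing.comap_closedPoint m
  rw [this, Scheme.fromSpecStalk_closedPoint]

lemma mem_maximalIdeal_of_fibre_point (z : (pullback p (affineLinePoint k a) : Scheme.{u})) :
    toStalk p (pullback.fst p (affineLinePoint k a) z) (X - C a) ∈
      maximalIdeal (Y.presheaf.stalk (pullback.fst p (affineLinePoint k a) z)) := by
  rw [mem_maximalIdeal, mem_nonunits_iff]
  intro hu
  have h0 := ker_stalkMap_fst p a z ▸ Ideal.mem_span_singleton_self
    (toStalk p (pullback.fst p (affineLinePoint k a) z) (X - C a))
  have := hu.map ((pullback.fst p (affineLinePoint k a)).stalkMap z).hom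
  rw [show _ = _ from h0] at this
  exact not_isUnit_zero this

lemma snd_preimage_eq_univ :
    (pullback.snd p (affineLinePoint k a)) ⁻¹' {specClosedPoint k} = Set.univ := by
  ext z
  simp only [Set.mem_preimage, Set.mem_singleton_iff, Set.mem_univ, iff_true]
  exact Subsingleton.elim (α := PrimeSpectrum k) _ _

lemma finite_fibre [IsFinite p] : Finite (pullback p (affineLinePoint k a) : Scheme.{u}) := by
  have h := (pullback.snd p (affineLinePoint k a)).finite_preimage_singleton (specClosedPoint k)
  rw [snd_preimage_eq_univ] at h
  exact Set.finite_univ_iff.mp h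

lemma discreteTopology_fibre [IsFinite p] :
    DiscreteTopology (pullback p (affineLinePoint k a) : Scheme.{u}) := by
  have h := (pullback.snd p (affineLinePoint k a)).isDiscrete_preimage_singleton (specClosedPoint k)
  rw [snd_preimage_eq_univ] at h
  exact isDiscrete_univ_iff.mp h

end Fibre

/-! ### Schemes finite over the affine line -/

section FiniteOverLine

open IsLocalRing Polynomial

/-- The local rings of a scheme which is finite over `Spec R` are localizations of a finite
`R`-algebra. -/
lemma exists_finite_isLocalization_stalk {R : Type u} [CommRing R] {Y : Scheme.{u}} [IsIntegral Y]
    (p : Y ⟶ Spec (.of R)) [IsFinite p] (y : Y) :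
    ∃ (S : Type u) (_ : CommRing S) (_ : IsDomain S) (_ : Algebra R S)
      (_ : Algebra S (Y.presheaf.stalk y)) (P : Ideal S) (_ : P.IsPrime),
      Module.Finite R S ∧ IsLocalization.AtPrime (Y.presheaf.stalk y) P ∧
        (algebraMap S (Y.presheaf.stalk y)).comp (algebraMap R S) = toStalk p y := by
  have : IsAffine Y := isAffine_of_isAffineHom p
  let ψ := Spec.preimage (Y.isoSpec.inv ≫ p)
  have hψ : Spec.map ψ = Y.isoSpec.inv ≫ p := Spec.map_preimage _
  have hfin : IsFinite (Spec.map ψ) := hψ ▸ inferInstance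
  rw [IsFinite.SpecMap_iff] at hfin
  have hloc := (isAffineOpen_top Y).isLocalization_stalk ⟨y, Set.mem_univ y⟩
  refine ⟨Γ(Y, ⊤), inferInstance, inferInstance, ψ.hom.toAlgebra,
    TopCat.Presheaf.algebra_section_stalk Y.presheaf (U := ⊤) ⟨y, trivial⟩, _, inferInstance, hfin, hloc, ?_⟩
  symm
  refine toStalk_eq ?_
  change Spec.map (ψ ≫ Y.presheaf.germ ⊤ y trivial) = _
  rw [Spec.map_comp, hψ, ← Scheme.fromSpecStalk_toSpecΓ]
  change (Y.fromSpecStalk y ≫ Y.isoSpec.hom) ≫ _ = _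
  rw [Category.assoc, Iso.hom_inv_id_assoc]

lemma dimensionLEOne_of_isIntegral (R S : Type*) [CommRing R] [CommRing S] [IsDomain S]
    [Nontrivial R] [Algebra R S] [Algebra.IsIntegral R S] [Ring.DimensionLEOne R] : Ring.DimensionLEOne S where
  maximalOfPrime {P} hP0 hP := by
    obtain ⟨x, hx, hx0⟩ := Submodule.exists_mem_ne_zero_of_ne_bot hP0
    have h1 : P.comap (algebraMap R S) ≠ ⊥ :=
      Ideal.comap_ne_bot_of_integral_mem hx0 hx (Algebra.IsIntegral.isIntegral x)
    exact Ideal.isMaximal_of_isIntegral_of_isMaximal_comap P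
      ((Ideal.IsPrime.comap _).isMaximal h1)

variable {K : Type u} [Field K]

/-- The local rings of an integral scheme, as subrings of an extension of the function field. -/
abbrev stalkFieldAlgebra (K : Type u) [Field K] (Y : Scheme.{u}) [IsIntegral Y]
    [Algebra Y.functionField K] (y : Y) : Algebra (Y.presheaf.stalk y) K :=
  ((algebraMap Y.functionField K).comp (algebraMap (Y.presheaf.stalk y) Y.functionField)).toAlgebra

lemma algebraMap_toStalk {R : Type u} [CommRing R] {Y : Scheme.{u}} [IsIntegral Y]
    [Algebra Y.functionField K] (p : Y ⟶ Spec (.of R)) {α : R →+* K}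
    (hα : genericHom K Y ≫ p = Spec.map (CommRingCat.ofHom α)) (y : Y) (x : R) :
    letI := stalkFieldAlgebra K Y y
    algebraMap (Y.presheaf.stalk y) K (toStalk p y x) = α x := by
  let := stalkFieldAlgebra K Y y
  have : IsScalarTower (Y.presheaf.stalk y) Y.functionField K := .of_algebraMap_eq fun _ => rfl
  rw [genericHom_eq Y y, Category.assoc, ← spec_map_toStalk, ← Spec.map_comp] at hα
  exact congrArg (fun f => f.hom x) (Spec.map_injective hα)

/-- The local degree formula at a point `w` of an integral scheme `Y` which is finite over the
affine line: the zeros of `t - a` at the valuation rings of a finite extension `K` of the function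
field which are centred at `w` are counted by the length of the local ring of the fibre. -/
lemma exists_finset_isCenter_sum_eq {k : Type u} [Field k] [Algebra k K] {Y : Scheme.{u}}
    [IsIntegral Y] [Algebra Y.functionField K] [FiniteDimensional Y.functionField K]
    (p : Y ⟶ affineLine k) [IsFinite p] [Algebra k[X] K] [IsScalarTower k k[X] K]
    [FaithfulSMul k[X] K] [Module.Finite k[X] (integralClosure k[X] K)]
    (hα : genericHom K Y ≫ p = Spec.map (CommRingCat.ofHom (algebraMap k[X] K))) (a : k) (w : Y)
    (ht : toStalk p w (X - C a) ∈ maximalIdeal (Y.presheaf.stalk w)) :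
    letI := stalkAlgebra (p ≫ affineLineToSpec k) w
    ∃ s : Finset (Place k K), (∀ V, V ∈ s ↔ IsCenter (genericHom K Y) V.ring w) ∧
      ∑ V ∈ s, valLength V.ring (algebraMap k[X] K (X - C a)) *
          Module.length k (ResidueField V.ring) =
        Module.finrank Y.functionField K *
          (Module.length (Y.presheaf.stalk w)
            (Y.presheaf.stalk w ⧸ Ideal.span {toStalk p w (X - C a)}) *
          Module.length k (ResidueField (Y.presheaf.stalk w))) := by
  let := stalkAlgebra (p ≫ affineLineToSpec k) w
  let := stalkFieldAlgebra K Y w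
  have hT : IsScalarTower (Y.presheaf.stalk w) Y.functionField K := .of_algebraMap_eq fun _ => rfl
  obtain ⟨S, _, _, _, _, P, _, _, _, hS⟩ := exists_finite_isLocalization_stalk p w
  have hαw := algebraMap_toStalk p hα w
  have : IsScalarTower k (Y.presheaf.stalk w) K := .of_algebraMap_eq fun x => by
    rw [RingHom.algebraMap_toAlgebra (toStalk _ w), toStalk_comp_spec_map, RingHom.comp_apply, hαw,
      IsScalarTower.algebraMap_apply k k[X] K]
    rfl
  let : Algebra k[X] (Y.presheaf.stalk w) := (toStalk p w).toAlgebra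
  have : IsScalarTower k[X] (Y.presheaf.stalk w) K := .of_algebraMap_eq fun x => (hαw x).symm
  let : Algebra S K := ((algebraMap (Y.presheaf.stalk w) K).comp (algebraMap S _)).toAlgebra
  have : IsScalarTower S (Y.presheaf.stalk w) K := .of_algebraMap_eq fun _ => rfl
  have : IsScalarTower k[X] S K := .of_algebraMap_eq fun x => by
    rw [IsScalarTower.algebraMap_apply S (Y.presheaf.stalk w) K, ← RingHom.comp_apply (algebraMap S _), hS, hαw]
  have : IsNoetherianRing S := IsNoetherianRing.of_finite k[X] S
  have : IsNoetherianRing (Y.presheaf.stalk w) := IsLocalization.isNoetherianRing P.primeCompl _ inferInstance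
  have : Ring.DimensionLEOne S := dimensionLEOne_of_isIntegral k[X] S
  have : Ring.DimensionLEOne (Y.presheaf.stalk w) :=
    Ring.DimensionLEOne.localization (M := P.primeCompl) _ (Ideal.primeCompl_le_nonZeroDivisors P)
  have := finite_integralClosure_localization k[X] S (Y.presheaf.stalk w) K P.primeCompl
  obtain ⟨s, hs, h⟩ := exists_finset_dominates_sum_eq k (Y.presheaf.stalk w) Y.functionField K
    (toStalk p w (X - C a)) ht (fun h0 => X_sub_C_ne_zero a (FaithfulSMul.algebraMap_injective k[X] K
      (by rw [← hαw, h0, map_zero, map_zero])))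
  refine ⟨s, fun V => ?_, ?_⟩
  · rw [hs, isCenter_genericHom_iff]
  · rw [← h, hαw]

lemma injective_of_surjective {R : Type u} [CommRing R] [IsDomain R] {Y : Scheme.{u}} [IsIntegral Y]
    [Algebra Y.functionField K] (p : Y ⟶ Spec (.of R)) [Surjective p] {α : R →+* K}
    (hα : genericHom K Y ≫ p = Spec.map (CommRingCat.ofHom α)) : Function.Injective α := by
  obtain ⟨y, hy⟩ := p.surjective (⟨⊥, Ideal.isPrime_bot⟩ : PrimeSpectrum R)
  have h1 : p (genericPoint Y) ⤳ p y := (genericPoint_specializes y).map p.continuous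
  have h2 : genericHom K Y (specClosedPoint K) = genericPoint Y := genericHom_specClosedPoint Y
  have h3 : (p (genericPoint Y)).asIdeal = RingHom.ker α := by
    rw [← h2, ← Scheme.Hom.comp_apply, hα]
    change Ideal.comap α (maximalIdeal K) = _
    rw [maximalIdeal_eq_bot]
    rfl
  have h4 : (p (genericPoint Y)).asIdeal ≤ (p y).asIdeal :=
    (PrimeSpectrum.le_iff_specializes _ _).mpr h1
  rw [RingHom.injective_iff_ker_eq_bot, ← h3, ← le_bot_iff]
  exact h4.trans_eq (by rw [hy])

/-- The function field of an integral scheme `Y` which is finite and surjective over the affine line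
is a finite extension of the field of rational functions. -/
lemma finiteDimensional_functionField {k : Type u} [Field k] {Y : Scheme.{u}} [IsIntegral Y]
    (p : Y ⟶ affineLine k) [IsFinite p] (F : Type u) [Field F] [Algebra k[X] F]
    [IsFractionRing k[X] F] [Algebra k[X] Y.functionField] [Algebra F Y.functionField]
    [IsScalarTower k[X] F Y.functionField]
    (hα : genericHom Y.functionField Y ≫ p =
      Spec.map (CommRingCat.ofHom (algebraMap k[X] Y.functionField))) :
    FiniteDimensional F Y.functionField := by
  obtain ⟨S, _, _, _, i, P, _, _, hloc, hS⟩ := exists_finite_isLocalization_stalk p (genericPoint Y)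
  let : Algebra S Y.functionField := i
  have hloc : IsLocalization P.primeCompl Y.functionField := hloc
  have : IsScalarTower k[X] S Y.functionField := .of_algebraMap_eq fun x => by
    have h1 := algebraMap_toStalk p hα (genericPoint Y) x
    rw [← hS] at h1
    rw [← h1]
    change (Y.presheaf.stalkSpecializes _).hom _ = _
    rw [TopCat.Presheaf.stalkSpecializes_refl]
    rfl
  have h1 : Algebra.EssFiniteType S Y.functionField := .of_isLocalization _ P.primeCompl
  have h2 : Algebra.EssFiniteType k[X] Y.functionField := .comp _ S _
  have h3 : Algebra.EssFiniteType F Y.functionField := .of_comp k[X] F _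
  have hint : ∀ s : S, IsIntegral F (algebraMap S Y.functionField s) := fun s =>
    ((Algebra.IsIntegral.isIntegral (R := k[X]) s).map
      (IsScalarTower.toAlgHom k[X] S Y.functionField)).tower_top
  have : Algebra.IsIntegral F Y.functionField := ⟨fun x => by
    obtain ⟨⟨a, b⟩, h⟩ := IsLocalization.surj P.primeCompl x
    have hb : algebraMap S Y.functionField b ≠ 0 :=
      (IsLocalization.map_units Y.functionField b).ne_zero
    rw [eq_div_of_mul_eq hb h, div_eq_mul_inv]
    exact (hint a).mul (hint b).inv⟩
  obtain ⟨T, hT⟩ := IntermediateField.fg_top F Y.functionField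
  have := IntermediateField.finiteDimensional_adjoin (K := F) (S := (T : Set Y.functionField))
    (fun x _ => Algebra.IsIntegral.isIntegral x)
  rw [hT] at this
  exact IntermediateField.topEquiv.toLinearEquiv.finiteDimensional

end FiniteOverLine

/-! ### Divisors of rational functions on normal curves -/

section Order

open IsLocalRing

variable {C : Scheme.{u}} [IsIntegral C] [IsLocallyNoetherian C]

lemma ord_one (c : C) : Scheme.ord (1 : C.functionField) c = 0 := by
  have h := Scheme.ord_mul (x := c) (one_ne_zero (α := C.functionField)) one_ne_zero
  rw [mul_one] at h
  omega

lemma ord_inv (f : C.functionField) (c : C) : Scheme.ord f⁻¹ c = -Scheme.ord f c := by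
  rcases eq_or_ne f 0 with rfl | hf
  · simp
  · have h := Scheme.ord_mul (x := c) hf (inv_ne_zero hf)
    rw [mul_inv_cancel₀ hf, ord_one] at h
    omega

/-- The order of vanishing of a rational function is positive at exactly those points of a normal
curve at which the function vanishes. -/
lemma ord_pos_iff {c : C} (hc : Order.coheight c = 1) [IsIntegrallyClosed (C.presheaf.stalk c)]
    {V : ValuationSubring C.functionField} (hV : Dominates (C.presheaf.stalk c) V)
    {x : C.functionField} (hx0 : x ≠ 0) : 0 < Scheme.ord x c ↔ x ∈ V.nonunits := by
  constructor
  · intro h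
    by_contra hx
    rw [ValuationSubring.mem_nonunits_iff_or] at hx
    push Not at hx
    have hi : x⁻¹ ∈ V := hx.2
    have := ord_eq_valLength hc hV hi (inv_ne_zero hx0)
    rw [ord_inv] at this
    omega
  · intro hx
    have hxV : x ∈ V := V.nonunits_subset hx
    have := isDiscreteValuationRing_stalk hc
    have : Ring.KrullDimLE 1 (C.presheaf.stalk c) := krullDimLE_of_coheight_le hc.le
    obtain ⟨a, ha⟩ := (bijective_of_dominates hV).2 ⟨x, hxV⟩
    obtain rfl : algebraMap _ _ a = x := congrArg Subtype.val ha
    have ha0 : a ≠ 0 := by rintro rfl; simp at hx0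
    rw [ord_eq_valLength hc hV hxV hx0, valLength_eq_ord hV]
    have h1 : Ring.ord (C.presheaf.stalk c) a ≠ ⊤ :=
      Ring.ord_ne_top (mem_nonZeroDivisors_of_ne_zero ha0)
    have h2 : Ring.ord (C.presheaf.stalk c) a ≠ 0 := by
      intro h0
      rw [Ring.ord, Module.length_eq_zero_iff, Ideal.Quotient.subsingleton_iff,
        Ideal.span_singleton_eq_top] at h0
      obtain ⟨b, hb⟩ := h0.exists_right_inv
      rw [ValuationSubring.mem_nonunits_iff_or] at hx
      rcases hx with hx | hx
      · exact hx0 hx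
      · refine hx ?_
        rw [← eq_inv_of_mul_eq_one_right (show algebraMap _ C.functionField a *
          algebraMap _ C.functionField b = 1 by rw [← map_mul, hb, map_one])]
        exact hV.1 b
    exact_mod_cast Nat.pos_of_ne_zero fun h => (ENat.toNat_eq_zero.mp h).elim h2 h1

lemma mem_of_dominates_of_eq_genericPoint {C : Scheme.{u}} [IsIntegral C] {c : C}
    (hc : c = genericPoint C) {V : ValuationSubring C.functionField}
    (hV : Dominates (C.presheaf.stalk c) V) (x : C.functionField) : x ∈ V := by
  have hf : IsField (C.presheaf.stalk c) := hc ▸ Field.toIsField C.functionField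
  obtain ⟨y, rfl⟩ := (IsFractionRing.surjective_iff_isField (K := C.functionField)).mpr hf x
  exact hV.1 y

/-- The degree over `k` of a closed point of a normal curve in terms of its valuation ring. -/
lemma length_residueField_place {k : Type u} [Field k] [Algebra k C.functionField]
    (q : C ⟶ Spec (.of k)) [LocallyOfFiniteType q]
    (hq : genericHom C.functionField C ≫ q =
      Spec.map (CommRingCat.ofHom (algebraMap k C.functionField)))
    {c : C} (hcl : IsClosed ({c} : Set C)) (hc : Order.coheight c = 1)
    [IsIntegrallyClosed (C.presheaf.stalk c)]
    (V : Place k C.functionField) (hV : Dominates (C.presheaf.stalk c) V.ring) :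
    Module.length k (ResidueField V.ring) = q.residueDegree c := by
  have := isDiscreteValuationRing_stalk hc
  let := stalkAlgebra q c
  have hcomp := algebraMap_toStalk q hq c
  let f : C.presheaf.stalk c →ₐ[k] V.ring :=
    { (algebraMap _ C.functionField).codRestrict V.ring.toSubring hV.1 with
      commutes' := fun x => Subtype.ext (hcomp x) }
  have := finite_residueField_stalk q hcl
  rw [← (residueFieldEquivOfSurjective k f
    (bijective_of_dominates hV).2).toLinearEquiv.length_eq, Module.length_of_free_of_finite,
    finrank_residueField_stalk, Module.length_eq_one, mul_one]

end Order

section Cycles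

lemma pushforward_single {Y X : Scheme.{u}} (g : Y ⟶ X) [IsFinite g] (y : ClosedPoint Y) (n : ℤ) :
    pushforward g (Finsupp.single y n) = Finsupp.single (y.map g) (g.residueDegree y.1 * n) := by
  simp [pushforward]

variable {C : Scheme.{u}} [IsIntegral C] [IsLocallyNoetherian C]

/-- The restriction to an open subscheme of the divisor of zeros of a rational function. -/
def zerosOn (U : C.Opens) (f : C.functionField) : ZeroCycle (U : Scheme.{u}) :=
  ∑ᶠ x : ClosedPoint (U : Scheme.{u}), Finsupp.single x (max (Scheme.ord f (U.ι x.1)) 0)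

lemma finite_closedPoint_ord_ne_zero [CompactSpace C] (hC : topologicalKrullDim C ≤ 1)
    (U : C.Opens) {f : C.functionField} (hf : f ≠ 0) :
    {x : ClosedPoint (U : Scheme.{u}) | Scheme.ord f (U.ι x.1) ≠ 0}.Finite :=
  (finite_ord_ne_zero hC f hf).preimage
    ((U.ι.injective.comp Subtype.val_injective).injOn)

lemma divOn_eq_zerosOn_sub [CompactSpace C] (hC : topologicalKrullDim C ≤ 1)
    (U : C.Opens) (f : C.functionFieldˣ) {x y : C.functionField} (hx : x ≠ 0) (hy : y ≠ 0)
    (h : ∀ c : ClosedPoint (U : Scheme.{u}), Scheme.ord (f : C.functionField) (U.ι c.1) =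
      max (Scheme.ord x (U.ι c.1)) 0 - max (Scheme.ord y (U.ι c.1)) 0) :
    divOn U f = zerosOn U x - zerosOn U y := by
  rw [divOn, zerosOn, zerosOn, ← finsum_sub_distrib]
  · exact finsum_congr fun c => by rw [h, Finsupp.single_sub]
  · refine (finite_closedPoint_ord_ne_zero hC U hx).subset fun c hc h0 => hc ?_
    simp only
    rw [h0]
    simp
  · refine (finite_closedPoint_ord_ne_zero hC U hy).subset fun c hc h0 => hc ?_
    simp only
    rw [h0]
    simp

end Cycles

/-! ### Comparison of divisors with boundaries -/

section Comparison

open IsLocalRing Polynomial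

variable {k : Type u} [Field k] {X C Y : Scheme.{u}} (s : X ⟶ Spec (.of k)) [IsProper s]
  (U : X.Opens) (φ : C ⟶ X) [IsFinite φ] [IsIntegral C] [IsLocallyNoetherian C] [IsIntegral Y]
  (p : Y ⟶ affineLine k) [IsFinite p] (r : Y ⟶ U)
  [Algebra Y.functionField C.functionField] [FiniteDimensional Y.functionField C.functionField]
  [Algebra k[X] C.functionField] [FaithfulSMul k[X] C.functionField]
  [Module.Finite k[X] (integralClosure k[X] C.functionField)]

/-- Let `C` be a normal curve which is finite over `X`, and let `Y` be a curve over an open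
subscheme `U` of `X` which is finite over the affine line, such that the function field of `C` is
finite over that of `Y`. Then the divisor of zeros of `t - a` on `C`, pushed forward to `U`, is a
multiple of the cycle of the fibre of `Y` over `t = a`. -/
theorem pushforward_zerosOn (hC : topologicalKrullDim C ≤ 1)
    (hn : ∀ c : C, IsIntegrallyClosed (C.presheaf.stalk c))
    (hr : r ≫ U.ι ≫ s = p ≫ affineLineToSpec k)
    (hg : genericHom C.functionField Y ≫ r ≫ U.ι = genericHom C.functionField C ≫ φ)
    (hα : genericHom C.functionField Y ≫ p =
      Spec.map (CommRingCat.ofHom (algebraMap k[X] C.functionField)))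
    (a : k) [IsFinite (pullback.fst p (affineLinePoint k a) ≫ r)] :
    pushforward (φ ∣_ U) (zerosOn (φ ⁻¹ᵁ U) (algebraMap k[X] C.functionField (Polynomial.X - Polynomial.C a))) =
      Module.finrank Y.functionField C.functionField •
        pushforward (pullback.fst p (affineLinePoint k a) ≫ r)
          (fundamentalCycle (pullback p (affineLinePoint k a))) := by
  classical
  set K := C.functionField with hK
  set x := algebraMap k[X] K (Polynomial.X - Polynomial.C a) with hx
  set d := Module.finrank Y.functionField K
  set f := pullback.fst p (affineLinePoint k a) with hf
  have hx0 : x ≠ 0 := fun h => X_sub_C_ne_zero a (FaithfulSMul.algebraMap_injective k[X] K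
    (by rw [← hx, h, map_zero]))
  let : Algebra k K := ((algebraMap k[X] K).comp Polynomial.C).toAlgebra
  have hkK : IsScalarTower k k[X] K := .of_algebraMap_eq fun _ => rfl
  have hCk : genericHom K C ≫ φ ≫ s = Spec.map (CommRingCat.ofHom (algebraMap k K)) := by
    rw [← reassoc_of% hg, hr, reassoc_of% hα, ← Spec.map_comp]
    rfl
  have : CompactSpace C := by
    have : CompactSpace X := QuasiCompact.compactSpace_of_compactSpace s
    exact QuasiCompact.compactSpace_of_compactSpace φ
  -- for each point of `C`, a valuation ring of `K` which dominates its local ring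
  have hplace : ∀ c : C, ∃ V : Place k K, Dominates (C.presheaf.stalk c) V.ring := fun c => by
    obtain ⟨V, hV⟩ := exists_dominates (O := C.presheaf.stalk c) K
    exact ⟨⟨V, fun b => by rw [← algebraMap_toStalk (φ ≫ s) hCk c]; exact hV.1 _⟩, hV⟩
  choose V hV using hplace
  have hVc : ∀ c, IsCenter (genericHom K C) (V c).ring c := fun c =>
    (isCenter_genericHom_iff C c _).mpr (hV c)
  have hcoh : ∀ y : ClosedPoint (φ ⁻¹ᵁ U : Scheme.{u}), 0 < Scheme.ord x ((φ ⁻¹ᵁ U).ι y.1) →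
      Order.coheight ((φ ⁻¹ᵁ U).ι y.1) = 1 := fun y hy => by
    by_contra h
    rw [Scheme.ord_eq_zero_of_coheight_neq_one h] at hy
    exact lt_irrefl _ hy
  have hclosed : ∀ c : C, Order.coheight c = 1 → IsClosed ({c} : Set C) := fun c hc =>
    isClosed_singleton_of_ne_genericPoint hC (by
      rintro rfl
      rw [coheight_genericPoint] at hc
      exact zero_ne_one hc)
  have hT := finite_closedPoint_ord_ne_zero hC (φ ⁻¹ᵁ U) hx0
  let T := hT.toFinset.filter fun y => 0 < Scheme.ord x ((φ ⁻¹ᵁ U).ι y.1)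
  have memT : ∀ y, y ∈ T ↔ 0 < Scheme.ord x ((φ ⁻¹ᵁ U).ι y.1) := fun y => by
    simp only [T, Finset.mem_filter, Set.Finite.mem_toFinset, Set.mem_ofPred_eq, and_iff_right_iff_imp]
    exact fun h => h.ne'
  have hL : zerosOn (φ ⁻¹ᵁ U) x =
      ∑ y ∈ T, Finsupp.single y (max (Scheme.ord x ((φ ⁻¹ᵁ U).ι y.1)) 0) := by
    refine finsum_eq_sum_of_support_subset _ fun y hy => ?_
    rw [Finset.mem_coe, memT]
    by_contra h
    exact hy (by simp only; rw [max_eq_right (not_lt.mp h), Finsupp.single_zero])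
  have := finite_fibre p a
  let := Fintype.ofFinite (ClosedPoint (pullback p (affineLinePoint k a)))
  -- the zeros of `t - a` on `C` above `U`, sorted by the centres of their valuation rings on `Y`
  let Tz := fun z : ClosedPoint (pullback p (affineLinePoint k a)) =>
    T.filter fun y => IsCenter (genericHom K Y) (V ((φ ⁻¹ᵁ U).ι y.1)).ring (f z.1)
  have hdisj : ((Finset.univ : Finset (ClosedPoint (pullback p (affineLinePoint k a)))) : Set _).PairwiseDisjoint Tz := by
    intro z _ z' _ hzz'
    refine Finset.disjoint_left.mpr fun y hy hy' => hzz' (Subtype.ext (f.isClosedEmbedding.injective ?_))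
    exact IsCenter.unique p (Finset.mem_filter.mp hy).2 (Finset.mem_filter.mp hy').2
  -- by properness of `Y` over the affine line, every zero of `t - a` has a centre on `Y`
  have hTu : T = Finset.univ.biUnion Tz := by
    ext y
    simp only [Finset.mem_biUnion, Finset.mem_univ, true_and, Tz, Finset.mem_filter]
    refine ⟨fun hy => ?_, fun ⟨z, hz⟩ => hz.1⟩
    have hy' := (ord_pos_iff (hcoh y ((memT y).mp hy)) (hV _) hx0).mp ((memT y).mp hy)
    have hVk : ∀ g : k[X], algebraMap k[X] K g ∈ (V ((φ ⁻¹ᵁ U).ι y.1)).ring := by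
      refine algebraMap_polynomial_mem _ (V _).algebraMap_mem ?_
      have h1 := add_mem ((V ((φ ⁻¹ᵁ U).ι y.1)).ring.nonunits_subset hy')
        ((V ((φ ⁻¹ᵁ U).ι y.1)).algebraMap_mem a)
      rwa [IsScalarTower.algebraMap_apply k k[X] K, hx, ← map_add, Polynomial.algebraMap_eq,
        sub_add_cancel] at h1
    have hc1 : IsCenter (genericHom K Y ≫ p) (V ((φ ⁻¹ᵁ U).ι y.1)).ring
        (⟨valCenter k[X] _ hVk, inferInstance⟩ : PrimeSpectrum k[X]) := by
      rw [hα]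
      exact isCenter_spec_iff.mpr ⟨hVk, rfl⟩
    obtain ⟨w, hw, -⟩ := IsCenter.exists_lift p hc1
    obtain ⟨z, hz⟩ := exists_fibre_point p a w (by
      let := stalkFieldAlgebra K Y w
      have : IsScalarTower (Y.presheaf.stalk w) Y.functionField K := .of_algebraMap_eq fun _ => rfl
      have hdom := (isCenter_genericHom_iff Y w _).mp hw
      rw [mem_maximalIdeal, mem_nonunits_iff]
      intro hu
      obtain ⟨b, hb⟩ := hu.exists_right_inv
      have h1 := congrArg (algebraMap _ K) hb
      rw [map_mul, algebraMap_toStalk p hα, map_one] at h1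
      rw [ValuationSubring.mem_nonunits_iff_or] at hy'
      refine hy'.elim hx0 fun h2 => h2 ?_
      rw [← eq_inv_of_mul_eq_one_right h1]
      exact hdom.1 b)
    exact ⟨⟨z, by have := discreteTopology_fibre p a; exact isClosed_discrete _⟩, hy, hz ▸ hw⟩
  rw [hL, hTu, Finset.sum_biUnion hdisj, fundamentalCycle, finsum_eq_sum_of_fintype, map_sum, map_sum,
    Finset.smul_sum]
  refine Finset.sum_congr rfl fun z _ => ?_
  rw [map_sum]
  simp only [pushforward_single]
  -- all the points concerned have the same image `b` in `U`
  set b := z.map (f ≫ r) with hb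
  have hcen : ∀ (W : Place k K) (c : C), IsCenter (genericHom K Y) W.ring (f z.1) →
      IsCenter (genericHom K C) W.ring c → φ c = U.ι (r (f z.1)) := fun W c h1 h2 => by
    have h3 := h1.comp (r ≫ U.ι)
    rw [hg] at h3
    exact (IsCenter.unique s (h2.comp φ) h3).trans (Scheme.Hom.comp_apply _ _ _)
  have hpt : ∀ y ∈ Tz z, y.map (φ ∣_ U) = b := fun y hy => by
    refine Subtype.ext (U.ι.injective ?_)
    have h1 := hcen _ _ (Finset.mem_filter.mp hy).2 (hVc _)
    rw [← Scheme.Hom.comp_apply, ← morphismRestrict_ι, Scheme.Hom.comp_apply] at h1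
    refine h1.trans ?_
    rw [← Scheme.Hom.comp_apply f r]
    rfl
  rw [Finset.sum_congr rfl fun y hy => by rw [hpt y hy],
    ← Finsupp.single_finsetSum, Finsupp.smul_single]
  congr 1
  -- compare degrees over `k`, by multiplying with the degree of `b`
  have hUs : LocallyOfFiniteType (U.ι ≫ s) := inferInstance
  have he : (U.ι ≫ s).residueDegree b.1 ≠ 0 := residueDegree_ne_zero _ b.2
  have hdegC : ∀ y ∈ Tz z, (U.ι ≫ s).residueDegree b.1 * (φ ∣_ U).residueDegree y.1 =
      (φ ≫ s).residueDegree ((φ ⁻¹ᵁ U).ι y.1) := fun y hy => by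
    have h1 : b.1 = (φ ∣_ U) y.1 := by rw [← hpt y hy]; rfl
    rw [h1, ← residueDegree_comp, ← Category.assoc, morphismRestrict_ι, Category.assoc,
      residueDegree_comp, residueDegree_eq_one (φ ⁻¹ᵁ U).ι _
        (ConcreteCategory.bijective_of_isIso _).2, mul_one]
  have hdegY : (U.ι ≫ s).residueDegree b.1 * (f ≫ r).residueDegree z.1 =
      (p ≫ affineLineToSpec k).residueDegree (f z.1) := by
    rw [show b.1 = (f ≫ r) z.1 from rfl, ← residueDegree_comp, Category.assoc, hr,
      residueDegree_comp, residueDegree_eq_one f _ (f.stalkMap_surjective _), mul_one]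
  have hwcl : IsClosed ({f z.1} : Set Y) := by
    rw [← Set.image_singleton]
    exact f.isClosedEmbedding.isClosedMap _ z.2
  have hpft : LocallyOfFiniteType (p ≫ affineLineToSpec k) := by
    have : LocallyOfFiniteType (affineLineToSpec k) := by
      rw [HasRingHomProperty.Spec_iff (P := @LocallyOfFiniteType)]
      exact (RingHom.finiteType_algebraMap (A := k) (B := k[X])).mpr inferInstance
    infer_instance
  let := stalkAlgebra (p ≫ affineLineToSpec k) (f z.1)
  have hmw : Module.length k (ResidueField (Y.presheaf.stalk (f z.1))) =
      (p ≫ affineLineToSpec k).residueDegree (f z.1) := by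
    have := finite_residueField_stalk (p ≫ affineLineToSpec k) hwcl
    rw [Module.length_of_free_of_finite, finrank_residueField_stalk, Module.length_eq_one, mul_one]
  obtain ⟨S, hS, hsum⟩ := exists_finset_isCenter_sum_eq p hα a (f z.1)
    (mem_maximalIdeal_of_fibre_point p a z.1)
  rw [← length_stalk_fibre, hmw, ← hx] at hsum
  set l := Module.length ((pullback p (affineLinePoint k a)).presheaf.stalk z.1)
    ((pullback p (affineLinePoint k a)).presheaf.stalk z.1)
  have hord : ∀ y ∈ Tz z, Scheme.ord x ((φ ⁻¹ᵁ U).ι y.1) =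
      (valLength (V ((φ ⁻¹ᵁ U).ι y.1)).ring x).toNat ∧
      0 < Scheme.ord x ((φ ⁻¹ᵁ U).ι y.1) := fun y hy => by
    have hy1 := (memT y).mp (Finset.mem_filter.mp hy).1
    have hy2 := (ord_pos_iff (hcoh y hy1) (hV _) hx0).mp hy1
    exact ⟨ord_eq_valLength (hcoh y hy1) (hV _) ((V _).ring.nonunits_subset hy2) hx0, hy1⟩
  have hsum' : ∑ y ∈ Tz z, valLength (V ((φ ⁻¹ᵁ U).ι y.1)).ring x *
      ((φ ≫ s).residueDegree ((φ ⁻¹ᵁ U).ι y.1) : ℕ∞) =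
      d * (l * (p ≫ affineLineToSpec k).residueDegree (f z.1)) := by
    refine Eq.trans ?_ hsum
    -- by properness of `C` over `X`, a valuation ring centred on `Y` has a centre on `C`
    refine Finset.sum_bij (fun y _ => V ((φ ⁻¹ᵁ U).ι y.1)) ?_ ?_ ?_ ?_
    · exact fun y hy => (hS _).mpr (Finset.mem_filter.mp hy).2
    · intro y _ y' _ h
      refine Subtype.ext ((φ ⁻¹ᵁ U).ι.injective ?_)
      have := hVc ((φ ⁻¹ᵁ U).ι y.1)
      simp only at h
      rw [h] at this
      exact IsCenter.unique (φ ≫ s) this (hVc _)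
    · intro W hW
      have hWY := (hS W).mp hW
      have h1 := hWY.comp (r ≫ U.ι)
      rw [hg] at h1
      obtain ⟨c, hc, hφc⟩ := IsCenter.exists_lift φ h1
      have hVc' := (isCenter_genericHom_iff C c _).mp hc
      have hxW : x ∈ W.ring.nonunits := by
        let := stalkFieldAlgebra K Y (f z.1)
        have : IsScalarTower (Y.presheaf.stalk (f z.1)) Y.functionField K :=
          .of_algebraMap_eq fun _ => rfl
        have h2 := ((isCenter_genericHom_iff Y (f z.1) _).mp hWY).2 _
          (mem_maximalIdeal_of_fibre_point p a z.1)
        rwa [algebraMap_toStalk p hα] at h2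
      have hcg : c ≠ genericPoint C := by
        intro hcg
        rw [ValuationSubring.mem_nonunits_iff_or] at hxW
        exact hxW.elim hx0 fun h2 => h2 (mem_of_dominates_of_eq_genericPoint hcg hVc' _)
      have hc1 := coheight_eq_one_of_ne_genericPoint hC hcg
      have hcU : c ∈ φ ⁻¹ᵁ U := by
        change φ c ∈ U
        rw [hφc, Scheme.Hom.comp_apply]
        exact (r (f z.1)).2
      let y : ClosedPoint (φ ⁻¹ᵁ U : Scheme.{u}) := ⟨⟨c, hcU⟩, by
        have := (hclosed c hc1).preimage (φ ⁻¹ᵁ U).ι.continuous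
        rwa [show (φ ⁻¹ᵁ U).ι ⁻¹' {c} = {(⟨c, hcU⟩ : φ ⁻¹ᵁ U)} from
          Set.ext fun y => (Subtype.ext_iff (a1 := y) (a2 := ⟨c, hcU⟩)).symm] at this⟩
      have := isDiscreteValuationRing_stalk hc1
      have hVW : V c = W := by
        have h2 := eq_of_dominates (hV c) hVc'
        cases W
        generalize V c = V' at h2
        cases V'
        simp only at h2
        subst h2
        rfl
      refine ⟨y, Finset.mem_filter.mpr ⟨(memT y).mpr ?_, ?_⟩, hVW⟩
      · exact (ord_pos_iff hc1 hVc' hx0).mpr hxW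
      · exact hVW.symm ▸ hWY
    · intro y hy
      have hy' := hcoh y ((memT y).mp (Finset.mem_filter.mp hy).1)
      rw [length_residueField_place (φ ≫ s) hCk (hclosed _ hy') hy' _ (hV _)]
  have hnat := congrArg ENat.toNat hsum'
  rw [ENat.toNat_sum] at hnat
  · simp only [ENat.toNat_mul, ENat.toNat_natCast] at hnat
    have he' : ((U.ι ≫ s).residueDegree b.1 : ℤ) ≠ 0 := by exact_mod_cast he
    apply mul_left_cancel₀ he'
    rw [Finset.mul_sum, nsmul_eq_mul]
    refine Eq.trans ?_ (Eq.trans (congrArg (Nat.cast : ℕ → ℤ) hnat) ?_)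
    · rw [Nat.cast_sum]
      refine Finset.sum_congr rfl fun y hy => ?_
      rw [max_eq_left (hord y hy).2.le, (hord y hy).1, ← hdegC y hy]
      push_cast
      ring
    · rw [← hdegY]
      push_cast
      ring
  · intro y hy
    refine WithTop.mul_ne_top (fun h => ?_) (ENat.natCast_ne_top _)
    have h1 := hord y hy
    rw [ENat.toNat_eq_zero.mpr (Or.inr h)] at h1
    omega

end Comparison

section Boundary

open Polynomial

/-- The divisor of `x / (x - 1)` is the difference of the zeros of `x` and of `x - 1`: the poles of `x`
and of `x - 1` cancel. -/
lemma ord_div_sub_one {C : Scheme.{u}} [IsIntegral C] [IsLocallyNoetherian C] (c : C)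
    [IsIntegrallyClosed (C.presheaf.stalk c)] {x : C.functionField} (hx0 : x ≠ 0) (hx1 : x - 1 ≠ 0) :
    Scheme.ord (x / (x - 1)) c = max (Scheme.ord x c) 0 - max (Scheme.ord (x - 1) c) 0 := by
  by_cases hc : Order.coheight c = 1
  · obtain ⟨V, hV⟩ := exists_dominates (O := C.presheaf.stalk c) C.functionField
    have h1 : Scheme.ord (x / (x - 1)) c = Scheme.ord x c - Scheme.ord (x - 1) c := by
      rw [div_eq_mul_inv, Scheme.ord_mul hx0 (inv_ne_zero hx1), ord_inv]
      ring
    by_cases hx : x ∈ V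
    · have h2 := ord_eq_valLength hc hV hx hx0
      have h3 := ord_eq_valLength hc hV (sub_mem hx (one_mem V)) hx1
      omega
    · -- at a pole of `x` the function `x / (x - 1)` is a unit
      have hi : x⁻¹ ∈ V := (V.mem_or_inv_mem x).resolve_left hx
      have hn : x⁻¹ ∈ V.nonunits := by
        rw [ValuationSubring.mem_nonunits_iff_or, inv_inv]
        exact Or.inr hx
      have h2 : x / (x - 1) ∈ V := by
        by_contra h
        have h3 : (x / (x - 1))⁻¹ ∈ V.nonunits := by
          rw [ValuationSubring.mem_nonunits_iff_or, inv_inv]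
          exact Or.inr h
        rw [ValuationSubring.mem_nonunits_iff_exists_mem_maximalIdeal] at h3 hn
        obtain ⟨h3, h3'⟩ := h3
        obtain ⟨h4, h4'⟩ := hn
        refine (Ideal.ne_top_iff_one _).mp (IsLocalRing.maximalIdeal.isMaximal V).ne_top ?_
        convert add_mem h3' h4'
        refine Subtype.ext ?_
        change (1 : C.functionField) = (x / (x - 1))⁻¹ + x⁻¹
        field_simp
        ring
      have h3 : (x / (x - 1))⁻¹ ∈ V := by
        have : (x / (x - 1))⁻¹ = 1 - x⁻¹ := by field_simp
        rw [this]
        exact sub_mem (one_mem V) hi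
      have h4 := ord_eq_zero_of_inv_mem hc hV h2 h3
      have h5 := ord_eq_valLength hc hV hi (inv_ne_zero hx0)
      rw [ord_inv] at h5
      omega
  · simp [Scheme.ord_eq_zero_of_coheight_neq_one hc]

lemma boundary_single {k : Type u} [Field k] {X : Scheme.{u}} (s : X ⟶ Spec (.of k)) [IsSeparated s]
    (W : FiniteCorrespondenceGenerator (cylinderProj s)) :
    boundary s (Finsupp.single W 1) =
      pushforward (fibreToBase W 0) (fundamentalCycle (fibreAt W 0)) -
        pushforward (fibreToBase W 1) (fundamentalCycle (fibreAt W 1)) := by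
  simp [boundary, boundaryAt]

variable {k : Type u} [Field k] {X C : Scheme.{u}} (s : X ⟶ Spec (.of k)) [IsProper s]

/-- If a normal curve `C` over `X` and a finite correspondence `W` from the affine line to `X ∖ |D|`
are related by a finite extension of function fields, then the cycle of the function `t / (t - 1)`
on `C` is a multiple of the boundary of `W`. -/
theorem tau_eq_finrank_smul_boundary (D : EffectiveCartierDivisor X) (φ : C ⟶ X) [IsFinite φ]
    [IsIntegral C] [IsLocallyNoetherian C] (hC : topologicalKrullDim C ≤ 1)
    (hn : ∀ c : C, IsIntegrallyClosed (C.presheaf.stalk c))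
    (W : FiniteCorrespondenceGenerator (cylinderProj (D.compl.ι ≫ s)))
    [IsIntegral W.ideal.subscheme] [Algebra W.ideal.subscheme.functionField C.functionField]
    [FiniteDimensional W.ideal.subscheme.functionField C.functionField]
    [Algebra k[X] C.functionField] [FaithfulSMul k[X] C.functionField]
    [Module.Finite k[X] (integralClosure k[X] C.functionField)]
    (hg : genericHom C.functionField W.ideal.subscheme ≫ W.ideal.subschemeι ≫
      pullback.fst (D.compl.ι ≫ s) (affineLineToSpec k) ≫ D.compl.ι =
        genericHom C.functionField C ≫ φ)
    (hα : genericHom C.functionField W.ideal.subscheme ≫ W.ideal.subschemeι ≫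
      cylinderProj (D.compl.ι ≫ s) =
        Spec.map (CommRingCat.ofHom (algebraMap k[X] C.functionField)))
    (f : C.functionFieldˣ) (hf : (f : C.functionField) =
      algebraMap k[X] C.functionField Polynomial.X / (algebraMap k[X] C.functionField Polynomial.X - 1)) :
    tau D φ f = Module.finrank W.ideal.subscheme.functionField C.functionField •
      boundary (D.compl.ι ≫ s) (Finsupp.single W 1) := by
  have := W.isFinite
  have : CompactSpace C := by
    have : CompactSpace X := QuasiCompact.compactSpace_of_compactSpace s
    exact QuasiCompact.compactSpace_of_compactSpace φ
  have hr : (W.ideal.subschemeι ≫ pullback.fst (D.compl.ι ≫ s) (affineLineToSpec k)) ≫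
      D.compl.ι ≫ s = (W.ideal.subschemeι ≫ cylinderProj (D.compl.ι ≫ s)) ≫
        affineLineToSpec k := by
    rw [Category.assoc, Category.assoc]
    exact congrArg _ pullback.condition
  have hM := pushforward_zerosOn s D.compl φ (W.ideal.subschemeι ≫ cylinderProj (D.compl.ι ≫ s))
    (W.ideal.subschemeι ≫ pullback.fst (D.compl.ι ≫ s) (affineLineToSpec k)) hC hn hr
    (by simpa using hg) hα
  have h0 : algebraMap k[X] C.functionField Polynomial.X ≠ 0 := fun h =>
    Polynomial.X_ne_zero (FaithfulSMul.algebraMap_injective k[X] C.functionField (by rw [h, map_zero]))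
  have h1 : algebraMap k[X] C.functionField Polynomial.X - 1 ≠ 0 := fun h =>
    Polynomial.X_sub_C_ne_zero (1 : k) (FaithfulSMul.algebraMap_injective k[X] C.functionField
      (by simpa using h))
  rw [tau, divOn_eq_zerosOn_sub hC _ f h0 h1 (fun c => by rw [hf, ord_div_sub_one _ h0 h1]),
    map_sub, boundary_single, smul_sub]
  have hM0 := hM 0
  have hM1 := hM 1
  simp only [map_zero, sub_zero, map_one, map_sub] at hM0 hM1
  rw [hM0, hM1]

end Boundary

/-! ### Scheme-theoretic images of points -/

section Image

open IsLocalRing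

lemma isReduced_image {Y Z : Scheme.{u}} (f : Y ⟶ Z) [QuasiCompact f] [IsReduced Y] :
    IsReduced f.image := by
  have (x : f.image) : _root_.IsReduced (f.image.presheaf.stalk x) := by
    obtain ⟨_, ⟨U, hU, rfl⟩, hxU, -⟩ := Z.isBasis_affineOpens.exists_subset_of_mem_open
      (Set.mem_univ (f.imageι x)) isOpen_univ
    have h1 : _root_.IsReduced Γ(f.image, f.imageι ⁻¹ᵁ U) :=
      isReduced_of_injective _ (f.toImage_app_injective ⟨U, hU⟩)
    have h2 := (hU.preimage f.imageι).isLocalization_stalk ⟨x, hxU⟩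
    let := TopCat.Presheaf.algebra_section_stalk f.image.presheaf (U := f.imageι ⁻¹ᵁ U) ⟨x, hxU⟩
    exact isReduced_localizationPreserves
      ((hU.preimage f.imageι).primeIdealOf ⟨x, hxU⟩).asIdeal.primeCompl _ h1
  exact isReduced_of_isReduced_stalk f.image

lemma isIntegral_image {Y Z : Scheme.{u}} (f : Y ⟶ Z) [QuasiCompact f] [IsIntegral Y] :
    IsIntegral f.image := by
  have := isReduced_image f
  have : IrreducibleSpace f.image := by
    rw [irreducibleSpace_def]
    have h := ((IrreducibleSpace.isIrreducible_univ Y).image _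
      f.toImage.continuous.continuousOn).closure
    rwa [Set.image_univ, f.toImage.denseRange.closure_range] at h
  exact isIntegral_of_irreducibleSpace_of_isReduced _

/-- A dominant `K`-valued point of an integral scheme embeds the function field in `K`. -/
lemma exists_genericHom_eq_of_isDominant {K : Type u} [Field K] {Y : Scheme.{u}} [IsIntegral Y]
    (g : Spec (.of K) ⟶ Y) [IsDominant g] :
    ∃ _ : Algebra Y.functionField K, genericHom K Y = g := by
  refine exists_genericHom_eq Y g ?_
  have h1 : Set.range g = {g (specClosedPoint K)} := by
    ext y
    constructor
    · rintro ⟨z, rfl⟩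
      exact congrArg g (Subsingleton.elim (α := PrimeSpectrum K) _ _)
    · rintro rfl
      exact ⟨_, rfl⟩
  have h2 := g.denseRange.closure_range
  rw [h1] at h2
  exact IsGenericPoint.eq h2 (genericPoint_spec Y)

end Image

/-! ### Finiteness over the affine line -/

section Finite

open IsLocalRing Polynomial

variable {k : Type u} [Field k] {K : Type u} [Field K] [Algebra k[X] K]

lemma surjective_of_isFinite {R : Type u} [CommRing R] [IsDomain R] {Y : Scheme.{u}}
    (p : Y ⟶ Spec (.of R)) [IsFinite p] (g : Spec (.of K) ⟶ Y) {α : R →+* K}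
    (hα : g ≫ p = Spec.map (CommRingCat.ofHom α)) (hinj : Function.Injective α) :
    Surjective p := by
  refine ⟨fun q => ?_⟩
  have h1 : p (g (specClosedPoint K)) ⤳ q := by
    rw [← Scheme.Hom.comp_apply, hα]
    refine (PrimeSpectrum.le_iff_specializes _ _).mp ?_
    change Ideal.comap α (maximalIdeal K) ≤ _
    rw [maximalIdeal_eq_bot]
    change RingHom.ker α ≤ _
    rw [(RingHom.injective_iff_ker_eq_bot α).mp hinj]
    exact bot_le
  exact h1.mem_closed p.isClosedMap.isClosed_range ⟨_, rfl⟩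

/-- An integral scheme which is proper over the affine line and whose function field embeds in a
finite extension `K` of the field of rational functions is finite over the affine line: its points
are centres of valuation rings of `K`, and these correspond to the primes of the integral closure
of `k[t]` in `K`. -/
lemma isFinite_of_isProper {Y : Scheme.{u}} [IsIntegral Y] [Algebra Y.functionField K]
    (p : Y ⟶ affineLine k) [IsProper p] (F : Type u) [Field F] [Algebra k[X] F]
    [IsFractionRing k[X] F] [Algebra F K] [IsScalarTower k[X] F K] [FiniteDimensional F K]
    [Module.Finite k[X] (integralClosure k[X] K)]
    (hα : genericHom K Y ≫ p = Spec.map (CommRingCat.ofHom (algebraMap k[X] K))) :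
    IsFinite p := by
  let B := integralClosure k[X] K
  have : FaithfulSMul k[X] K := FaithfulSMul.trans k[X] F K
  have : IsFractionRing B K := integralClosure.isFractionRing_of_finite_extension F K
  have : IsIntegrallyClosed B := integralClosure.isIntegrallyClosedOfFiniteExtension F
  have : IsNoetherianRing B := IsNoetherianRing.of_finite k[X] B
  have : IsDedekindDomain B := { }
  -- a point `y` of `Y` is determined by the centre on `B` of a valuation ring centred at `y`
  choose V hV using exists_isCenter (K := K) Y
  have hk : ∀ y, ∃ h : ∀ g : k[X], algebraMap k[X] K g ∈ V y,
      (p y).asIdeal = valCenter k[X] (V y) h := fun y => by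
    have h1 := (hV y).comp p
    rw [hα] at h1
    exact isCenter_spec_iff.mp h1
  have hB : ∀ y (b : B), algebraMap B K b ∈ V y := fun y b =>
    mem_of_isIntegral_of_forall_mem (V y) (hk y).1 b.2
  let c : Y → PrimeSpectrum B := fun y => ⟨valCenter B (V y) (hB y), inferInstance⟩
  have hc : ∀ y, PrimeSpectrum.comap (algebraMap k[X] B) (c y) = p y := fun y => by
    refine PrimeSpectrum.ext ?_
    rw [(hk y).2]
    ext g
    simp only [c, PrimeSpectrum.comap_asIdeal, Ideal.mem_comap, mem_valCenter]
    rfl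
  have hinj : Function.Injective c := by
    intro y y' h
    have h1 : valCenter B (V y) (hB y) = valCenter B (V y') (hB y') :=
      congrArg PrimeSpectrum.asIdeal h
    have h2 : V y = V y' := by
      by_cases h0 : valCenter B (V y) (hB y) = ⊥
      · have htop : ∀ W : ValuationSubring K, ∀ hW : (∀ b : B, algebraMap B K b ∈ W),
            valCenter B W hW = ⊥ → W = ⊤ := fun W hW h0 => by
          refine top_le_iff.mp fun x _ => ?_
          obtain ⟨a, b, hb, rfl⟩ := IsFractionRing.div_surjective (A := B) x
          rw [div_eq_mul_inv]
          refine mul_mem (hW a) ?_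
          refine (inv_mem_of_notMem_valCenter (hV := hW) fun hb' => ?_).2
          rw [h0, Ideal.mem_bot] at hb'
          exact nonZeroDivisors.ne_zero hb hb'
        rw [htop _ _ h0, htop (V y') (hB y') (h1 ▸ h0)]
      · refine eq_of_toLocalSubring_le ?_
        rw [toSubring_eq_localSubringAtPrime (V y) (hB y) h0,
          toSubring_eq_localSubringAtPrime (V y') (hB y') (h1 ▸ h0)]
        simp only [h1, le_refl]
    have h3 := hV y
    rw [h2] at h3
    exact IsCenter.unique p h3 (hV y')
  have hfin : IsFinite (Spec.map (CommRingCat.ofHom (algebraMap k[X] B))) := by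
    rw [IsFinite.SpecMap_iff]
    exact RingHom.finite_algebraMap.mpr inferInstance
  have : LocallyQuasiFinite p := by
    refine LocallyQuasiFinite.of_finite_preimage_singleton p fun t => ?_
    have h1 := (Spec.map (CommRingCat.ofHom (algebraMap k[X] B))).finite_preimage_singleton t
    refine (h1.preimage hinj.injOn).subset fun y hy => ?_
    exact (hc y).trans hy
  exact IsFinite.of_isProper_of_locallyQuasiFinite p

end Finite

/-! ### Relations on normal curves are boundaries -/

section FunctionField

open IsLocalRing Polynomial

variable {k : Type u} [Field k]

lemma genericHom_self_comp {R : Type u} [CommRing R] {C : Scheme.{u}} [IsIntegral C]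
    (q : C ⟶ Spec (.of R)) :
    genericHom C.functionField C ≫ q =
      Spec.map (CommRingCat.ofHom (toStalk q (genericPoint C))) := by
  rw [spec_map_toStalk, genericHom]
  have : CommRingCat.ofHom (algebraMap C.functionField C.functionField) = 𝟙 _ := rfl
  rw [this, Spec.map_id, Category.id_comp]

/-- The function field of a curve over a field is finitely generated of transcendence degree at most
one. -/
lemma functionField_essFiniteType_and_trdeg_le_one {C : Scheme.{u}} [IsIntegral C]
    (q : C ⟶ Spec (.of k)) [LocallyOfFiniteType q] (hC : topologicalKrullDim C ≤ 1) :
    letI : Algebra k C.functionField := stalkAlgebra q (genericPoint C)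
    Algebra.EssFiniteType k C.functionField ∧ Algebra.trdeg k C.functionField ≤ 1 := by
  let : Algebra k C.functionField := stalkAlgebra q (genericPoint C)
  obtain ⟨_, ⟨V, hV, rfl⟩, hxV, -⟩ := C.isBasis_affineOpens.exists_subset_of_mem_open
    (Set.mem_univ (genericPoint C)) isOpen_univ
  have hV : IsAffineOpen V := hV
  have : Nonempty V := ⟨⟨_, hxV⟩⟩
  have : IsAffine V := hV
  let ψ := Spec.preimage (hV.fromSpec ≫ q)
  have hψ : Spec.map ψ = hV.fromSpec ≫ q := Spec.map_preimage _
  have hft : LocallyOfFiniteType (Spec.map ψ) := hψ ▸ inferInstance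
  rw [HasRingHomProperty.Spec_iff (P := @LocallyOfFiniteType)] at hft
  let : Algebra k Γ(C, V) := ψ.hom.toAlgebra
  have : Algebra.FiniteType k Γ(C, V) := hft
  have := functionField_isFractionRing_of_isAffineOpen (X := C) V hV
  have : IsScalarTower k Γ(C, V) C.functionField := .of_algebraMap_eq fun x => by
    have h1 : toStalk q (genericPoint C) = ((C.presheaf.germ V _ hxV).hom).comp ψ.hom := by
      refine toStalk_eq ?_
      change Spec.map (ψ ≫ C.presheaf.germ V _ hxV) = _
      rw [Spec.map_comp, hψ, ← hV.fromSpecStalk_eq_fromSpecStalk hxV, IsAffineOpen.fromSpecStalk,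
        Category.assoc]
    exact congrArg (fun f => f x) h1
  have hdim : ringKrullDim Γ(C, V) ≤ 1 := by
    have h1 := topologicalKrullDim_subspace_le C (V : Set C)
    have h2 := IsHomeomorph.topologicalKrullDim_eq _ hV.isoSpec.hom.homeomorph.isHomeomorph
    have h3 : topologicalKrullDim (PrimeSpectrum Γ(C, V)) = ringKrullDim Γ(C, V) :=
      PrimeSpectrum.topologicalKrullDim_eq_ringKrullDim _
    exact (h3.symm.trans (h2.symm)).trans_le (h1.trans hC)
  have : Ring.KrullDimLE 1 Γ(C, V) := (Order.krullDimLE_iff 1 _).mpr hdim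
  have : Ring.DimensionLEOne Γ(C, V) :=
    ⟨fun {p} hp0 hp => Ring.krullDimLE_one_iff_of_noZeroDivisors.mp this p hp0 hp⟩
  refine ⟨?_, trdeg_le_one_of_dimensionLEOne k Γ(C, V) C.functionField⟩
  have : Algebra.EssFiniteType Γ(C, V) C.functionField :=
    .of_isLocalization _ (nonZeroDivisors Γ(C, V))
  exact .comp k Γ(C, V) _

lemma algebraMap_comp_toStalk_genericPoint {R K : Type u} [CommRing R] [Field K] {Y : Scheme.{u}}
    [IsIntegral Y] [Algebra Y.functionField K] (p : Y ⟶ Spec (.of R)) {α : R →+* K}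
    (hα : genericHom K Y ≫ p = Spec.map (CommRingCat.ofHom α)) :
    (algebraMap Y.functionField K).comp (toStalk p (genericPoint Y)) = α := by
  have h1 : Spec.map (CommRingCat.ofHom (toStalk p (genericPoint Y)) ≫
      CommRingCat.ofHom (algebraMap Y.functionField K)) = Spec.map (CommRingCat.ofHom α) := by
    rw [← hα, Spec.map_comp, spec_map_toStalk, genericHom, Category.assoc]
  exact congrArg CommRingCat.Hom.hom (Spec.map_injective h1)

lemma finiteDimensional_of_genericHom {K : Type u} [Field K] [Algebra k[X] K] {Y : Scheme.{u}}
    [IsIntegral Y] [Algebra Y.functionField K] (p : Y ⟶ affineLine k) (F : Type u) [Field F]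
    [Algebra k[X] F] [IsFractionRing k[X] F] [Algebra F K] [IsScalarTower k[X] F K]
    [FiniteDimensional F K]
    (hα : genericHom K Y ≫ p = Spec.map (CommRingCat.ofHom (algebraMap k[X] K))) :
    FiniteDimensional Y.functionField K := by
  have : FaithfulSMul k[X] K := FaithfulSMul.trans k[X] F K
  let β : k[X] →+* Y.functionField := toStalk p (genericPoint Y)
  have hβ : ∀ x, algebraMap Y.functionField K (β x) = algebraMap k[X] K x := fun x =>
    congrArg (fun f => f x) (algebraMap_comp_toStalk_genericPoint p hα)
  have hinj : Function.Injective β := fun x y h => FaithfulSMul.algebraMap_injective k[X] K (by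
    rw [← hβ, h, hβ])
  let : Algebra F Y.functionField := (IsFractionRing.lift (A := k[X]) (K := F) hinj).toAlgebra
  have : IsScalarTower F Y.functionField K := .of_algebraMap_eq' (by
    refine IsLocalization.ringHom_ext (nonZeroDivisors k[X]) (RingHom.ext fun x => ?_)
    simp only [RingHom.comp_apply, RingHom.algebraMap_toAlgebra (IsFractionRing.lift hinj)]
    rw [IsFractionRing.lift_algebraMap, hβ, ← IsScalarTower.algebraMap_apply])
  exact FiniteDimensional.right F Y.functionField K

end FunctionField

section Relations

open IsLocalRing Polynomial

/-- The rational function `f` on `C` is regular with value `1` at all points above `D`. -/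
def IsOneAlong {X C : Scheme.{u}} (D : EffectiveCartierDivisor X) [IsIntegral C] (φ : C ⟶ X)
    (f : C.functionField) : Prop :=
  ∀ c, φ c ∈ D.ideal.support → ∃ h ∈ maximalIdeal (C.presheaf.stalk c),
    algebraMap (C.presheaf.stalk c) C.functionField h = f - 1

variable {k : Type u} [Field k] {X C : Scheme.{u}}

lemma tau_eq_zero (D : EffectiveCartierDivisor X) (φ : C ⟶ X) [IsFinite φ] [IsIntegral C]
    [IsLocallyNoetherian C] (f : C.functionFieldˣ)
    (hf : ∀ c, Scheme.ord (f : C.functionField) c = 0) : tau D φ f = 0 := by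
  simp [tau, divOn, hf]

variable (s : X ⟶ Spec (.of k))

/-- A function which is algebraic over the base field has no zeros or poles. -/
lemma tau_eq_zero_of_isIntegral (D : EffectiveCartierDivisor X) (φ : C ⟶ X) [IsFinite φ]
    [IsIntegral C] [IsLocallyNoetherian C] (hn : ∀ c : C, IsIntegrallyClosed (C.presheaf.stalk c))
    (f : C.functionFieldˣ) [Algebra k C.functionField]
    (hk : genericHom C.functionField C ≫ φ ≫ s =
      Spec.map (CommRingCat.ofHom (algebraMap k C.functionField)))
    (hf : IsIntegral k (f : C.functionField)) : tau D φ f = 0 := by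
  refine tau_eq_zero D φ f fun c => ?_
  by_cases hc : Order.coheight c = 1
  · obtain ⟨V, hV⟩ := exists_dominates (O := C.presheaf.stalk c) C.functionField
    have hkV : ∀ a : k, algebraMap k C.functionField a ∈ V := fun a => by
      rw [← algebraMap_toStalk (φ ≫ s) hk c]
      exact hV.1 _
    exact ord_eq_zero_of_inv_mem hc hV (mem_of_isIntegral_of_forall_mem V hkV hf)
      (mem_of_isIntegral_of_forall_mem V hkV hf.inv)
  · exact Scheme.ord_eq_zero_of_coheight_neq_one hc _

/-- The cycle of a rational function which is `1` along `D` is the boundary of a finite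
correspondence from the affine line, namely of a multiple of the closure of the graph of
`f / (f - 1)`. -/
theorem tau_mem_range_boundary [IsProper s] (D : EffectiveCartierDivisor X) (φ : C ⟶ X)
    [IsFinite φ] [IsIntegral C] [IsLocallyNoetherian C] (hC : topologicalKrullDim C ≤ 1)
    (hn : ∀ c : C, IsIntegrallyClosed (C.presheaf.stalk c)) (f : C.functionFieldˣ)
    (hf : IsOneAlong D φ f) : tau D φ f ∈ (boundary (D.compl.ι ≫ s)).range := by
  let K := C.functionField
  let : Algebra k K := stalkAlgebra (φ ≫ s) (genericPoint C)
  have hk : genericHom K C ≫ φ ≫ s = Spec.map (CommRingCat.ofHom (algebraMap k K)) :=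
    genericHom_self_comp (φ ≫ s)
  have hf0 : (f : K) ≠ 0 := f.ne_zero
  by_cases hf1 : (f : K) = 1
  · rw [tau_eq_zero_of_isIntegral s D φ hn f hk (hf1 ▸ isIntegral_one)]
    exact zero_mem _
  have hf1' : (f : K) - 1 ≠ 0 := sub_ne_zero.mpr hf1
  let u : K := f / (f - 1)
  have hu1 : u - 1 = 1 / ((f : K) - 1) := by
    rw [eq_div_iff hf1', sub_mul, div_mul_cancel₀ _ hf1', one_mul, sub_sub_cancel]
  have hfu : (f : K) = u / (u - 1) := by
    rw [hu1, div_div_eq_mul_div, div_one, div_mul_cancel₀ _ hf1']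
  by_cases hu : IsAlgebraic k u
  · have h1 : IsIntegral k u := hu.isIntegral
    rw [tau_eq_zero_of_isIntegral s D φ hn f hk]
    · exact zero_mem _
    · rw [hfu, div_eq_mul_inv]
      exact h1.mul (h1.sub isIntegral_one).inv
  let : Algebra k[X] K := (Polynomial.aeval (R := k) u).toRingHom.toAlgebra
  have hα : ∀ g : k[X], algebraMap k[X] K g = Polynomial.aeval u g := fun g => rfl
  have : IsScalarTower k k[X] K := .of_algebraMap_eq fun x => by simp [hα]
  have hinj : Function.Injective (algebraMap k[X] K) := transcendental_iff_injective.mp hu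
  have : FaithfulSMul k[X] K := (faithfulSMul_iff_algebraMap_injective _ _).mpr hinj
  let F := FractionRing k[X]
  let : Algebra F K := FractionRing.liftAlgebra k[X] K
  have : IsScalarTower k[X] F K := FractionRing.isScalarTower_liftAlgebra k[X] K
  obtain ⟨hK1, hK2⟩ := functionField_essFiniteType_and_trdeg_le_one (φ ≫ s) hC
  have : FiniteDimensional F K := finiteDimensional_of_trdeg_le_one k F K hK2
  have : Module.Finite k[X] (integralClosure k[X] K) := finite_integralClosure_polynomial F
  -- the generic point of the graph of `u`
  let i : Spec (.of K) ⟶ pullback s (affineLineToSpec k) :=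
    pullback.lift (genericHom K C ≫ φ) (Spec.map (CommRingCat.ofHom (algebraMap k[X] K))) (by
      rw [Category.assoc, hk, ← Spec.map_comp, ← CommRingCat.ofHom_comp]
      congr 2
      exact RingHom.ext fun x => IsScalarTower.algebraMap_apply k k[X] K x)
  have hi1 : i ≫ pullback.fst _ _ = genericHom K C ≫ φ := pullback.lift_fst _ _ _
  have hi2 : i ≫ pullback.snd _ _ = Spec.map (CommRingCat.ofHom (algebraMap k[X] K)) :=
    pullback.lift_snd _ _ _
  have : QuasiCompact i := by
    have : QuasiCompact (i ≫ pullback.snd _ _) := by rw [hi2]; infer_instance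
    exact .of_comp i (pullback.snd _ _)
  let Y := i.image
  have : IsIntegral Y := isIntegral_image i
  obtain ⟨_, hgen⟩ := exists_genericHom_eq_of_isDominant i.toImage
  let p : Y ⟶ affineLine k := i.imageι ≫ pullback.snd s (affineLineToSpec k)
  have hp : genericHom K Y ≫ p = Spec.map (CommRingCat.ofHom (algebraMap k[X] K)) := by
    rw [hgen, Scheme.Hom.toImage_imageι_assoc, hi2]
  have : IsFinite p := isFinite_of_isProper p F hp
  have hφ : genericHom K Y ≫ i.imageι ≫ pullback.fst _ _ = genericHom K C ≫ φ := by
    rw [hgen, Scheme.Hom.toImage_imageι_assoc, hi1]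
  -- the closure of the graph does not meet `D × 𝔸¹`, as `f / (f - 1)` has poles above `D`
  have hYD : ∀ y : Y, (i.imageι ≫ pullback.fst _ _) y ∈ D.compl := fun y hy => by
    obtain ⟨V, hV⟩ := exists_isCenter (K := K) Y y
    have h1 := hV.comp (i.imageι ≫ pullback.fst _ _)
    rw [hφ] at h1
    obtain ⟨c, hc, hc'⟩ := IsCenter.exists_lift φ h1
    have h2 := hV.comp p
    rw [hp] at h2
    obtain ⟨h2, -⟩ := isCenter_spec_iff.mp h2
    -- `u` and `f` are regular at `V`, and `f - 1` vanishes there, so that `1 = (u - 1) (f - 1)` does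
    have huV : u ∈ V := by simpa [hα] using h2 Polynomial.X
    obtain ⟨h, hh, hhf⟩ := hf c (hc' ▸ hy)
    have h3 := ((isCenter_genericHom_iff C c V).mp hc).2 h hh
    rw [hhf, ValuationSubring.mem_nonunits_iff_exists_mem_maximalIdeal] at h3
    obtain ⟨h3, h4⟩ := h3
    refine (Ideal.ne_top_iff_one _).mp (maximalIdeal.isMaximal V).ne_top ?_
    convert sub_mem (Ideal.mul_mem_left _ (⟨u, huV⟩ : V) h4) h4
    refine Subtype.ext ?_
    change (1 : K) = u * (f - 1) - (f - 1)
    rw [div_mul_cancel₀ _ hf1', sub_sub_cancel]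
  let j : Y ⟶ D.compl := IsOpenImmersion.lift D.compl.ι (i.imageι ≫ pullback.fst _ _) (by
    rw [Scheme.Opens.range_ι]
    rintro _ ⟨y, rfl⟩
    exact hYD y)
  have hj : j ≫ D.compl.ι = i.imageι ≫ pullback.fst _ _ := IsOpenImmersion.lift_fac _ _ _
  let J : Y ⟶ pullback (D.compl.ι ≫ s) (affineLineToSpec k) := pullback.lift j p (by
    rw [reassoc_of% hj, Category.assoc, pullback.condition])
  have hJ1 : J ≫ pullback.fst _ _ = j := pullback.lift_fst _ _ _
  have hJ2 : J ≫ cylinderProj (D.compl.ι ≫ s) = p := pullback.lift_snd _ _ _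
  -- the closed subscheme `Y` of `X × 𝔸¹` is also closed in `(X ∖ |D|) × 𝔸¹`
  have : IsClosedImmersion J := by
    let t : pullback (D.compl.ι ≫ s) (affineLineToSpec k) ⟶ pullback s (affineLineToSpec k) :=
      pullback.lift (pullback.fst _ _ ≫ D.compl.ι) (pullback.snd _ _) (by
        rw [Category.assoc, pullback.condition])
    have ht : J ≫ t = i.imageι := by
      apply pullback.hom_ext
      · simp only [t, Category.assoc]
        rw [pullback.lift_fst, reassoc_of% hJ1, hj]
      · simp only [t, Category.assoc, pullback.lift_snd]
        exact hJ2
    have : IsSeparated t := by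
      have : IsSeparated (t ≫ pullback.snd _ _) := by
        rw [pullback.lift_snd]
        infer_instance
      exact .of_comp t (pullback.snd _ _)
    have : IsClosedImmersion (J ≫ t) := ht ▸ inferInstance
    exact .of_comp J t
  have hJp : J.ker.subschemeι ≫ cylinderProj (D.compl.ι ≫ s) = inv J.toImage ≫ p := by
    rw [IsIso.eq_inv_comp, Scheme.Hom.toImage_imageι_assoc, hJ2]
  let W : FiniteCorrespondenceGenerator (cylinderProj (D.compl.ι ≫ s)) :=
    { ideal := J.ker
      isIntegral := isIntegral_image J
      isFinite := by rw [hJp]; infer_instance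
      surjective := by
        have := surjective_of_isFinite p (genericHom K Y) hp hinj
        rw [hJp]
        infer_instance }
  have : IsIntegral W.ideal.subscheme := W.isIntegral
  obtain ⟨_, hgen'⟩ := exists_genericHom_eq_of_isDominant (i.toImage ≫ J.toImage)
  have hW : genericHom K W.ideal.subscheme ≫ W.ideal.subschemeι = genericHom K Y ≫ J := by
    rw [hgen]
    refine (congrArg (· ≫ J.ker.subschemeι) hgen').trans ?_
    rw [Category.assoc, Scheme.Hom.toImage_imageι]
  have hWp : genericHom K W.ideal.subscheme ≫ W.ideal.subschemeι ≫
      cylinderProj (D.compl.ι ≫ s) = Spec.map (CommRingCat.ofHom (algebraMap k[X] K)) := by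
    rw [reassoc_of% hW, hJ2, hp]
  have : FiniteDimensional W.ideal.subscheme.functionField K :=
    finiteDimensional_of_genericHom _ F hWp
  rw [tau_eq_finrank_smul_boundary s D φ hC hn W ?_ hWp f ?_]
  · exact nsmul_mem (AddMonoidHom.mem_range.mpr ⟨_, rfl⟩) _
  · rw [reassoc_of% hW, reassoc_of% hJ1, hj, hφ]
  · rw [hα, Polynomial.aeval_X]
    exact hfu

end Relations

/-! ### Normal curves with a given function field -/

section Dimension

open Polynomial

/-- A domain over a field whose fraction field has transcendence degree at most one has dimension at
most one: modulo a nonzero element of a prime ideal, an algebraic relation with that element becomes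
an algebraic equation over the base field. -/
lemma dimensionLEOne_of_trdeg_le_one (k R K : Type u) [Field k] [CommRing R] [IsDomain R]
    [Algebra k R] [Field K] [Algebra k K] [Algebra R K] [IsScalarTower k R K] [FaithfulSMul R K]
    (h : Algebra.trdeg k K ≤ 1) : Ring.DimensionLEOne R := by
  classical
  refine ⟨fun {P} hP0 hP => ?_⟩
  obtain ⟨b, hbP, hb0⟩ := Submodule.exists_mem_ne_zero_of_ne_bot hP0
  have hb : Transcendental k b := fun hb =>
    hP.ne_top (Ideal.eq_top_of_isUnit_mem _ hbP (hb.isIntegral.isUnit hb0))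
  let : Algebra k[X] R := (Polynomial.aeval b).toRingHom.toAlgebra
  have : IsScalarTower k k[X] R := .of_algebraMap_eq fun x => by
    simp [RingHom.algebraMap_toAlgebra]
  have hX : algebraMap k[X] R X = b := by simp [RingHom.algebraMap_toAlgebra]
  have hinj : Function.Injective (algebraMap k[X] R) := transcendental_iff_injective.mp hb
  have : FaithfulSMul k[X] R := (faithfulSMul_iff_algebraMap_injective _ _).mpr hinj
  let : Algebra k[X] K := ((algebraMap R K).comp (algebraMap k[X] R)).toAlgebra
  have : IsScalarTower k[X] R K := .of_algebraMap_eq fun _ => rfl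
  have : IsScalarTower k k[X] K := .of_algebraMap_eq fun x => by
    rw [IsScalarTower.algebraMap_apply k[X] R K, ← IsScalarTower.algebraMap_apply k k[X] R,
      ← IsScalarTower.algebraMap_apply]
  have : FaithfulSMul k[X] K := FaithfulSMul.trans k[X] R K
  have halg : ∀ x : R, IsAlgebraic k[X] x := by
    have : Algebra.IsAlgebraic k[X] K := isAlgebraic_of_trdeg_le k k[X] K (n := 1) (by simpa using h)
      (by rw [Polynomial.trdeg_of_isDomain]; simp)
    exact fun x => (isAlgebraic_algebraMap_iff (FaithfulSMul.algebraMap_injective R K)).mp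
      (Algebra.IsAlgebraic.isAlgebraic (R := k[X]) (algebraMap R K x))
  have : Algebra.IsIntegral k (R ⧸ P) := ⟨fun x => by
    obtain ⟨x, rfl⟩ := Ideal.Quotient.mk_surjective x
    obtain ⟨q, hq0, hq⟩ := halg x
    -- a primitive relation does not vanish identically when `b` is set to `0`
    let : NormalizedGCDMonoid k[X] := Nonempty.some inferInstance
    have h1 : aeval x q.primPart = 0 := aeval_primPart_eq_zero hq0 hq
    have h2 : q.primPart.map (evalRingHom (0 : k)) ≠ 0 := fun h => by
      have h3 : C X ∣ q.primPart := by
        rw [C_dvd_iff_dvd_coeff]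
        intro i
        have := congrArg (fun r => r.coeff i) h
        rw [X_dvd_iff, coeff_zero_eq_eval_zero]
        simpa using this
      exact not_isUnit_X (q.isPrimitive_primPart X h3)
    refine IsAlgebraic.isIntegral ⟨_, h2, ?_⟩
    have h4 : (algebraMap k (R ⧸ P)).comp (evalRingHom 0) =
        (Ideal.Quotient.mk P).comp (algebraMap k[X] R) := by
      refine Polynomial.ringHom_ext (fun c => ?_) ?_
      · simp only [RingHom.comp_apply, coe_evalRingHom, eval_C]
        rw [← Polynomial.algebraMap_eq, ← IsScalarTower.algebraMap_apply k k[X] R]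
        rfl
      · simp only [RingHom.comp_apply, coe_evalRingHom, eval_X, map_zero, hX]
        exact (Ideal.Quotient.eq_zero_iff_mem.mpr hbP).symm
    rw [aeval_def, eval₂_map, h4, ← hom_eval₂, ← aeval_def, h1, map_zero]⟩
  exact Ideal.Quotient.maximal_of_isField P
    (isField_of_isIntegral_of_isField' (R := k) (Field.toIsField k))

end Dimension

section EvalSection

open IsLocalRing

variable {K : Type u} [Field K] {X : Scheme.{u}}

lemma top_le_preimage (g : Spec (.of K) ⟶ X) {U : X.Opens} (hU : g (specClosedPoint K) ∈ U) :
    ⊤ ≤ g ⁻¹ᵁ U := fun z _ => by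
  rwa [show z = specClosedPoint K from Subsingleton.elim (α := PrimeSpectrum K) _ _]

/-- The value of a section at a `K`-valued point. -/
def evalSection (g : Spec (.of K) ⟶ X) (U : X.Opens) (hU : g (specClosedPoint K) ∈ U) :
    Γ(X, U) →+* K :=
  (g.appLE U ⊤ (top_le_preimage g hU) ≫ (Scheme.ΓSpecIso (.of K)).hom).hom

lemma spec_map_evalSection (g : Spec (.of K) ⟶ X) {U : X.Opens} (hU : IsAffineOpen U)
    (h : g (specClosedPoint K) ∈ U) :
    Spec.map (CommRingCat.ofHom (evalSection g U h)) ≫ hU.fromSpec = g := by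
  have h1 := IsAffineOpen.SpecMap_appLE_fromSpec g hU (isAffineOpen_top (Spec (.of K)))
    (top_le_preimage g h)
  change Spec.map (g.appLE U ⊤ _ ≫ _) ≫ _ = _
  rw [Spec.map_comp, Category.assoc, h1, ← Category.assoc]
  convert Category.id_comp _
  rw [IsAffineOpen.fromSpec_top, Iso.comp_inv_eq, Category.id_comp, Scheme.isoSpec_Spec_hom]

lemma evalSection_comp {C : Scheme.{u}} (j : Spec (.of K) ⟶ C) (φ : C ⟶ X) {U : X.Opens}
    (h : (j ≫ φ) (specClosedPoint K) ∈ U) :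
    evalSection (j ≫ φ) U h = (evalSection j (φ ⁻¹ᵁ U) h).comp (φ.app U).hom := by
  simp only [evalSection, Scheme.Hom.comp_appLE]
  rfl

lemma evalSection_genericHom {C : Scheme.{u}} [IsIntegral C] [Algebra C.functionField K]
    {V : C.Opens} (hV : IsAffineOpen V) [Nonempty V]
    (h : genericHom K C (specClosedPoint K) ∈ V) :
    evalSection (genericHom K C) V h =
      (algebraMap C.functionField K).comp (algebraMap Γ(C, V) C.functionField) := by
  have h1 : CommRingCat.ofHom (evalSection (genericHom K C) V h) =
      C.germToFunctionField V ≫ CommRingCat.ofHom (algebraMap C.functionField K) := by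
    refine Spec.map_injective ((cancel_mono hV.fromSpec).mp ?_)
    have h2 : Spec.map (C.germToFunctionField V) ≫ hV.fromSpec =
        C.fromSpecStalk (genericPoint C) := by
      rw [← hV.fromSpecStalk_eq_fromSpecStalk, IsAffineOpen.fromSpecStalk]
    refine (spec_map_evalSection _ hV h).trans (.trans ?_
      (congrArg (· ≫ hV.fromSpec) (Spec.map_comp _ _)).symm)
    simp only [Category.assoc, h2, genericHom]
    rfl
  exact congrArg CommRingCat.Hom.hom h1

/-- The functions on the normalization of `X` in `K` over an affine open `U` of `X` are the elements of
`K` integral over the functions on `U`. -/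
lemma exists_evalSection_toNormalization_iff (g : Spec (.of K) ⟶ X) [QuasiCompact g]
    [QuasiSeparated g] {U : X.Opens} (hU : IsAffineOpen U) (h : g (specClosedPoint K) ∈ U)
    (h' : g.toNormalization (specClosedPoint K) ∈ g.fromNormalization ⁻¹ᵁ U) (x : K) :
    (∃ b, evalSection g.toNormalization (g.fromNormalization ⁻¹ᵁ U) h' b = x) ↔
      (evalSection g U h).IsIntegralElem x := by
  let := (g.app U).hom.toAlgebra
  let ε : Γ(Spec (.of K), g ⁻¹ᵁ U) ≅ .of K :=
    (Spec (.of K)).presheaf.mapIso (eqToIso (top_le_iff.mp (top_le_preimage g h)).symm).op ≪≫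
      Scheme.ΓSpecIso (.of K)
  have hε : Function.Bijective ε.hom := ConcreteCategory.bijective_of_isIso _
  have h1 : ∀ a, evalSection g U h a = ε.hom (algebraMap Γ(X, U) Γ(Spec (.of K), g ⁻¹ᵁ U) a) :=
    fun a => by
      simp only [evalSection, Scheme.Hom.appLE, ε]
      rfl
  have h2 : ∀ b, evalSection g.toNormalization (g.fromNormalization ⁻¹ᵁ U) h' b =
      ε.hom ((g.normalizationObjIso hU).hom b).1 := fun b => by
    refine .trans ?_ (congrArg ε.hom.hom
      (congrArg (fun f => f.hom b) (g.normalizationObjIso_hom_val hU))).symm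
    have h3 := g.toNormalization.appLE_map (U := g.fromNormalization ⁻¹ᵁ U)
      (V := g ⁻¹ᵁ U) (by simp [← Scheme.Hom.comp_preimage])
      (homOfLE (top_le_preimage g h)).op
    simp only [evalSection, ← h3]
    rfl
  constructor
  · rintro ⟨b, rfl⟩
    obtain ⟨p, hp, hp'⟩ := ((g.normalizationObjIso hU).hom b).2
    refine ⟨p, hp, ?_⟩
    rw [h2, show evalSection g U h = ε.hom.hom.comp (algebraMap _ _) from RingHom.ext h1,
      ← Polynomial.hom_eval₂, hp', map_zero]
  · rintro ⟨p, hp, hp'⟩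
    obtain ⟨y, rfl⟩ := hε.2 x
    have h3 : IsIntegral Γ(X, U) y := ⟨p, hp, hε.1 (by
      rw [map_zero, ← hp', show evalSection g U h = ε.hom.hom.comp (algebraMap _ _) from
        RingHom.ext h1, ← Polynomial.hom_eval₂])⟩
    refine ⟨(g.normalizationObjIso hU).inv ⟨y, h3⟩, ?_⟩
    rw [h2]
    simp

end EvalSection

/-- If a subalgebra of a field of transcendence degree at most one has a transcendental element, then
every element of the field is a quotient of integral elements. -/
lemma exists_isIntegral_algebraMap_mul (k A K : Type u) [Field k] [CommRing A] [Algebra k A]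
    [Field K] [Algebra k K] [Algebra A K] [IsScalarTower k A K] (hK : Algebra.trdeg k K ≤ 1)
    (a : A) (ha : Transcendental k (algebraMap A K a)) (x : K) :
    ∃ y : A, algebraMap A K y ≠ 0 ∧ IsIntegral A (algebraMap A K y * x) := by
  let : Algebra (Polynomial k) A := (Polynomial.aeval a).toRingHom.toAlgebra
  have hmap : ∀ q, algebraMap (Polynomial k) A q = Polynomial.aeval a q := fun _ => rfl
  let : Algebra (Polynomial k) K := ((algebraMap A K).comp (algebraMap (Polynomial k) A)).toAlgebra
  have : IsScalarTower (Polynomial k) A K := .of_algebraMap_eq' rfl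
  have : IsScalarTower k (Polynomial k) K := .of_algebraMap_eq fun x => by
    rw [IsScalarTower.algebraMap_apply (Polynomial k) A K, hmap, Polynomial.algebraMap_eq,
      Polynomial.aeval_C, ← IsScalarTower.algebraMap_apply]
  have hinj : Function.Injective (algebraMap (Polynomial k) K) := by
    convert transcendental_iff_injective.mp ha using 1
    ext q
    rw [IsScalarTower.algebraMap_apply (Polynomial k) A K, hmap, Polynomial.aeval_algebraMap_apply]
  have : FaithfulSMul (Polynomial k) K := (faithfulSMul_iff_algebraMap_injective _ _).mpr hinj
  have halg : Algebra.IsAlgebraic (Polynomial k) K :=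
    isAlgebraic_of_trdeg_le k (Polynomial k) K (n := 1) (by simpa using hK)
      (by rw [Polynomial.trdeg_of_isDomain]; simp)
  obtain ⟨y, hy0, hy⟩ := (halg.isAlgebraic x).exists_integral_multiple
  refine ⟨algebraMap _ A y, ?_, ?_⟩
  · rw [← IsScalarTower.algebraMap_apply]
    exact fun h => hy0 (hinj (h.trans (map_zero _).symm))
  · rw [← IsScalarTower.algebraMap_apply, ← Algebra.smul_def]
    exact hy.tower_top

section Normalization

open IsLocalRing

variable {k : Type u} [Field k] {K : Type u} [Field K] [Algebra k K] {X : Scheme.{u}}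
  (s : X ⟶ Spec (.of k)) [LocallyOfFiniteType s] {g : Spec (.of K) ⟶ X}

lemma exists_finiteType_comp_evalSection
    (hg : g ≫ s = Spec.map (CommRingCat.ofHom (algebraMap k K))) {U : X.Opens}
    (hU : IsAffineOpen U) (h : g (specClosedPoint K) ∈ U) :
    ∃ ψ : k →+* Γ(X, U), ψ.FiniteType ∧ (evalSection g U h).comp ψ = algebraMap k K := by
  let ψ := Spec.preimage (hU.fromSpec ≫ s)
  have hψ : Spec.map ψ = hU.fromSpec ≫ s := Spec.map_preimage _
  have hft : LocallyOfFiniteType (Spec.map ψ) := hψ ▸ inferInstance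
  rw [HasRingHomProperty.Spec_iff (P := @LocallyOfFiniteType)] at hft
  refine ⟨ψ.hom, hft, ?_⟩
  have h1 : Spec.map (ψ ≫ CommRingCat.ofHom (evalSection g U h)) =
      Spec.map (CommRingCat.ofHom (algebraMap k K)) := by
    rw [Spec.map_comp, hψ, ← Category.assoc, spec_map_evalSection, hg]
  exact congrArg CommRingCat.Hom.hom (Spec.map_injective h1)

lemma fromSpec_ker_evalSection {U : X.Opens} (hU : IsAffineOpen U) (h : g (specClosedPoint K) ∈ U) :
    hU.fromSpec (⟨RingHom.ker (evalSection g U h), RingHom.ker_isPrime _⟩ :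
      PrimeSpectrum Γ(X, U)) = g (specClosedPoint K) := by
  conv_rhs => rw [← spec_map_evalSection g hU h]
  rw [Scheme.Hom.comp_apply]
  congr 1
  refine PrimeSpectrum.ext ?_
  change _ = Ideal.comap (evalSection g U h) (maximalIdeal K)
  rw [maximalIdeal_eq_bot]
  rfl

/-- If the image of a `K`-valued point is not closed, then some regular function near it takes a
value which is transcendental over the base field. -/
lemma exists_transcendental_evalSection
    (hg : g ≫ s = Spec.map (CommRingCat.ofHom (algebraMap k K)))
    (hcl : ¬ IsClosed ({g (specClosedPoint K)} : Set X)) {U : X.Opens}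
    (hU : IsAffineOpen U) (h : g (specClosedPoint K) ∈ U) :
    ∃ a, Transcendental k (evalSection g U h a) := by
  by_contra! halg
  obtain ⟨ψ, -, hψ⟩ := exists_finiteType_comp_evalSection s hg hU h
  let : Algebra k Γ(X, U) := ψ.toAlgebra
  let e := evalSection g U h
  have : Algebra.IsIntegral k (Γ(X, U) ⧸ RingHom.ker e) := ⟨fun x => by
    obtain ⟨x, rfl⟩ := Ideal.Quotient.mk_surjective x
    obtain ⟨p, hp, hp'⟩ := (not_not.mp (halg x) : IsAlgebraic k _).isIntegral
    refine ⟨p, hp, ?_⟩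
    refine e.kerLift_injective ?_
    rw [map_zero, ← hp', Polynomial.hom_eval₂, ← hψ]
    rfl⟩
  have hmax : (RingHom.ker e).IsMaximal := by
    have := RingHom.ker_isPrime e
    exact Ideal.Quotient.maximal_of_isField _
      (isField_of_isIntegral_of_isField' (R := k) (Field.toIsField k))
  have : JacobsonSpace X := LocallyOfFiniteType.jacobsonSpace s
  refine hcl ?_
  rw [← fromSpec_ker_evalSection hU h]
  have h1 := hU.fromSpec.isOpenEmbedding.preimage_closedPoints
  have h2 : (⟨RingHom.ker e, RingHom.ker_isPrime _⟩ : PrimeSpectrum Γ(X, U)) ∈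
      closedPoints (PrimeSpectrum Γ(X, U)) :=
    (PrimeSpectrum.isClosed_singleton_iff_isMaximal _).mpr hmax
  exact h1.ge h2

/-- A scheme affine over `X`, whose functions over affine opens `U` of `X` are the elements of `K`
integral over the functions on `U`, is normal with function field `K`. -/
lemma isIntegrallyClosed_stalk_normalization (hK : Algebra.trdeg k K ≤ 1)
    (hg : g ≫ s = Spec.map (CommRingCat.ofHom (algebraMap k K)))
    (hcl : ¬ IsClosed ({g (specClosedPoint K)} : Set X)) {C : Scheme.{u}} [IsIntegral C]
    [Algebra C.functionField K] (φ : C ⟶ X) [IsAffineHom φ] (hgφ : genericHom K C ≫ φ = g)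
    (H : ∀ (U : X.Opens) (_ : IsAffineOpen U) (h : g (specClosedPoint K) ∈ U)
      (h' : genericHom K C (specClosedPoint K) ∈ φ ⁻¹ᵁ U) (x : K),
      (∃ b, evalSection (genericHom K C) (φ ⁻¹ᵁ U) h' b = x) ↔
        (evalSection g U h).IsIntegralElem x) :
    (∀ c : C, IsIntegrallyClosed (C.presheaf.stalk c)) ∧
      Function.Surjective (algebraMap C.functionField K) := by
  have hpt : genericHom K C (specClosedPoint K) = genericPoint C := genericHom_specClosedPoint C
  have key : ∀ c : C, IsIntegrallyClosed (C.presheaf.stalk c) ∧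
      Function.Surjective (algebraMap C.functionField K) := by
    intro c
    obtain ⟨_, ⟨U, hU, rfl⟩, hxU, -⟩ := X.isBasis_affineOpens.exists_subset_of_mem_open
      (Set.mem_univ (φ c)) isOpen_univ
    have hU : IsAffineOpen U := hU
    have hcV : c ∈ φ ⁻¹ᵁ U := hxU
    have hV : IsAffineOpen (φ ⁻¹ᵁ U) := hU.preimage φ
    have : Nonempty (φ ⁻¹ᵁ U) := ⟨⟨c, hcV⟩⟩
    have h' : genericHom K C (specClosedPoint K) ∈ φ ⁻¹ᵁ U := by
      rw [hpt]
      exact (genericPoint_specializes c).mem_open (φ ⁻¹ᵁ U).2 hcV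
    have h : g (specClosedPoint K) ∈ U := by
      rw [← hgφ]
      exact h'
    obtain ⟨ψ, -, hψ⟩ := exists_finiteType_comp_evalSection s hg hU h
    obtain ⟨a, ha⟩ := exists_transcendental_evalSection s hg hcl hU h
    have hi := evalSection_genericHom (K := K) hV h'
    have hA : evalSection g U h = (evalSection (genericHom K C) (φ ⁻¹ᵁ U) h').comp (φ.app U).hom := by
      subst hgφ
      exact evalSection_comp _ φ h
    let A := Γ(X, U)
    let B := Γ(C, φ ⁻¹ᵁ U)
    let : Algebra k A := ψ.toAlgebra
    let : Algebra A K := (evalSection g U h).toAlgebra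
    let : Algebra A B := (φ.app U).hom.toAlgebra
    let : Algebra B K := (evalSection (genericHom K C) (φ ⁻¹ᵁ U) h').toAlgebra
    have : IsScalarTower k A K := .of_algebraMap_eq' hψ.symm
    have : IsScalarTower A B K := .of_algebraMap_eq' hA
    have : IsScalarTower B C.functionField K := .of_algebraMap_eq' hi
    have : IsFractionRing B C.functionField :=
      functionField_isFractionRing_of_isAffineOpen (X := C) _ hV
    have : FaithfulSMul B K := FaithfulSMul.trans B C.functionField K
    have hB : ∀ x : K, IsIntegral A x → ∃ b : B, algebraMap B K b = x := fun x hx =>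
      (H U hU h h' x).mpr hx
    have : Algebra.IsIntegral A B := ⟨fun b => by
      have h1 : IsIntegral A (algebraMap B K b) := (H U hU h h' _).mp ⟨b, rfl⟩
      exact (isIntegral_algebraMap_iff (FaithfulSMul.algebraMap_injective B K)).mp h1⟩
    constructor
    · have hBic : IsIntegrallyClosed B := (isIntegrallyClosed_iff C.functionField).mpr fun {x} hx => by
        obtain ⟨b, hb⟩ := hB _ (isIntegral_trans (R := A) _
          (hx.map (IsScalarTower.toAlgHom B C.functionField K)))
        refine ⟨b, (algebraMap C.functionField K).injective ?_⟩
        rw [← IsScalarTower.algebraMap_apply]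
        exact hb
      have h2 := hV.isLocalization_stalk ⟨c, hcV⟩
      let := TopCat.Presheaf.algebra_section_stalk C.presheaf (U := φ ⁻¹ᵁ U) ⟨c, hcV⟩
      exact isIntegrallyClosed_of_isLocalization (R := B) (S := C.presheaf.stalk c)
        (hV.primeIdealOf ⟨c, hcV⟩).asIdeal.primeCompl (Ideal.primeCompl_le_nonZeroDivisors _)
    · intro x
      obtain ⟨y, hy0, hy⟩ := exists_isIntegral_algebraMap_mul k A K hK a ha x
      obtain ⟨b, hb⟩ := hB _ hy
      refine ⟨algebraMap B C.functionField b / algebraMap B C.functionField (algebraMap A B y), ?_⟩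
      rw [map_div₀, ← IsScalarTower.algebraMap_apply B, ← IsScalarTower.algebraMap_apply B,
        ← IsScalarTower.algebraMap_apply A B K, hb, mul_div_cancel_left₀ _ hy0]
  exact ⟨fun c => (key c).1, (key (genericPoint C)).2⟩

/-- An integral scheme locally of finite type over a field whose function field has transcendence
degree one has dimension one. -/
lemma topologicalKrullDim_eq_one {C : Scheme.{u}} [IsIntegral C] [Algebra C.functionField K]
    (q : C ⟶ Spec (.of k)) [LocallyOfFiniteType q]
    (hq : genericHom K C ≫ q = Spec.map (CommRingCat.ofHom (algebraMap k K)))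
    (hK : Algebra.trdeg k K ≤ 1) (hK' : ¬ Algebra.IsAlgebraic k K)
    (hsurj : Function.Surjective (algebraMap C.functionField K)) : topologicalKrullDim C = 1 := by
  have hle : topologicalKrullDim C ≤ 1 := by
    rw [← krullDim_points_eq, Order.krullDim_eq_iSup_coheight]
    refine iSup_le fun c => ?_
    let := stalkAlgebra q c
    let := stalkFieldAlgebra K C c
    have : IsScalarTower (C.presheaf.stalk c) C.functionField K := .of_algebraMap_eq fun _ => rfl
    have : IsScalarTower k (C.presheaf.stalk c) K := .of_algebraMap_eq fun x =>
      (algebraMap_toStalk q hq c x).symm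
    have : FaithfulSMul (C.presheaf.stalk c) K :=
      FaithfulSMul.trans (C.presheaf.stalk c) C.functionField K
    have := dimensionLEOne_of_trdeg_le_one k (C.presheaf.stalk c) K hK
    rw [← ringKrullDim_stalk_eq_coheight]
    exact (Order.krullDimLE_iff 1 _).mp inferInstance
  refine le_antisymm hle ?_
  -- in dimension zero the generic point is closed, and `K` is algebraic over `k` by the Nullstellensatz
  by_contra! hlt
  have hgen : ∀ c : C, c = genericPoint C := fun c => by
    by_contra hc
    have h1 := Order.coheight_le_krullDim c
    rw [coheight_eq_one_of_ne_genericPoint hle hc, krullDim_points_eq] at h1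
    exact absurd h1 (not_le.mpr hlt)
  have hcl : IsClosed ({genericPoint C} : Set C) := by
    rw [show ({genericPoint C} : Set C) = Set.univ from Set.eq_univ_of_forall hgen]
    exact isClosed_univ
  let := stalkAlgebra q (genericPoint C)
  have := finite_residueField_stalk q hcl
  refine hK' ⟨fun x => IsIntegral.isAlgebraic ?_⟩
  obtain ⟨y, rfl⟩ := hsurj x
  obtain ⟨p, hp, hp'⟩ := Algebra.IsIntegral.isIntegral (R := k) (residue _ y)
  refine ⟨p, hp, ?_⟩
  let z : C.functionField := p.eval₂ (toStalk q (genericPoint C)) y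
  have hz : z = 0 := by
    by_contra hz
    have h1 : residue (C.presheaf.stalk (genericPoint C)) z = 0 := by
      rw [← hp', Polynomial.hom_eval₂]
      rfl
    exact (((residue_eq_zero_iff _).mp h1 : z ∈ nonunits C.functionField)) (isUnit_iff_ne_zero.mpr hz)
  rw [← algebraMap_comp_toStalk_genericPoint q hq]
  refine .trans ?_ ((congrArg (algebraMap C.functionField K) hz).trans (map_zero _))
  exact (Polynomial.hom_eval₂ p (toStalk q (genericPoint C)) (algebraMap C.functionField K) y).symm

variable [Algebra.EssFiniteType k K]

lemma isFinite_fromNormalization [QuasiCompact g] [QuasiSeparated g] (hK : Algebra.trdeg k K ≤ 1)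
    (hg : g ≫ s = Spec.map (CommRingCat.ofHom (algebraMap k K)))
    (hcl : ¬ IsClosed ({g (specClosedPoint K)} : Set X)) : IsFinite g.fromNormalization := by
  refine { finite_app := fun U hU => ?_ }
  let := (g.app U).hom.toAlgebra
  rw [g.fromNormalization_app hU]
  have hiso : (g.normalizationObjIso hU).inv.hom.Finite :=
    .of_surjective _ (g.normalizationObjIso hU).symm.commRingCatIsoToRingEquiv.surjective
  refine hiso.comp (RingHom.finite_algebraMap.mpr ?_)
  by_cases h : g (specClosedPoint K) ∈ U
  · let ε : Γ(Spec (.of K), g ⁻¹ᵁ U) ≅ .of K :=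
      (Spec (.of K)).presheaf.mapIso (eqToIso (top_le_iff.mp (top_le_preimage g h)).symm).op ≪≫
        Scheme.ΓSpecIso (.of K)
    obtain ⟨ψ, hψ1, hψ⟩ := exists_finiteType_comp_evalSection s hg hU h
    obtain ⟨a, ha⟩ := exists_transcendental_evalSection s hg hcl hU h
    let : Algebra k Γ(X, U) := ψ.toAlgebra
    let : Algebra Γ(X, U) K := (evalSection g U h).toAlgebra
    have : IsScalarTower k Γ(X, U) K := .of_algebraMap_eq' hψ.symm
    have : Algebra.FiniteType k Γ(X, U) := hψ1
    have := finite_integralClosure_of_finiteType k Γ(X, U) K hK a ha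
    let e : Γ(Spec (.of K), g ⁻¹ᵁ U) ≃ₐ[Γ(X, U)] K :=
      AlgEquiv.ofRingEquiv (f := ε.commRingCatIsoToRingEquiv) fun a => by
        change _ = evalSection g U h a
        simp only [evalSection, Scheme.Hom.appLE, ε]
        rfl
    exact Module.Finite.equiv e.symm.mapIntegralClosure.toLinearEquiv
  · have : Subsingleton Γ(Spec (.of K), g ⁻¹ᵁ U) := by
      have : g ⁻¹ᵁ U = ⊥ := by
        refine eq_bot_iff.mpr fun z hz => h ?_
        rwa [show z = specClosedPoint K from Subsingleton.elim (α := PrimeSpectrum K) _ _] at hz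
      rw [this]
      infer_instance
    infer_instance

/-- The normalization of `X` in a field `K` of transcendence degree one, with respect to a `K`-valued
point whose image is not closed, is a normal curve with function field `K`, finite over `X`. -/
theorem exists_normal_curve [IsSeparated s] (hK : Algebra.trdeg k K ≤ 1)
    (hg : g ≫ s = Spec.map (CommRingCat.ofHom (algebraMap k K)))
    (hcl : ¬ IsClosed ({g (specClosedPoint K)} : Set X)) :
    ∃ (C : Scheme.{u}) (φ : C ⟶ X) (_ : IsIntegral C) (_ : Algebra K C.functionField),
      IsFinite φ ∧ (∀ c : C, IsIntegrallyClosed (C.presheaf.stalk c)) ∧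
        topologicalKrullDim C = 1 ∧ Function.Bijective (algebraMap K C.functionField) ∧
          genericHom C.functionField C ≫ φ =
            Spec.map (CommRingCat.ofHom (algebraMap K C.functionField)) ≫ g := by
  have hQ : QuasiCompact g := by
    have : QuasiCompact (g ≫ s) := by rw [hg]; infer_instance
    exact .of_comp g s
  have hQ' : QuasiSeparated g := by
    have : QuasiSeparated (g ≫ s) := by rw [hg]; infer_instance
    exact .of_comp g s
  have := isFinite_fromNormalization s hK hg hcl
  obtain ⟨i, hi⟩ := exists_genericHom_eq_of_isDominant g.toNormalization
  have hgφ : genericHom K g.normalization ≫ g.fromNormalization = g := by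
    rw [hi, g.toNormalization_fromNormalization]
  obtain ⟨h1, h2⟩ := isIntegrallyClosed_stalk_normalization s hK hg hcl g.fromNormalization hgφ
    (fun U hU h => by
      rw [hi]
      exact exists_evalSection_toNormalization_iff g hU h)
  have hq : genericHom K g.normalization ≫ g.fromNormalization ≫ s =
      Spec.map (CommRingCat.ofHom (algebraMap k K)) := by
    rw [reassoc_of% hgφ, hg]
  have hK' : ¬ Algebra.IsAlgebraic k K := fun hK' => by
    obtain ⟨_, ⟨U, hU, rfl⟩, hxU, -⟩ := X.isBasis_affineOpens.exists_subset_of_mem_open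
      (Set.mem_univ (g (specClosedPoint K))) isOpen_univ
    obtain ⟨a, ha⟩ := exists_transcendental_evalSection s hg hcl hU hxU
    exact ha (hK'.isAlgebraic _)
  let e : g.normalization.functionField ≃+* K :=
    RingEquiv.ofBijective (algebraMap g.normalization.functionField K)
      ⟨(algebraMap g.normalization.functionField K).injective, h2⟩
  refine ⟨g.normalization, g.fromNormalization, inferInstance, e.symm.toRingHom.toAlgebra, this, h1,
    topologicalKrullDim_eq_one _ hq hK hK' h2, e.symm.bijective, ?_⟩
  refine .trans ?_ (congrArg (Spec.map _ ≫ ·) hgφ)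
  rw [genericHom, genericHom, Category.assoc, Category.assoc, ← Spec.map_comp_assoc,
    ← CommRingCat.ofHom_comp]
  congr 3
  exact RingHom.ext fun x => (e.symm_apply_apply x).symm

end Normalization

/-! ### Boundaries are relations on normal curves -/

section Boundaries

open IsLocalRing Polynomial

variable {k : Type u} [Field k] {X : Scheme.{u}}

lemma genericHom_eq_comp {K L : Type u} [Field K] [Field L] [Algebra K L] (Y : Scheme.{u})
    [IsIntegral Y] [Algebra Y.functionField K] [Algebra Y.functionField L]
    [IsScalarTower Y.functionField K L] :
    genericHom L Y = Spec.map (CommRingCat.ofHom (algebraMap K L)) ≫ genericHom K Y := by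
  rw [genericHom, genericHom, ← Spec.map_comp_assoc, IsScalarTower.algebraMap_eq Y.functionField K L]
  rfl

section

variable {C Y : Scheme.{u}} [IsIntegral C] [IsLocallyNoetherian C] [IsIntegral Y]
  [Algebra Y.functionField C.functionField] [Algebra k[X] C.functionField]

/-- If the graph of a rational function `u` on a normal curve over `X` is finite over the affine line
and does not meet `D`, then `u` has poles above `D`, and so `u / (u - 1)` has value `1` there. -/
lemma isOneAlong_div_sub_one (s : X ⟶ Spec (.of k)) [IsSeparated s] (D : EffectiveCartierDivisor X)
    (φ : C ⟶ X) (hC : topologicalKrullDim C ≤ 1)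
    (hn : ∀ c : C, IsIntegrallyClosed (C.presheaf.stalk c)) (p : Y ⟶ affineLine k) [IsProper p]
    (q : Y ⟶ D.compl) (hqs : q ≫ D.compl.ι ≫ s = p ≫ affineLineToSpec k)
    (hq : genericHom C.functionField Y ≫ q ≫ D.compl.ι = genericHom C.functionField C ≫ φ)
    (hp : genericHom C.functionField Y ≫ p =
      Spec.map (CommRingCat.ofHom (algebraMap k[X] C.functionField)))
    (f : C.functionField)
    (hf : f - 1 = (algebraMap k[X] C.functionField Polynomial.X - 1)⁻¹) : IsOneAlong D φ f := by
  intro c hc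
  have hφgen : φ (genericPoint C) ∈ D.compl := by
    rw [← genericHom_specClosedPoint (K := C.functionField), ← Scheme.Hom.comp_apply, ← hq,
      ← Category.assoc, Scheme.Hom.comp_apply]
    exact ((genericHom C.functionField Y ≫ q) _).2
  have hcg : c ≠ genericPoint C := fun h => hφgen (h ▸ hc)
  have hc1 := coheight_eq_one_of_ne_genericPoint hC hcg
  have := isDiscreteValuationRing_stalk hc1
  obtain ⟨V, hV⟩ := exists_dominates (O := C.presheaf.stalk c) C.functionField
  have hVc : IsCenter (genericHom C.functionField C) V c := (isCenter_genericHom_iff C c V).mpr hV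
  have hu : algebraMap k[X] C.functionField Polynomial.X ∉ V := fun hu => by
    let : Algebra k C.functionField := ((algebraMap k[X] C.functionField).comp Polynomial.C).toAlgebra
    have : IsScalarTower k k[X] C.functionField := .of_algebraMap_eq fun _ => rfl
    have hCk : genericHom C.functionField C ≫ φ ≫ s =
        Spec.map (CommRingCat.ofHom (algebraMap k C.functionField)) := by
      rw [← reassoc_of% hq, hqs, reassoc_of% hp, ← Spec.map_comp]
      rfl
    have hVk := algebraMap_polynomial_mem V (fun a => by
      rw [← algebraMap_toStalk (φ ≫ s) hCk c]
      exact hV.1 _) hu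
    have h1 : IsCenter (genericHom C.functionField Y ≫ p) V
        (⟨valCenter k[X] V hVk, inferInstance⟩ : PrimeSpectrum k[X]) := by
      rw [hp]
      exact isCenter_spec_iff.mpr ⟨hVk, rfl⟩
    obtain ⟨w, hw, -⟩ := IsCenter.exists_lift p h1
    have h2 := hw.comp (q ≫ D.compl.ι)
    rw [hq] at h2
    have h3 : (q ≫ D.compl.ι) w ∈ D.compl := by
      rw [Scheme.Hom.comp_apply]
      exact (q w).2
    exact (IsCenter.unique s h2 (hVc.comp φ) ▸ h3) hc
  have hu' : f - 1 ∈ V.nonunits := by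
    rw [hf, ValuationSubring.mem_nonunits_iff_or, inv_inv]
    exact .inr fun h => hu (by simpa using add_mem h (one_mem V))
  obtain ⟨h, hh⟩ := (bijective_of_dominates hV).2 ⟨f - 1, V.nonunits_subset hu'⟩
  have hh : algebraMap (C.presheaf.stalk c) C.functionField h = f - 1 := congrArg Subtype.val hh
  refine ⟨h, (mem_maximalIdeal _).mpr fun hunit => ?_, hh⟩
  obtain ⟨b, hb⟩ := hunit.exists_right_inv
  have h1 := congrArg (algebraMap (C.presheaf.stalk c) C.functionField) hb
  rw [map_mul, hh, map_one] at h1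
  rw [ValuationSubring.mem_nonunits_iff_or, ← eq_inv_of_mul_eq_one_right h1] at hu'
  exact hu'.elim (left_ne_zero_of_mul_eq_one h1) fun h2 => h2 (hV.1 b)

end

/-- The normalization of `X` in the function field of a curve `Y` over `X` which is finite over the
affine line. -/
lemma exists_normal_curve_of_isFinite (s : X ⟶ Spec (.of k)) [LocallyOfFiniteType s] [IsSeparated s]
    {Y : Scheme.{u}} [IsIntegral Y] (p : Y ⟶ affineLine k) [IsFinite p] [Surjective p] (r : Y ⟶ X)
    (hrs : r ≫ s = p ≫ affineLineToSpec k) (hcl : ¬ IsClosed ({r (genericPoint Y)} : Set X)) :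
    ∃ (C : Scheme.{u}) (φ : C ⟶ X) (_ : IsIntegral C) (_ : Algebra Y.functionField C.functionField)
      (_ : Algebra k[X] C.functionField),
      IsFinite φ ∧ (∀ c : C, IsIntegrallyClosed (C.presheaf.stalk c)) ∧
        topologicalKrullDim C = 1 ∧ FiniteDimensional Y.functionField C.functionField ∧
        Module.finrank Y.functionField C.functionField = 1 ∧ FaithfulSMul k[X] C.functionField ∧
        Module.Finite k[X] (integralClosure k[X] C.functionField) ∧
        genericHom C.functionField Y ≫ r = genericHom C.functionField C ≫ φ ∧
        genericHom C.functionField Y ≫ p =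
          Spec.map (CommRingCat.ofHom (algebraMap k[X] C.functionField)) := by
  let : Algebra k[X] Y.functionField := (toStalk p (genericPoint Y)).toAlgebra
  let : Algebra k Y.functionField := ((algebraMap k[X] Y.functionField).comp Polynomial.C).toAlgebra
  have : IsScalarTower k k[X] Y.functionField := .of_algebraMap_eq fun _ => rfl
  have hp : genericHom Y.functionField Y ≫ p =
      Spec.map (CommRingCat.ofHom (algebraMap k[X] Y.functionField)) := genericHom_self_comp p
  have hinj : Function.Injective (algebraMap k[X] Y.functionField) := injective_of_surjective p hp
  have : FaithfulSMul k[X] Y.functionField := (faithfulSMul_iff_algebraMap_injective _ _).mpr hinj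
  let F := FractionRing k[X]
  let : Algebra F Y.functionField := FractionRing.liftAlgebra k[X] Y.functionField
  have : IsScalarTower k[X] F Y.functionField :=
    FractionRing.isScalarTower_liftAlgebra k[X] Y.functionField
  have : FiniteDimensional F Y.functionField := finiteDimensional_functionField p F hp
  obtain ⟨_, hK⟩ := essFiniteType_and_trdeg_le_one k F Y.functionField
  have hg : (genericHom Y.functionField Y ≫ r) ≫ s =
      Spec.map (CommRingCat.ofHom (algebraMap k Y.functionField)) := by
    rw [Category.assoc, hrs, reassoc_of% hp, ← Spec.map_comp]
    rfl
  have hgpt : (genericHom Y.functionField Y ≫ r) (specClosedPoint Y.functionField) =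
      r (genericPoint Y) := by
    rw [Scheme.Hom.comp_apply, genericHom_specClosedPoint]
  obtain ⟨C, φ, _, _, _, hn, hC, hbij, hφ⟩ := exists_normal_curve s hK hg (by rwa [hgpt])
  let : Algebra k[X] C.functionField :=
    ((algebraMap Y.functionField C.functionField).comp (algebraMap k[X] Y.functionField)).toAlgebra
  have : IsScalarTower k[X] Y.functionField C.functionField := .of_algebraMap_eq fun _ => rfl
  let E : Y.functionField ≃ₐ[Y.functionField] C.functionField :=
    AlgEquiv.ofBijective (Algebra.ofId Y.functionField C.functionField) hbij
  have hY : genericHom C.functionField Y =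
      Spec.map (CommRingCat.ofHom (algebraMap Y.functionField C.functionField)) ≫
        genericHom Y.functionField Y := genericHom_eq_comp Y
  have : Module.Finite k[X] (integralClosure k[X] Y.functionField) := finite_integralClosure_polynomial F
  refine ⟨C, φ, inferInstance, inferInstance, inferInstance, inferInstance, hn, hC,
    E.toLinearEquiv.finiteDimensional, ?_, FaithfulSMul.trans k[X] Y.functionField C.functionField,
    Module.Finite.equiv (E.restrictScalars k[X]).mapIntegralClosure.toLinearEquiv, ?_, ?_⟩
  · rw [← E.toLinearEquiv.finrank_eq, Module.finrank_self]
  · rw [hφ, hY, Category.assoc]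
  · rw [hY, Category.assoc, hp, ← Spec.map_comp]
    rfl

/-- The boundary of a finite correspondence which does not map to a closed point is the cycle of a
rational function on the normalization of `X` in its function field. -/
lemma exists_tau_eq_boundary_of_not_isClosed (s : X ⟶ Spec (.of k)) [IsProper s]
    (D : EffectiveCartierDivisor X)
    (W : FiniteCorrespondenceGenerator (cylinderProj (D.compl.ι ≫ s)))
    (hW : IsIntegral W.ideal.subscheme)
    (hcl : ¬ IsClosed ({((W.ideal.subschemeι ≫ pullback.fst (D.compl.ι ≫ s) (affineLineToSpec k)) ≫
      D.compl.ι) (genericPoint W.ideal.subscheme)} : Set X)) :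
    ∃ (C : Scheme.{u}) (φ : C ⟶ X) (h : IsAdmissibleCurve D φ),
      haveI := h.isIntegral
      haveI := h.isLocallyNoetherian
      haveI := h.isFinite
      ∃ f : C.functionFieldˣ, IsOneAlong D φ f ∧
        boundary (D.compl.ι ≫ s) (Finsupp.single W 1) = tau D φ f := by
  have hpfin : IsFinite (W.ideal.subschemeι ≫ cylinderProj (D.compl.ι ≫ s)) := W.isFinite
  have hpsurj : Surjective (W.ideal.subschemeι ≫ cylinderProj (D.compl.ι ≫ s)) := W.surjective
  have hqs : (W.ideal.subschemeι ≫ pullback.fst (D.compl.ι ≫ s) (affineLineToSpec k)) ≫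
      D.compl.ι ≫ s = (W.ideal.subschemeι ≫ cylinderProj (D.compl.ι ≫ s)) ≫ affineLineToSpec k := by
    rw [Category.assoc, Category.assoc]
    exact congrArg _ pullback.condition
  obtain ⟨C, φ, _, _, _, _, hn, hC, _, hrank, _, _, hq, hp⟩ := exists_normal_curve_of_isFinite s
    (W.ideal.subschemeι ≫ cylinderProj (D.compl.ι ≫ s)) _ ((Category.assoc _ _ _).trans hqs) hcl
  have : IsLocallyNoetherian C := LocallyOfFiniteType.isLocallyNoetherian (φ ≫ s)
  have hφgen : φ (genericPoint C) ∈ D.compl := by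
    rw [← genericHom_specClosedPoint (K := C.functionField), ← Scheme.Hom.comp_apply, ← hq,
      Category.assoc, ← Category.assoc, ← Category.assoc, Scheme.Hom.comp_apply]
    exact Subtype.prop _
  let u := algebraMap k[X] C.functionField Polynomial.X
  have hu0 : u ≠ 0 := fun h => Polynomial.X_ne_zero
    (FaithfulSMul.algebraMap_injective k[X] C.functionField (h.trans (map_zero _).symm))
  have hu1 : u - 1 ≠ 0 := fun h => Polynomial.X_sub_C_ne_zero (1 : k)
    (FaithfulSMul.algebraMap_injective k[X] C.functionField (by
      rw [map_sub, map_one, map_one, map_zero]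
      exact h))
  have hf1 : u / (u - 1) - 1 = (u - 1)⁻¹ := by
    rw [div_sub_one hu1, sub_sub_cancel, one_div]
  refine ⟨C, φ, ⟨inferInstance, inferInstance, hC, hn, inferInstance, fun h =>
    hφgen (h ⟨_, rfl⟩)⟩, Units.mk0 (u / (u - 1)) (div_ne_zero hu0 hu1), ?_, ?_⟩
  · exact isOneAlong_div_sub_one s D φ hC.le hn _ _ hqs ((Category.assoc _ _ _).symm.trans hq) hp _ hf1
  · rw [tau_eq_finrank_smul_boundary s D φ hC.le hn W (by simpa using hq) hp _ rfl, hrank, one_smul]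

end Boundaries

/-! ### Constant correspondences -/

section Constant

open IsLocalRing Polynomial TensorProduct

variable {k : Type u} [Field k]

/-- The degree of the fundamental cycle of a finite scheme over a field is the dimension of its ring
of functions. -/
lemma sum_length_mul_residueDegree {Z : Scheme.{u}} [DiscreteTopology Z] (q : Z ⟶ Spec (.of k))
    {E : Type u} [CommRing E] [Algebra k E] [Module.Finite k E] (e : Z ≅ Spec (.of E))
    (he : e.hom ≫ Spec.map (CommRingCat.ofHom (algebraMap k E)) = q) [Fintype (ClosedPoint Z)] :
    ∑ z : ClosedPoint Z, Module.length (Z.presheaf.stalk z.1) (Z.presheaf.stalk z.1) *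
      (q.residueDegree z.1 : ℕ∞) = Module.finrank k E := by
  have : IsAffine Z := .of_isIso e.hom
  have : IsFinite q := by
    rw [← he]
    have : IsFinite (Spec.map (CommRingCat.ofHom (algebraMap k E))) :=
      (IsFinite.SpecMap_iff _).mpr (RingHom.finite_algebraMap.mpr inferInstance)
    infer_instance
  let ρ := Spec.preimage (Z.isoSpec.inv ≫ e.hom)
  have hρ : Spec.map ρ = Z.isoSpec.inv ≫ e.hom := Spec.map_preimage _
  have hρiso : IsIso ρ := by
    have : IsIso (Scheme.Spec.map ρ.op) := by
      change IsIso (Spec.map ρ)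
      rw [hρ]
      infer_instance
    have := isIso_of_reflects_iso ρ.op Scheme.Spec
    exact isIso_of_op ρ
  let : Algebra k Γ(Z, ⊤) := (ρ.hom.comp (algebraMap k E)).toAlgebra
  let ε : E ≃ₐ[k] Γ(Z, ⊤) :=
    AlgEquiv.ofRingEquiv (f := RingEquiv.ofBijective ρ.hom (ConcreteCategory.bijective_of_isIso ρ))
      fun _ => rfl
  have : Module.Finite k Γ(Z, ⊤) := Module.Finite.equiv ε.toLinearEquiv
  have : IsArtinianRing Γ(Z, ⊤) := IsArtinianRing.of_finite k _
  have hcl : ∀ z : Z, IsClosed ({z} : Set Z) := fun z => isClosed_discrete _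
  let ι : ClosedPoint Z ≃ PrimeSpectrum Γ(Z, ⊤) :=
    (Equiv.subtypeUnivEquiv hcl).trans Z.isoSpec.hom.homeomorph.toEquiv
  let := Fintype.ofEquiv _ ι
  have h1 := length_eq_sum_primeSpectrum k Γ(Z, ⊤)
  rw [← ε.toLinearEquiv.length_eq, Module.length_of_free_of_finite, Module.length_eq_one, mul_one] at h1
  rw [h1]
  refine Fintype.sum_equiv ι _ _ fun z => ?_
  have hloc := (isAffineOpen_top Z).isLocalization_stalk ⟨z.1, Set.mem_univ z.1⟩
  let := TopCat.Presheaf.algebra_section_stalk Z.presheaf (U := ⊤) ⟨z.1, trivial⟩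
  have hprime : ((isAffineOpen_top Z).primeIdealOf ⟨z.1, Set.mem_univ z.1⟩) = ι z := by
    refine (isAffineOpen_top Z).fromSpec.isOpenEmbedding.injective ?_
    rw [IsAffineOpen.fromSpec_primeIdealOf, IsAffineOpen.fromSpec_top]
    exact (Scheme.Hom.comp_apply Z.isoSpec.hom Z.isoSpec.inv z.1 ▸ by simp)
  rw [hprime] at hloc
  let := stalkAlgebra q z.1
  have : IsScalarTower k Γ(Z, ⊤) (Z.presheaf.stalk z.1) := by
    refine .of_algebraMap_eq' (toStalk_eq ?_)
    change Spec.map (CommRingCat.ofHom (algebraMap k E) ≫ ρ ≫ Z.presheaf.germ ⊤ z.1 trivial) = _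
    rw [Spec.map_comp, Spec.map_comp, hρ, ← Scheme.fromSpecStalk_toSpecΓ, ← he]
    change ((Z.fromSpecStalk z.1 ≫ Z.isoSpec.hom) ≫ _) ≫ _ = _
    simp only [Category.assoc, Iso.hom_inv_id_assoc]
  let η : Localization.AtPrime (ι z).asIdeal ≃ₐ[Γ(Z, ⊤)] Z.presheaf.stalk z.1 :=
    IsLocalization.algEquiv (ι z).asIdeal.primeCompl _ _
  have := finite_residueField_stalk q (hcl z.1)
  have h2 : Module.length k (ResidueField (Z.presheaf.stalk z.1)) = q.residueDegree z.1 := by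
    rw [Module.length_of_free_of_finite, finrank_residueField_stalk, Module.length_eq_one, mul_one]
  rw [← h2, (ResidueField.mapAlgEquiv (η.restrictScalars k)).toLinearEquiv.length_eq]
  congr 1
  rw [length_eq_length_quotient (η.toRingHom) η.surjective
    (I := ⊥) ((RingHom.injective_iff_ker_eq_bot η.toRingHom).mp η.injective)]
  exact (Submodule.quotEquivOfEqBot ⊥ rfl).length_eq

/-- All fibres over rational points of an integral scheme which is finite and surjective over the
affine line have the same degree. -/
lemma exists_sum_fibre_eq {Y : Scheme.{u}} [IsIntegral Y] (p : Y ⟶ affineLine k) [IsFinite p]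
    [Surjective p] : ∃ N : ℕ, ∀ (a : k) [Fintype (ClosedPoint (pullback p (affineLinePoint k a)))],
      ∑ z : ClosedPoint (pullback p (affineLinePoint k a)),
        Module.length ((pullback p (affineLinePoint k a)).presheaf.stalk z.1)
          ((pullback p (affineLinePoint k a)).presheaf.stalk z.1) *
          ((pullback.snd p (affineLinePoint k a)).residueDegree z.1 : ℕ∞) = N := by
  have : IsAffine Y := isAffine_of_isAffineHom p
  let ψ := Spec.preimage (Y.isoSpec.inv ≫ p)
  have hψ : Spec.map ψ = Y.isoSpec.inv ≫ p := Spec.map_preimage _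
  have hfin : IsFinite (Spec.map ψ) := hψ ▸ inferInstance
  rw [IsFinite.SpecMap_iff] at hfin
  let : Algebra k[X] Γ(Y, ⊤) := ψ.hom.toAlgebra
  have : Module.Finite k[X] Γ(Y, ⊤) := hfin
  have hinj : Function.Injective (algebraMap k[X] Γ(Y, ⊤)) := by
    have h1 : toStalk p (genericPoint Y) =
        (Y.presheaf.germ ⊤ (genericPoint Y) trivial).hom.comp (algebraMap k[X] Γ(Y, ⊤)) := by
      refine toStalk_eq ?_
      change Spec.map (ψ ≫ Y.presheaf.germ ⊤ (genericPoint Y) trivial) = _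
      rw [Spec.map_comp, hψ, ← Scheme.fromSpecStalk_toSpecΓ]
      change (Y.fromSpecStalk (genericPoint Y) ≫ Y.isoSpec.hom) ≫ _ = _
      rw [Category.assoc, Iso.hom_inv_id_assoc]
    have h2 := injective_of_surjective p (genericHom_self_comp p)
    rw [h1] at h2
    exact .of_comp h2
  have : FaithfulSMul k[X] Γ(Y, ⊤) := (faithfulSMul_iff_algebraMap_injective _ _).mpr hinj
  have : Module.IsTorsionFree k[X] Γ(Y, ⊤) := inferInstance
  have : Module.Free k[X] Γ(Y, ⊤) := inferInstance
  refine ⟨Module.finrank k[X] Γ(Y, ⊤), fun a _ => ?_⟩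
  let : Algebra k[X] k := (evalRingHom a).toAlgebra
  have h1 := (isPullback_SpecMap_of_isPushout _ _ _ _
    (CommRingCat.isPushout_tensorProduct k[X] k Γ(Y, ⊤))).flip
  have h2 : IsPullback (Spec.map (CommRingCat.ofHom
      (Algebra.TensorProduct.includeRight : Γ(Y, ⊤) →ₐ[k[X]] k ⊗[k[X]] Γ(Y, ⊤)).toRingHom) ≫
        Y.isoSpec.inv)
      (Spec.map (CommRingCat.ofHom (algebraMap k (k ⊗[k[X]] Γ(Y, ⊤))))) p (affineLinePoint k a) :=
    h1.of_iso (Iso.refl _) Y.isoSpec.symm (Iso.refl _) (Iso.refl _) (by simp) (by simp)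
      (by
        rw [Iso.symm_hom, ← hψ, Iso.refl_hom, Category.comp_id]
        rfl)
      (by
        rw [Iso.refl_hom, Iso.refl_hom, Category.comp_id, Category.id_comp])
  have := discreteTopology_fibre p a
  rw [sum_length_mul_residueDegree _ (h2.isoPullback).symm (h2.isoPullback_inv_snd),
    Module.finrank_baseChange]

/-- The boundary of a finite correspondence whose image is a closed point vanishes. -/
lemma boundary_single_eq_zero {X : Scheme.{u}} (s : X ⟶ Spec (.of k)) [LocallyOfFiniteType s]
    [IsSeparated s] (W : FiniteCorrespondenceGenerator (cylinderProj s))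
    (hW : IsIntegral W.ideal.subscheme)
    (hcl : IsClosed ({(W.ideal.subschemeι ≫ pullback.fst s (affineLineToSpec k))
      (genericPoint W.ideal.subscheme)} : Set X)) :
    boundary s (Finsupp.single W 1) = 0 := by
  have := W.isFinite
  have := W.surjective
  obtain ⟨N, hN⟩ := exists_sum_fibre_eq (W.ideal.subschemeι ≫ cylinderProj s)
  set b := (W.ideal.subschemeι ≫ pullback.fst s (affineLineToSpec k))
      (genericPoint W.ideal.subscheme)
  have hb : ∀ y, (W.ideal.subschemeι ≫ pullback.fst s (affineLineToSpec k)) y = b := fun y =>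
    ((genericPoint_specializes y).map
      (W.ideal.subschemeι ≫ pullback.fst s (affineLineToSpec k)).continuous).mem_closed hcl rfl
  have key : ∀ a : k, ∃ c : ℤ, s.residueDegree b * c = N ∧
      pushforward (fibreToBase W a) (fundamentalCycle (fibreAt W a)) =
        Finsupp.single ⟨b, hcl⟩ c := fun a => by
    have := finite_fibre (W.ideal.subschemeι ≫ cylinderProj s) a
    let := Fintype.ofFinite (ClosedPoint (fibreAt W a))
    have hpt : ∀ z : ClosedPoint (fibreAt W a), z.map (fibreToBase W a) = ⟨b, hcl⟩ := fun z =>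
      Subtype.ext (by
        refine .trans ?_ (hb (pullback.fst (W.ideal.subschemeι ≫ cylinderProj s) (affineLinePoint k a) z.1))
        rw [← Scheme.Hom.comp_apply]
        rfl)
    rw [fundamentalCycle, finsum_eq_sum_of_fintype, map_sum]
    simp only [pushforward_single, hpt]
    rw [← Finsupp.single_finsetSum]
    refine ⟨_, ?_, rfl⟩
    have h1 := congrArg ENat.toNat (hN a)
    rw [ENat.toNat_sum] at h1
    · simp only [ENat.toNat_mul, ENat.toNat_natCast] at h1
      rw [← h1, Finset.mul_sum, Nat.cast_sum]
      refine Finset.sum_congr rfl fun z _ => ?_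
      have h2 : (fibreToBase W a) z.1 = b := congrArg Subtype.val (hpt z)
      have h3 := residueDegree_comp (fibreToBase W a) s z.1
      rw [fibreToBase_comp, h2] at h3
      rw [h3]
      push_cast
      ring
    · intro z _ h
      have h3 : ∑ z : ClosedPoint (fibreAt W a),
        Module.length ((fibreAt W a).presheaf.stalk z.1) ((fibreAt W a).presheaf.stalk z.1) *
          ((pullback.snd (W.ideal.subschemeι ≫ cylinderProj s)
            (affineLinePoint k a)).residueDegree z.1 : ℕ∞) = ⊤ :=
        WithTop.sum_eq_top.mpr ⟨z, Finset.mem_univ z, h⟩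
      exact absurd ((hN a).symm.trans h3) (ENat.natCast_ne_top N)
  obtain ⟨c, hc, hc'⟩ := key 0
  obtain ⟨d, hd, hd'⟩ := key 1
  have hdeg : (s.residueDegree b : ℤ) ≠ 0 := by exact_mod_cast residueDegree_ne_zero s hcl
  rw [boundary_single, hc', hd', mul_left_cancel₀ hdeg (hc.trans hd.symm), sub_self]

end Constant

/-! ### Relations for the reduced modulus -/

section ReducedRelations

open IsLocalRing

variable {X : Scheme.{u}}

/-- The subgroup of relations for the reduced modulus, generated by the cycles of the rational functions
with value `1` along `D`. -/
def reducedRelations (D : EffectiveCartierDivisor X) :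
    AddSubgroup (ZeroCycle (D.compl : Scheme.{u})) :=
  AddSubgroup.closure {z | ∃ (C : Scheme.{u}) (φ : C ⟶ X) (h : IsAdmissibleCurve D φ),
    haveI := h.isIntegral
    haveI := h.isLocallyNoetherian
    haveI := h.isFinite
    ∃ f : C.functionFieldˣ, IsOneAlong D φ f ∧ z = tau D φ f}

lemma mem_support_comap_iff (D : EffectiveCartierDivisor X) {C : Scheme.{u}} (φ : C ⟶ X)
    [QuasiCompact φ] {c : C} : c ∈ (D.ideal.comap φ).support ↔ φ c ∈ D.ideal.support := by
  rw [Scheme.IdealSheafData.support_comap]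
  rfl

lemma stalkIdeal_le_maximalIdeal {C : Scheme.{u}} (I : C.IdealSheafData) {c : C}
    (hc : c ∈ I.support) : stalkIdeal I c ≤ maximalIdeal (C.presheaf.stalk c) := by
  refine iSup₂_le fun U hU => Ideal.map_le_iff_le_comap.mpr fun a ha => ?_
  rw [Ideal.mem_comap, mem_maximalIdeal, mem_nonunits_iff]
  intro hu
  have h1 := (Scheme.IdealSheafData.mem_support_iff_of_mem hU).mp hc
  rw [Scheme.mem_zeroLocus_iff] at h1
  exact h1 a ha ((C.mem_basicOpen a c hU).mpr hu)

lemma stalkIdeal_ne_bot {C : Scheme.{u}} [IsIntegral C] (I : C.IdealSheafData)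
    (h : genericPoint C ∉ I.support) (c : C) : stalkIdeal I c ≠ ⊥ := by
  obtain ⟨_, ⟨U, hU, rfl⟩, hcU, -⟩ := C.isBasis_affineOpens.exists_subset_of_mem_open
    (Set.mem_univ c) isOpen_univ
  have hgU : genericPoint C ∈ U := (genericPoint_specializes c).mem_open U.2 hcU
  rw [Scheme.IdealSheafData.mem_support_iff_of_mem (U := ⟨U, hU⟩) hgU, Scheme.mem_zeroLocus_iff] at h
  push Not at h
  obtain ⟨a, ha, hga⟩ := h
  have ha0 : a ≠ 0 := fun h0 => by
    rw [h0, Scheme.basicOpen_zero] at hga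
    exact hga
  intro hbot
  have h1 : C.presheaf.germ U c hcU a ∈ stalkIdeal I c :=
    le_iSup₂ (f := fun (U : C.affineOpens) (hU : c ∈ U.1) =>
      (I.ideal U).map (C.presheaf.germ U.1 c hU).hom) ⟨U, hU⟩ hcU (Ideal.mem_map_of_mem _ ha)
  rw [hbot, Ideal.mem_bot] at h1
  exact ha0 (germ_injective_of_isIntegral C c hcU (h1.trans (map_zero _).symm))

/-- The modulus condition for `f` in terms of `f - 1`. Invertibility of `f` at the points of the divisor
is automatic. -/
lemma mem_modulusGroup_iff {C : Scheme.{u}} [IsIntegral C] (I : C.IdealSheafData)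
    (f : C.functionFieldˣ) : f ∈ modulusGroup I ↔ ∀ c ∈ I.support, ∃ h ∈ stalkIdeal I c,
      algebraMap (C.presheaf.stalk c) C.functionField h = f - 1 := by
  simp only [modulusGroup, Subgroup.mem_iInf, Subgroup.mem_map, MonoidHom.mem_ker]
  refine forall₂_congr fun c hc => ⟨?_, ?_⟩
  · rintro ⟨v, hv, rfl⟩
    refine ⟨v - 1, ?_, ?_⟩
    · rw [← Ideal.Quotient.eq_zero_iff_mem, map_sub, map_one, sub_eq_zero]
      exact congrArg Units.val hv
    · rw [map_sub, map_one]
      rfl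
  · rintro ⟨h, hh, hf⟩
    have hu : IsUnit (1 + h) := by
      by_contra hu
      have := Ideal.sub_mem _ ((mem_maximalIdeal _).mpr hu) (stalkIdeal_le_maximalIdeal I hc hh)
      rw [add_sub_cancel_right] at this
      exact (Ideal.ne_top_iff_one _).mp (maximalIdeal.isMaximal _).ne_top this
    refine ⟨hu.unit, Units.ext ?_, Units.ext ?_⟩
    · change Ideal.Quotient.mk _ (1 + h) = 1
      rw [map_add, map_one, Ideal.Quotient.eq_zero_iff_mem.mpr hh, add_zero]
    · change algebraMap _ _ (1 + h) = f.1
      rw [map_add, map_one, hf, add_sub_cancel]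

lemma isOneAlong_of_mem_modulusGroup (D : EffectiveCartierDivisor X) {C : Scheme.{u}} [IsIntegral C]
    (φ : C ⟶ X) [QuasiCompact φ] {f : C.functionFieldˣ}
    (hf : f ∈ modulusGroup (D.ideal.comap φ)) : IsOneAlong D φ f := fun c hc => by
  have hc := (mem_support_comap_iff D φ).mpr hc
  obtain ⟨h, hh, hhf⟩ := (mem_modulusGroup_iff _ f).mp hf c hc
  exact ⟨h, stalkIdeal_le_maximalIdeal _ hc hh, hhf⟩

lemma modulusRelations_le_reducedRelations (D : EffectiveCartierDivisor X) :
    modulusRelations D ≤ reducedRelations D := by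
  refine AddSubgroup.closure_mono ?_
  rintro z ⟨C, φ, h, f, hf, rfl⟩
  have := h.isIntegral
  have := h.isFinite
  exact ⟨C, φ, h, f, isOneAlong_of_mem_modulusGroup D φ hf, rfl⟩

variable {k : Type u} [Field k] (s : X ⟶ Spec (.of k)) [IsProper s]

/-- The relations for the reduced modulus are the boundaries of finite correspondences. -/
theorem range_boundary_eq_reducedRelations (D : EffectiveCartierDivisor X) :
    (boundary (D.compl.ι ≫ s)).range = reducedRelations D := by
  refine le_antisymm ?_ ((AddSubgroup.closure_le _).mpr ?_)
  · have hW : ∀ W, boundary (D.compl.ι ≫ s) (Finsupp.single W 1) ∈ reducedRelations D := fun W => by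
      have := W.isIntegral
      by_cases hcl : IsClosed ({(W.ideal.subschemeι ≫ pullback.fst (D.compl.ι ≫ s)
          (affineLineToSpec k)) (genericPoint W.ideal.subscheme)} : Set D.compl)
      · rw [boundary_single_eq_zero _ W W.isIntegral hcl]
        exact zero_mem _
      · obtain ⟨C, φ, h, f, hf, hf'⟩ := exists_tau_eq_boundary_of_not_isClosed s D W W.isIntegral
          fun hcl' => hcl (by
            have h1 := hcl'.preimage D.compl.ι.continuous
            rw [Scheme.Hom.comp_apply, ← Set.image_singleton,
              Set.preimage_image_eq _ D.compl.ι.injective] at h1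
            exact h1)
        exact AddSubgroup.subset_closure ⟨C, φ, h, f, hf, hf'⟩
    rintro _ ⟨x, rfl⟩
    induction x using Finsupp.induction_linear with
    | zero => rw [map_zero]; exact zero_mem _
    | add x y hx hy => rw [map_add]; exact add_mem hx hy
    | single W n =>
      rw [← mul_one n, ← smul_eq_mul, ← Finsupp.smul_single, map_zsmul]
      exact zsmul_mem (hW W) n
  · rintro z ⟨C, φ, h, f, hf, rfl⟩
    have := h.isIntegral
    have := h.isLocallyNoetherian
    have := h.isFinite
    exact tau_mem_range_boundary s D φ h.dim_eq_one.le h.normal f hf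

end ReducedRelations

/-! ### Powers and roots of functions with value one along the divisor -/

section Tau

variable {X C : Scheme.{u}} (D : EffectiveCartierDivisor X) (φ : C ⟶ X) [IsFinite φ] [IsIntegral C]
  [IsLocallyNoetherian C]

lemma divOn_mul [CompactSpace C] (hC : topologicalKrullDim C ≤ 1) (U : C.Opens)
    (f g : C.functionFieldˣ) : divOn U (f * g) = divOn U f + divOn U g := by
  rw [divOn, divOn, divOn, ← finsum_add_distrib]
  · exact finsum_congr fun c => by
      rw [Units.val_mul, Scheme.ord_mul f.ne_zero g.ne_zero, Finsupp.single_add]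
  · exact (finite_closedPoint_ord_ne_zero hC U f.ne_zero).subset fun c hc h0 => hc (by
      simp only [h0, Finsupp.single_zero])
  · exact (finite_closedPoint_ord_ne_zero hC U g.ne_zero).subset fun c hc h0 => hc (by
      simp only [h0, Finsupp.single_zero])

/-- The cycle `τ_C` as a homomorphism on the multiplicative group of the function field. -/
def tauHom [CompactSpace C] (hC : topologicalKrullDim C ≤ 1) :
    C.functionFieldˣ →* Multiplicative (ZeroCycle (D.compl : Scheme.{u})) :=
  MonoidHom.mk' (fun f => .ofAdd (tau D φ f)) fun f g => by
    rw [← ofAdd_add, tau, divOn_mul hC, map_add]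
    rfl

lemma tau_mul [CompactSpace C] (hC : topologicalKrullDim C ≤ 1) (f g : C.functionFieldˣ) :
    tau D φ (f * g) = tau D φ f + tau D φ g :=
  congrArg Multiplicative.toAdd (map_mul (tauHom D φ hC) f g)

lemma tau_pow [CompactSpace C] (hC : topologicalKrullDim C ≤ 1) (f : C.functionFieldˣ) (n : ℕ) :
    tau D φ (f ^ n) = n • tau D φ f :=
  congrArg Multiplicative.toAdd (map_pow (tauHom D φ hC) f n)

end Tau

section Roots

open IsLocalRing Polynomial

/-- The truncated binomial series: `1 + T` is an `n`-th power modulo every power of `T`. -/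
lemma exists_X_pow_dvd_sub_pow {k : Type*} [Field k] {n : ℕ} (hn : (n : k) ≠ 0) (N : ℕ) :
    ∃ P : k[X], X ∣ P - 1 ∧ X ^ (N + 1) ∣ 1 + X - P ^ n := by
  induction N with
  | zero => exact ⟨1, by simp, by simp⟩
  | succ N ih =>
    obtain ⟨P, hP, Q, hQ⟩ := ih
    obtain ⟨z, hz⟩ := powAddExpansion P (X ^ (N + 1) * C (Q.eval 0 / n)) n
    have hP1 : P.eval 0 = 1 := by
      rw [X_dvd_iff, coeff_zero_eq_eval_zero, eval_sub, eval_one, sub_eq_zero] at hP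
      exact hP
    -- the correction term makes the coefficient of `X ^ (N + 1)` in the remainder vanish
    refine ⟨P + X ^ (N + 1) * C (Q.eval 0 / n), ?_, ?_⟩
    · rw [add_sub_right_comm]
      exact dvd_add hP (Dvd.dvd.mul_right (dvd_pow_self _ N.succ_ne_zero) _)
    · have h1 : 1 + X - (P + X ^ (N + 1) * C (Q.eval 0 / n)) ^ n = X ^ (N + 1) *
          (Q - (n : k[X]) * P ^ (n - 1) * C (Q.eval 0 / n) -
            z * X ^ (N + 1) * C (Q.eval 0 / n) ^ 2) := by
        rw [hz]
        linear_combination hQ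
      rw [h1, pow_succ X (N + 1)]
      refine mul_dvd_mul_left _ ?_
      rw [X_dvd_iff, coeff_zero_eq_eval_zero]
      simp [hP1, mul_div_cancel₀ _ hn]

variable {k : Type u} [Field k] {X C : Scheme.{u}} (D : EffectiveCartierDivisor X)

lemma genericPoint_notMem_support (φ : C ⟶ X) (h : IsAdmissibleCurve D φ) :
    haveI := h.isIntegral
    genericPoint C ∉ (D.ideal.comap φ).support := by
  have := h.isIntegral
  have := h.isFinite
  rw [mem_support_comap_iff]
  refine fun hg => h.not_subset ?_
  rintro _ ⟨c, rfl⟩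
  exact ((genericPoint_specializes c).map φ.continuous).mem_closed D.ideal.support.isClosed hg

/-- On an admissible curve, a bounded power of the maximal ideal at a point above `D` is contained
in the ideal of the divisor. -/
lemma exists_pow_mem_stalkIdeal [CompactSpace C] (φ : C ⟶ X) (h : IsAdmissibleCurve D φ) :
    ∃ N : ℕ, ∀ c ∈ (D.ideal.comap φ).support, ∀ a ∈ maximalIdeal (C.presheaf.stalk c),
      ∀ n, N ≤ n → a ^ n ∈ stalkIdeal (D.ideal.comap φ) c := by
  have := h.isIntegral
  have := h.isLocallyNoetherian
  have := h.isFinite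
  have : IsNoetherian C := { }
  have hg := genericPoint_notMem_support D φ h
  have hfin : ((D.ideal.comap φ).support : Set C).Finite :=
    finite_of_isClosed_of_notMem h.dim_eq_one.le (D.ideal.comap φ).support.isClosed hg
  have hloc : ∀ c ∈ (D.ideal.comap φ).support, ∃ N : ℕ,
      ∀ a ∈ maximalIdeal (C.presheaf.stalk c), a ^ N ∈ stalkIdeal (D.ideal.comap φ) c := by
    intro c hc
    have hcg : c ≠ genericPoint C := fun hcg => hg (hcg ▸ hc)
    have := h.normal c
    have := isDiscreteValuationRing_stalk (coheight_eq_one_of_ne_genericPoint h.dim_eq_one.le hcg)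
    obtain ⟨ϖ, hϖ⟩ := IsDiscreteValuationRing.exists_irreducible (C.presheaf.stalk c)
    obtain ⟨N, hN⟩ := IsDiscreteValuationRing.ideal_eq_span_pow_irreducible
      (stalkIdeal_ne_bot (D.ideal.comap φ) hg c) hϖ
    refine ⟨N, fun a ha => ?_⟩
    rw [hϖ.maximalIdeal_eq, Ideal.mem_span_singleton] at ha
    rw [hN, Ideal.mem_span_singleton]
    exact pow_dvd_pow_of_dvd ha N
  choose! N hN using hloc
  obtain ⟨M, hM⟩ := (hfin.image N).bddAbove
  exact ⟨M, fun c hc a ha n hn =>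
    Ideal.pow_mem_of_pow_mem _ (hN c hc a ha) ((hM ⟨c, hc, rfl⟩).trans hn)⟩

/-- In characteristic `p`, a sufficiently high `p`-power of a function with value one along `D`
satisfies the modulus condition, as `f ^ (p ^ m) - 1 = (f - 1) ^ (p ^ m)`. -/
lemma exists_pow_char_pow_mem_modulusGroup [CompactSpace C] (s : X ⟶ Spec (.of k))
    (φ : C ⟶ X) (h : IsAdmissibleCurve D φ) {p : ℕ} (hp : p.Prime) [CharP k p] :
    haveI := h.isIntegral
    ∀ f : C.functionFieldˣ, IsOneAlong D φ f →
      ∃ m : ℕ, f ^ p ^ m ∈ modulusGroup (D.ideal.comap φ) := by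
  have := h.isIntegral
  have := h.isFinite
  intro f hf
  obtain ⟨N, hN⟩ := exists_pow_mem_stalkIdeal D φ h
  have : Fact p.Prime := ⟨hp⟩
  have : CharP C.functionField p :=
    charP_of_injective_ringHom (toStalk (φ ≫ s) (genericPoint C)).injective p
  refine ⟨N, (mem_modulusGroup_iff _ _).mpr fun c hc => ?_⟩
  obtain ⟨a, ha, haf⟩ := hf c ((mem_support_comap_iff D φ).mp hc)
  refine ⟨a ^ p ^ N, hN c hc a ha _ (Nat.lt_pow_self hp.one_lt).le, ?_⟩
  rw [map_pow, haf, sub_pow_char_pow, one_pow, Units.val_pow_eq_pow_val]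

/-- In characteristic zero, a function with value one along `D` is an `n`-th power of such a
function up to a function which satisfies the modulus condition. -/
lemma exists_div_pow_mem_modulusGroup [CharZero k] [CompactSpace C] (s : X ⟶ Spec (.of k))
    (φ : C ⟶ X) (h : IsAdmissibleCurve D φ)
    {n : ℕ} (hn : n ≠ 0) :
    haveI := h.isIntegral
    ∀ f : C.functionFieldˣ, IsOneAlong D φ f → ∃ g : C.functionFieldˣ, IsOneAlong D φ g ∧
      f / g ^ n ∈ modulusGroup (D.ideal.comap φ) := by
  have := h.isIntegral
  have := h.isFinite
  intro f hf
  obtain ⟨N, hN⟩ := exists_pow_mem_stalkIdeal D φ h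
  obtain ⟨P, ⟨P₁, hP₁⟩, Q, hQ⟩ := exists_X_pow_dvd_sub_pow (k := k) (Nat.cast_ne_zero.mpr hn) N
  let q := φ ≫ s
  let K := C.functionField
  let : Algebra k K := stalkAlgebra q (genericPoint C)
  have hk : genericHom K C ≫ q = Spec.map (CommRingCat.ofHom (algebraMap k K)) :=
    genericHom_self_comp q
  let ev (c : C) (a : C.presheaf.stalk c) (R : k[X]) : C.presheaf.stalk c :=
    R.eval₂ (toStalk q c) a
  let g : K := P.eval₂ (algebraMap k K) (f - 1)
  have hev : ∀ c (a : C.presheaf.stalk c), algebraMap _ K a = f - 1 →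
      algebraMap _ K (ev c a P) = g := fun c a haf => by
    rw [hom_eval₂, haf]
    exact congrArg (fun β => P.eval₂ β _) (RingHom.ext fun x => algebraMap_toStalk q hk c x)
  have hmem : ∀ c (a : C.presheaf.stalk c), a ∈ maximalIdeal (C.presheaf.stalk c) →
      ev c a P - 1 ∈ maximalIdeal (C.presheaf.stalk c) := fun c a ha => by
    have h1 := congrArg (eval₂ (toStalk q c) a) hP₁
    rw [eval₂_sub, eval₂_one, eval₂_mul, eval₂_X] at h1
    exact h1 ▸ Ideal.mul_mem_right _ _ ha
  have hunit : ∀ c (a : C.presheaf.stalk c), a ∈ maximalIdeal (C.presheaf.stalk c) →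
      IsUnit (ev c a P) := fun c a ha => by
    by_contra hu
    have h1 := Ideal.sub_mem _ ((mem_maximalIdeal _).mpr hu) (hmem c a ha)
    rw [sub_sub_cancel] at h1
    exact (Ideal.ne_top_iff_one _).mp (maximalIdeal.isMaximal _).ne_top h1
  by_cases hg : g = 0
  · -- This happens only if the curve does not meet `D`, and then there is no modulus condition.
    have hempty : ∀ c, φ c ∉ D.ideal.support := fun c hc => by
      obtain ⟨a, ha, haf⟩ := hf c hc
      have h1 := (hunit c a ha).map (algebraMap _ K)
      rw [hev c a haf] at h1
      exact h1.ne_zero hg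
    exact ⟨1, fun c hc => absurd hc (hempty c), (mem_modulusGroup_iff _ _).mpr fun c hc =>
      absurd ((mem_support_comap_iff D φ).mp hc) (hempty c)⟩
  refine ⟨Units.mk0 g hg, fun c hc => ?_, (mem_modulusGroup_iff _ _).mpr fun c hc => ?_⟩
  · obtain ⟨a, ha, haf⟩ := hf c hc
    exact ⟨_, hmem c a ha, by rw [map_sub, map_one, hev c a haf]; rfl⟩
  · obtain ⟨a, ha, haf⟩ := hf c ((mem_support_comap_iff D φ).mp hc)
    obtain ⟨v, hv⟩ := (hunit c a ha).exists_right_inv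
    have h1 := congrArg (eval₂ (toStalk q c) a) hQ
    simp only [eval₂_sub, eval₂_add, eval₂_one, eval₂_X, eval₂_pow, eval₂_mul] at h1
    have hmem' : 1 + a - ev c a P ^ n ∈ stalkIdeal (D.ideal.comap φ) c :=
      h1 ▸ Ideal.mul_mem_right _ _ (hN c hc a ha _ N.le_succ)
    refine ⟨_, Ideal.mul_mem_right (v ^ n) _ hmem', ?_⟩
    have hv' : g * algebraMap _ K v = 1 := by rw [← hev c a haf, ← map_mul, hv, map_one]
    have hv'' : g ^ n * algebraMap _ K v ^ n = 1 := by rw [← mul_pow, hv', one_pow]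
    rw [map_mul, map_sub, map_add, map_one, map_pow, map_pow, haf, hev c a haf, add_sub_cancel,
      sub_mul, hv'', Units.val_div_eq_div_val, Units.val_pow_eq_pow_val, Units.val_mk0]
    refine congrArg (· - 1) (eq_div_of_mul_eq (pow_ne_zero n hg) ?_)
    rw [mul_assoc, mul_comm _ (g ^ n)]
    exact (congrArg _ hv'').trans (mul_one _)

/-- In positive characteristic `p`, the relations for the reduced modulus are killed by powers of
`p` modulo the relations for the modulus. -/
theorem exists_pow_smul_mem_modulusRelations (s : X ⟶ Spec (.of k)) [IsProper s] {p : ℕ} (hp : p.Prime)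
    [CharP k p] {z : ZeroCycle (D.compl : Scheme.{u})} (hz : z ∈ reducedRelations D) :
    ∃ m : ℕ, p ^ m • z ∈ modulusRelations D := by
  induction hz using AddSubgroup.closure_induction with
  | mem z hz =>
    obtain ⟨C, φ, h, f, hf, rfl⟩ := hz
    have := h.isIntegral
    have := h.isLocallyNoetherian
    have := h.isFinite
    have : CompactSpace C := QuasiCompact.compactSpace_of_compactSpace (φ ≫ s)
    obtain ⟨m, hm⟩ := exists_pow_char_pow_mem_modulusGroup D s φ h hp f hf
    exact ⟨m, AddSubgroup.subset_closure
      ⟨C, φ, h, f ^ p ^ m, hm, (tau_pow D φ h.dim_eq_one.le f _).symm⟩⟩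
  | zero => exact ⟨0, by rw [smul_zero]; exact zero_mem _⟩
  | add x y _ _ hx hy =>
    obtain ⟨a, ha⟩ := hx
    obtain ⟨b, hb⟩ := hy
    refine ⟨a + b, ?_⟩
    rw [smul_add]
    refine add_mem ?_ ?_
    · rw [pow_add, mul_comm, mul_smul]
      exact nsmul_mem ha _
    · rw [pow_add, mul_smul]
      exact nsmul_mem hb _
  | neg x _ hx =>
    obtain ⟨a, ha⟩ := hx
    exact ⟨a, by rw [smul_neg]; exact neg_mem ha⟩

/-- In characteristic zero, the relations for the reduced modulus are divisible modulo the relations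
for the modulus. -/
theorem exists_sub_smul_mem_modulusRelations [CharZero k] (s : X ⟶ Spec (.of k)) [IsProper s]
    {n : ℕ} (hn : n ≠ 0)
    {z : ZeroCycle (D.compl : Scheme.{u})} (hz : z ∈ reducedRelations D) :
    ∃ y ∈ reducedRelations D, z - n • y ∈ modulusRelations D := by
  induction hz using AddSubgroup.closure_induction with
  | mem z hz =>
    obtain ⟨C, φ, h, f, hf, rfl⟩ := hz
    have := h.isIntegral
    have := h.isLocallyNoetherian
    have := h.isFinite
    have : CompactSpace C := QuasiCompact.compactSpace_of_compactSpace (φ ≫ s)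
    obtain ⟨g, hg, hfg⟩ := exists_div_pow_mem_modulusGroup D s φ h hn f hf
    refine ⟨_, AddSubgroup.subset_closure ⟨C, φ, h, g, hg, rfl⟩,
      AddSubgroup.subset_closure ⟨C, φ, h, _, hfg, ?_⟩⟩
    rw [← tau_pow D φ h.dim_eq_one.le, sub_eq_iff_eq_add, ← tau_mul D φ h.dim_eq_one.le,
      div_mul_cancel]
  | zero => exact ⟨0, zero_mem _, by rw [smul_zero, sub_zero]; exact zero_mem _⟩
  | add x y _ _ hx hy =>
    obtain ⟨a, ha, ha'⟩ := hx
    obtain ⟨b, hb, hb'⟩ := hy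
    exact ⟨a + b, add_mem ha hb, by rw [smul_add, add_sub_add_comm]; exact add_mem ha' hb'⟩
  | neg x _ hx =>
    obtain ⟨a, ha, ha'⟩ := hx
    exact ⟨-a, neg_mem ha, by rw [smul_neg, neg_sub_neg, ← neg_sub]; exact neg_mem ha'⟩

end Roots

end ZeroCyclesWithModulus

end

theorem mainTheorem1 {k : Type u} [Field k] {X : Scheme.{u}}
    (s : X ⟶ Spec (CommRingCat.of k)) [IsProper s] (D : EffectiveCartierDivisor X) :
    ∃ π : ChowGroupWithModulus D →+ SuslinHomologyZero (D.compl.ι ≫ s),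
      (∀ z : ZeroCycle (D.compl : Scheme.{u}),
        π (QuotientAddGroup.mk z) = QuotientAddGroup.mk z) ∧
      Function.Surjective π ∧
      (CharZero k → ∀ n : ℕ, n ≠ 0 → ∀ x : π.ker, ∃ y : π.ker, n • y = x) ∧
      (∀ p : ℕ, p.Prime → CharP k p → ∀ x : π.ker, ∃ m : ℕ, p ^ m • x = 0) := by
  have hrange := range_boundary_eq_reducedRelations s D
  let π : ChowGroupWithModulus D →+ SuslinHomologyZero (D.compl.ι ≫ s) :=
    QuotientAddGroup.map _ _ (AddMonoidHom.id _)
      ((modulusRelations_le_reducedRelations D).trans hrange.ge)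
  have hπ : ∀ z : ZeroCycle (D.compl : Scheme.{u}),
      π (QuotientAddGroup.mk z) = QuotientAddGroup.mk z := fun z => rfl
  have hker : ∀ z : ZeroCycle (D.compl : Scheme.{u}),
      QuotientAddGroup.mk z ∈ π.ker ↔ z ∈ reducedRelations D := fun z => by
    rw [AddMonoidHom.mem_ker, hπ, QuotientAddGroup.eq_zero_iff, hrange]
  refine ⟨π, hπ, fun y => ?_, fun _ n hn => ?_, fun p hp _ => ?_⟩
  · obtain ⟨z, rfl⟩ := QuotientAddGroup.mk_surjective y
    exact ⟨QuotientAddGroup.mk z, hπ z⟩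
  · rintro ⟨x, hx⟩
    obtain ⟨z, rfl⟩ := QuotientAddGroup.mk_surjective x
    obtain ⟨y, hy, hyz⟩ := exists_sub_smul_mem_modulusRelations D s hn ((hker z).mp hx)
    refine ⟨⟨QuotientAddGroup.mk y, (hker y).mpr hy⟩, Subtype.ext ?_⟩
    rw [← QuotientAddGroup.eq_zero_iff, QuotientAddGroup.mk_sub, sub_eq_zero] at hyz
    exact hyz.symm
  · rintro ⟨x, hx⟩
    obtain ⟨z, rfl⟩ := QuotientAddGroup.mk_surjective x
    obtain ⟨m, hm⟩ := exists_pow_smul_mem_modulusRelations D s hp ((hker z).mp hx)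
    exact ⟨m, Subtype.ext ((QuotientAddGroup.eq_zero_iff _).mpr hm)⟩
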